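/- **Theorem 3.1.** Let $a,b,c\in\mathbb R$ with $a^2>0$, $c^2>0$, let $k\in\mathbb Z\setminus\{0\}$, let $L>0$ and $0<R<\infty$, and put $$s_+=\frac{b^2+\sqrt{b^4+24a^2c^2}}{4c^2}.$$ For functions $u,v$ on $[0,R]$ let $$\mathcal E(u,v)=\int_0^R\Big[\tfrac12\Big((u')^2+(v')^2+\tfrac{k^2}{r^2}u^2\Big)-\tfrac{a^2}{2L}(u^2+v^2)+\tfrac{c^2}{4L}(u^2+v^2)^2\Big]r\,dr-\frac{b^2}{3L\sqrt6}\int_0^R v(v^2-3u^2)\,r\,dr,$$ and let $S$ be the set of pairs $(u,v)$ of real functions on $[0,R]$, locally absolutely continuous on $(0,R]$ (that is, locally Sobolev functions, taken in their continuous representatives), with $$\sqrt r\,u',\ \sqrt r\,v',\ \frac{u}{\sqrt r},\ \sqrt r\,v\in L^2(0,R),\qquad u(R)=\frac{s_+}{\sqrt2},\quad v(R)=-\frac{s_+}{\sqrt6}.$$ Then there is a pair $(u,v)\in S$ that minimises $\mathcal E$ over $S$, with $$u\in C^\infty(0,R)\cap C([0,R]),\qquad v\in C^\infty(0,R)\cap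 C^1([0,R]),$$ and which satisfies, for all $r\in(0,R)$, $$u''+\frac{u'}r-\frac{k^2u}{r^2}=\frac uL\Big[-a^2+\sqrt{\tfrac23}\,b^2v+c^2(u^2+v^2)\Big],$$ $$v''+\frac{v'}r=\frac vL\Big[-a^2-\tfrac1{\sqrt6}b^2v+c^2(u^2+v^2)\Big]+\frac{1}{\sqrt6\,L}b^2u^2,$$ together with the boundary conditions $$u(0)=0,\quad v'(0)=0,\quad u(R)=\tfrac1{\sqrt2}s_+,\quad v(R)=-\tfrac1{\sqrt6}s_+.$$ Moreover, let $B_R\subset\mathbb R^2$ be the open disk of radius $R$ centred at $0$, let $\mathcal S_0$ be the space of symmetric traceless real $3\times3$ matrices, and write, in polar coordinates $(r,\varphi)$, $$Y=u(r)F_n(\varphi)+v(r)F_3,\qquad F_n(\varphi)=\sqrt2\big(n(\varphi)\otimes n(\varphi)-\tfrac12 I_2\big),\qquad F_3=\sqrt{\tfrac32}\big(e_3\otimes e_3-\tfrac13I\big),$$ where $n(\varphi)=(\cos\frac{k\varphi}2,\sin\frac{k\varphi}2,0)$ and $I_2=e_1\otimes e_1+e_2\otimes e_2$. Then $Y$ is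 continuous on $\overline{B_R}$, satisfies $Y=s_+\big(n(\varphi)\otimes n(\varphi)-\frac13I\big)$ on $\partial B_R$, belongs to $H^1(B_R;\mathcal S_0)$, and is a critical point of the Landau–de Gennes energy $$\mathcal F[Q]=\int_{B_R}\tfrac12|\nabla Q|^2+\tfrac1L\Big(-\tfrac{a^2}2|Q|^2-\tfrac{b^2}3\operatorname{tr}(Q^3)+\tfrac{c^2}4|Q|^4\Big)dx,\qquad |Q|^2=\operatorname{tr}(Q^2),$$ that is, $\frac{d}{dt}\mathcal F[Y+tP]\big|_{t=0}=0$ for every $P\in C_c^\infty(B_R;\mathcal S_0)$. -/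

import Mathlib

open Set MeasureTheory
open scoped ContDiff Matrix

noncomputable section

namespace LdG

/-- The preferred scalar order parameter
`s₊ = (b² + √(b⁴ + 24 a² c²)) / (4 c²)`. -/
def sPlus (a b c : ℝ) : ℝ :=
  (b ^ 2 + √(b ^ 4 + 24 * a ^ 2 * c ^ 2)) / (4 * c ^ 2)

/-- The reduced one-dimensional energy `ℰ(u, v)` on `(0, R)`. On the admissible set below, `deriv`
is the almost everywhere defined (equivalently, weak) derivative. -/
def reducedEnergy (L R a b c : ℝ) (k : ℤ) (u v : ℝ → ℝ) : ℝ :=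
  (∫ r in (0 : ℝ)..R,
      (1 / 2 * ((deriv u r) ^ 2 + (deriv v r) ^ 2 + (k : ℝ) ^ 2 / r ^ 2 * (u r) ^ 2)
        - a ^ 2 / (2 * L) * ((u r) ^ 2 + (v r) ^ 2)
        + c ^ 2 / (4 * L) * ((u r) ^ 2 + (v r) ^ 2) ^ 2) * r)
    - b ^ 2 / (3 * L * √6) * ∫ r in (0 : ℝ)..R, v r * ((v r) ^ 2 - 3 * (u r) ^ 2) * r

/-- `w` is locally absolutely continuous on `(0, R]`. In one dimension these are exactly the
continuous representatives of the functions with a locally integrable weak derivative (up to `R`),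
and the weak derivative is `deriv w`; the value `w R` is the trace at `R`. -/
def LocallyAC (R : ℝ) (w : ℝ → ℝ) : Prop :=
  ∀ ε ∈ Ioo 0 R, AbsolutelyContinuousOnInterval w ε R

/-- The weighted admissible set `S`: pairs `(u, v)` with
`√r u', √r v', u / √r, √r v ∈ L²(0, R)`, `u(R) = s₊ / √2` and `v(R) = - s₊ / √6`. -/
def admissible (R a b c : ℝ) : Set ((ℝ → ℝ) × (ℝ → ℝ)) :=
  {p | LocallyAC R p.1 ∧ LocallyAC R p.2 ∧
    MemLp (fun r => √r * deriv p.1 r) 2 (volume.restrict (Ioo 0 R)) ∧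
    MemLp (fun r => √r * deriv p.2 r) 2 (volume.restrict (Ioo 0 R)) ∧
    MemLp (fun r => p.1 r / √r) 2 (volume.restrict (Ioo 0 R)) ∧
    MemLp (fun r => √r * p.2 r) 2 (volume.restrict (Ioo 0 R)) ∧
    p.1 R = sPlus a b c / √2 ∧ p.2 R = -(sPlus a b c / √6)}

/-- The system of ordinary differential equations on `(0, R)`. -/
def SolvesODE (L R a b c : ℝ) (k : ℤ) (u v : ℝ → ℝ) : Prop :=
  ∀ r ∈ Ioo 0 R,
    deriv (deriv u) r + deriv u r / r - (k : ℝ) ^ 2 * u r / r ^ 2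
        = u r / L * (-a ^ 2 + √(2 / 3) * b ^ 2 * v r + c ^ 2 * ((u r) ^ 2 + (v r) ^ 2)) ∧
    deriv (deriv v) r + deriv v r / r
        = v r / L * (-a ^ 2 - 1 / √6 * b ^ 2 * v r + c ^ 2 * ((u r) ^ 2 + (v r) ^ 2))
          + 1 / (√6 * L) * b ^ 2 * (u r) ^ 2

/-- The plane with its Euclidean norm. -/
abbrev Plane := EuclideanSpace ℝ (Fin 2)

/-- Real `3 × 3` matrices. -/
abbrev Mat3 := Matrix (Fin 3) (Fin 3) ℝ

/-- The space `𝒮₀` of `Q`-tensors: symmetric traceless real `3 × 3` matrices. -/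
def QTensors : Set Mat3 := {Q | Qᵀ = Q ∧ Q.trace = 0}

/-- `g` is the weak partial derivative of `f` on the open set `Ω` in the `m`-th direction. -/
def HasWeakPartial (Ω : Set Plane) (m : Fin 2) (f g : Plane → ℝ) : Prop :=
  LocallyIntegrableOn f Ω ∧ LocallyIntegrableOn g Ω ∧
    ∀ φ : Plane → ℝ, ContDiff ℝ ∞ φ → HasCompactSupport φ → tsupport φ ⊆ Ω →
      ∫ x in Ω, f x * fderiv ℝ φ x (EuclideanSpace.single m 1) = -∫ x in Ω, g x * φ x

open Classical in
/-- The weak partial derivative (unique almost everywhere on `Ω`), and `0` if there is none. -/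
def weakPartial (Ω : Set Plane) (m : Fin 2) (f : Plane → ℝ) : Plane → ℝ :=
  if h : ∃ g, HasWeakPartial Ω m f g then h.choose else 0

/-- The scalar Sobolev space `H¹(Ω)`. -/
def MemH1 (Ω : Set Plane) (f : Plane → ℝ) : Prop :=
  MemLp f 2 (volume.restrict Ω) ∧
    ∀ m, ∃ g, HasWeakPartial Ω m f g ∧ MemLp g 2 (volume.restrict Ω)

/-- The Sobolev space `H¹(Ω; 𝒮₀)` of `Q`-tensor fields. -/
def MemH1Q (Ω : Set Plane) (Q : Plane → Mat3) : Prop :=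
  (∀ x ∈ Ω, Q x ∈ QTensors) ∧ ∀ i j, MemH1 Ω (fun x => Q x i j)

/-- The squared norm `|Q|² = tr(Q²)`. -/
def normSqQ (Q : Mat3) : ℝ := (Q ^ 2).trace

/-- The bulk energy density `f(Q) = -a²/2 |Q|² - b²/3 tr(Q³) + c²/4 |Q|⁴`. -/
def bulk (a b c : ℝ) (Q : Mat3) : ℝ :=
  -(a ^ 2 / 2) * normSqQ Q - b ^ 2 / 3 * (Q ^ 3).trace + c ^ 2 / 4 * (normSqQ Q) ^ 2

/-- The Landau–de Gennes energy `ℱ[Q] = ∫_Ω ½ |∇Q|² + (1/L) f(Q)` on `H¹(Ω; 𝒮₀)`. -/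
def energy (L a b c : ℝ) (Ω : Set Plane) (Q : Plane → Mat3) : ℝ :=
  ∫ x in Ω, (1 / 2 * ∑ m, ∑ i, ∑ j, (weakPartial Ω m (fun y => Q y i j) x) ^ 2
    + 1 / L * bulk a b c (Q x))

/-- Admissible variations: smooth `Q`-tensor fields with compact support in `Ω`. -/
def IsTestField (Ω : Set Plane) (P : Plane → Mat3) : Prop :=
  (∀ x, P x ∈ QTensors) ∧
    ∀ i j, ContDiff ℝ ∞ (fun x => P x i j) ∧ HasCompactSupport (fun x => P x i j) ∧
      tsupport (fun x => P x i j) ⊆ Ω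

/-- `Q ∈ H¹(Ω; 𝒮₀)` is a critical point of the Landau–de Gennes energy (for its own boundary
values): the first variation in the direction of every test field exists and vanishes. -/
def IsCriticalPoint (L a b c : ℝ) (Ω : Set Plane) (Q : Plane → Mat3) : Prop :=
  MemH1Q Ω Q ∧
    ∀ P, IsTestField Ω P → HasDerivAt (fun t : ℝ => energy L a b c Ω (fun x => Q x + t • P x)) 0 0

/-- The director `n(φ) = (cos (kφ/2), sin (kφ/2), 0)`. -/
def director (k : ℤ) (φ : ℝ) : Fin 3 → ℝ :=
  ![Real.cos ((k : ℝ) / 2 * φ), Real.sin ((k : ℝ) / 2 * φ), 0]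

/-- The boundary tensor `Q_k(φ) = n(φ) ⊗ n(φ) - I / 3`. -/
def Qk (k : ℤ) (φ : ℝ) : Mat3 :=
  Matrix.vecMulVec (director k φ) (director k φ) - (1 / 3 : ℝ) • (1 : Mat3)

/-- `F_n(φ) = √2 (n(φ) ⊗ n(φ) - I₂ / 2)` with `I₂ = e₁ ⊗ e₁ + e₂ ⊗ e₂`. -/
def Fn (k : ℤ) (φ : ℝ) : Mat3 :=
  √2 • (Matrix.vecMulVec (director k φ) (director k φ)
    - (1 / 2 : ℝ) • Matrix.diagonal ![1, 1, 0])

/-- `F₃ = √(3/2) (e₃ ⊗ e₃ - I / 3)`. -/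
def F3 : Mat3 :=
  √(3 / 2) • (Matrix.diagonal ![0, 0, 1] - (1 / 3 : ℝ) • (1 : Mat3))

/-- The point of the plane with polar coordinates `(r, φ)`. -/
def polarPoint (r φ : ℝ) : Plane := !₂[r * Real.cos φ, r * Real.sin φ]

/-- A polar angle of `x`. As `F_n` is `2π`-periodic, the branch does not matter. -/
def angle (x : Plane) : ℝ := Complex.arg ⟨x 0, x 1⟩

/-- The ansatz `Y(r, φ) = u(r) F_n(φ) + v(r) F₃` as a field on the plane. -/
def ansatz (k : ℤ) (u v : ℝ → ℝ) (x : Plane) : Mat3 :=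
  u ‖x‖ • Fn k (angle x) + v ‖x‖ • F3

end LdG

end

/-! The minimiser comes from the direct method. The quartic term of the bulk potential dominates the
cubic one, so the potential is bounded below and a minimising sequence has `√r u'` and `√r v'`
bounded in `L²(0, R)`. The values at `R` are prescribed, and `w r = w R - ∫ (√s w') (1/√s)` over
`(r, R)` with `1/√s` square integrable there; hence weak `L²` convergence of `√r w'` already forces
pointwise convergence of `w` on `(0, R]`. The Dirichlet terms are weakly lower semicontinuous, and
Fatou's lemma handles the rest. Because `k ≠ 0`, it also returns `u/√r ∈ L²` for the limit
(`exists_weak_limit`, `exists_minimizer`).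

Comparison with perturbations vanishing near `0` and at `R` gives the weak Euler-Lagrange equations.
The du Bois-Reymond lemma turns them into `r w' = m - ∫ q` over `(r, R)`, and bootstrapping gives
smoothness on `(0, R)`. At the origin one principle is used twice: if `g` has a limit at `0` and `g
/ r` is integrable, the limit is `0`. With `g = u²` it gives `u → 0`. With `g = (r v')²` it gives `r
v' = ∫ q` over `(0, r)`; since `q` is bounded, so are `v'` and `v`, hence `q = O(r)` and `v' =
O(r)`, which is the `C¹` regularity with `v'(0) = 0` (`exists_continuous_derivative`).

On the disk, the entries of `Y` are combinations of `u cos kφ`, `u sin kφ` and `v`, and on a mode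
`h(r) cos (kφ + α)` the Laplacian acts by the radial operator of the ODE. Thus the Euler-Lagrange
system of the full energy holds pointwise off the origin. It holds across the origin in the sense of
distributions because the gradients are in `L²` and, in two dimensions, scaled cutoffs have
gradients bounded in `L²` (`integral_div_of_memLp`). Finally the energy of `Y + tP` is a polynomial
in `t`, whose linear coefficient is the weak form of that system and so vanishes
(`isCriticalPoint_of_hasWeakLaplacian`). -/

open Filter Topology

noncomputable section

namespace LdG

/-! ### Weak compactness and absolutely continuous functions on `(0, R]` -/

/-- Bounded sequences in a separable real Hilbert space have weakly convergent subsequences. -/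
theorem exists_weakly_convergent_subseq {H : Type*} [NormedAddCommGroup H] [InnerProductSpace ℝ H]
    [CompleteSpace H] [TopologicalSpace.SeparableSpace H] {x : ℕ → H} {M : ℝ}
    (hx : ∀ n, ‖x n‖ ≤ M) :
    ∃ (y : H) (φ : ℕ → ℕ), StrictMono φ ∧
      ∀ z, Tendsto (fun n => inner ℝ (x (φ n)) z) atTop (𝓝 (inner ℝ y z)) := by
  obtain ⟨l, -, φ, hφ, hl⟩ := WeakDual.isSeqCompact_closedBall ℝ H 0 M
    (x := fun n => StrongDual.toWeakDual (InnerProductSpace.toDual ℝ H (x n)))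
    (fun n => by simpa using hx n)
  refine ⟨(InnerProductSpace.toDual ℝ H).symm (WeakDual.toStrongDual l), φ, hφ, fun z => ?_⟩
  have := (WeakDual.eval_continuous (𝕜 := ℝ) z).tendsto l |>.comp hl
  simpa [Function.comp_def] using this

/-- The Cauchy-Schwarz inequality for integrals of real functions. -/
theorem sq_integral_mul_le {α : Type*} [MeasurableSpace α] {μ : Measure α} {f g : α → ℝ}
    (hf : MemLp f 2 μ) (hg : MemLp g 2 μ) :
    (∫ x, f x * g x ∂μ) ^ 2 ≤ (∫ x, f x ^ 2 ∂μ) * ∫ x, g x ^ 2 ∂μ := by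
  have key : ∀ {f g : α → ℝ} (hf : MemLp f 2 μ) (hg : MemLp g 2 μ),
      inner ℝ (hf.toLp f) (hg.toLp g) = ∫ x, f x * g x ∂μ := by
    intro f g hf hg
    rw [L2.inner_def]
    refine integral_congr_ae ?_
    filter_upwards [hf.coeFn_toLp, hg.coeFn_toLp] with x h1 h2
    simp [h1, h2, mul_comm]
  have := real_inner_mul_inner_self_le (hf.toLp f) (hg.toLp g)
  rw [key, key, key] at this
  simpa [pow_two] using this

/-- Restricting from the larger interval that starts at `r / 2` admits the endpoint `r = R`, which
the open range of `ε` excludes. -/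
theorem LocallyAC.absolutelyContinuousOnInterval {R : ℝ} {w : ℝ → ℝ} (hw : LocallyAC R w) {r : ℝ}
    (hr : r ∈ Ioc 0 R) : AbsolutelyContinuousOnInterval w r R := by
  refine (hw (r / 2) ⟨half_pos hr.1, by linarith [hr.1, hr.2]⟩).mono ?_
  rw [uIcc_of_le hr.2, uIcc_of_le (by linarith [hr.1, hr.2])]
  exact Icc_subset_Icc_left (by linarith [hr.1])

theorem LocallyAC.setIntegral_deriv {R : ℝ} {w : ℝ → ℝ} (hw : LocallyAC R w) {r : ℝ}
    (hr : r ∈ Ioc 0 R) : ∫ s in Ioo r R, deriv w s = w R - w r := by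
  rw [← (hw.absolutelyContinuousOnInterval hr).integral_deriv_eq_sub,
    intervalIntegral.integral_of_le hr.2, integral_Ioc_eq_integral_Ioo]

theorem LocallyAC.continuousOn {R : ℝ} {w : ℝ → ℝ} (hw : LocallyAC R w) :
    ContinuousOn w (Ioc 0 R) := by
  intro r hr
  have h2 : r / 2 ∈ Ioc 0 R := ⟨half_pos hr.1, by linarith [hr.1, hr.2]⟩
  have := (hw.absolutelyContinuousOnInterval h2).continuousOn
  rw [uIcc_of_le h2.2] at this
  refine (this r ⟨by linarith [hr.1], hr.2⟩).mono_of_mem_nhdsWithin ?_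
  filter_upwards [self_mem_nhdsWithin,
    mem_nhdsWithin_of_mem_nhds (Ioi_mem_nhds (show r / 2 < r by linarith [hr.1]))] with y hy hy'
  exact ⟨le_of_lt hy', hy.2⟩

/-- The factor complementary to `√s w'`: writing `w' = (√s w') (1/√s)` makes increments of `w` into
`L²` pairings, for Cauchy-Schwarz and for weak limits alike. -/
theorem memLp_inv_sqrt {r R : ℝ} (hr : 0 < r) :
    MemLp (fun s : ℝ => 1 / √s) 2 (volume.restrict (Ioo r R)) := by
  refine MemLp.of_bound (Measurable.aestronglyMeasurable (by fun_prop)) (1 / √r) ?_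
  filter_upwards [ae_restrict_mem measurableSet_Ioo] with s hs
  rw [Real.norm_of_nonneg (by positivity)]
  have := Real.sqrt_pos.2 hr
  gcongr
  exact hs.1.le

/-- If the derivative of `w` satisfies `√r w' ∈ L²` then `w²` grows at most like `r^{-1/2}`. -/
theorem sq_mul_sqrt_le {R D : ℝ} {w : ℝ → ℝ} (hw : LocallyAC R w)
    (hw2 : MemLp (fun r => √r * deriv w r) 2 (volume.restrict (Ioo 0 R)))
    (hD : ∫ r in Ioo 0 R, (√r * deriv w r) ^ 2 ≤ D) {r : ℝ} (hr : r ∈ Ioc 0 R) :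
    w r ^ 2 * √r ≤ (2 * w R ^ 2 + 4 * D) * √R := by
  have hR : 0 < R := hr.1.trans_le hr.2
  have hsub : Ioo r R ⊆ Ioo 0 R := Ioo_subset_Ioo_left hr.1.le
  have h1 : w R - w r = ∫ s in Ioo r R, (√s * deriv w s) * (1 / √s) := by
    rw [← hw.setIntegral_deriv hr]
    refine setIntegral_congr_fun measurableSet_Ioo fun s hs => ?_
    have : 0 < √s := Real.sqrt_pos.2 (hr.1.trans hs.1)
    field_simp
  have hcs := sq_integral_mul_le (hw2.mono_measure (Measure.restrict_mono hsub le_rfl))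
    (memLp_inv_sqrt (R := R) hr.1)
  rw [← h1] at hcs
  have h2 : ∫ s in Ioo r R, (1 / √s) ^ 2 = Real.log (R / r) := by
    rw [← integral_one_div_of_pos hr.1 hR, intervalIntegral.integral_of_le hr.2,
      integral_Ioc_eq_integral_Ioo]
    refine setIntegral_congr_fun measurableSet_Ioo fun s hs => ?_
    have : 0 < s := hr.1.trans hs.1
    simp only [div_pow, one_pow, Real.sq_sqrt this.le]
  have h3 : ∫ s in Ioo r R, (√s * deriv w s) ^ 2 ≤ D :=
    (setIntegral_mono_set hw2.integrable_sq (Eventually.of_forall fun s => sq_nonneg _)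
      hsub.eventuallyLE).trans hD
  have hD0 : 0 ≤ D := (integral_nonneg fun s => sq_nonneg _).trans h3
  -- Cauchy-Schwarz gives logarithmic growth of `w²`. The cruder power `r^{-1/2}` suffices later: it
  -- makes a quartic in the unknowns, multiplied by `r`, bounded.
  have h4 : Real.log (R / r) ≤ 2 * (√R / √r) := by
    have := Real.log_le_rpow_div (x := R / r) (ε := 1 / 2) (div_pos hR hr.1).le (by norm_num)
    rw [← Real.sqrt_eq_rpow, Real.sqrt_div hR.le] at this
    linarith
  have h5 : (w R - w r) ^ 2 ≤ D * (2 * (√R / √r)) := by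
    refine hcs.trans ?_
    rw [h2]
    exact mul_le_mul h3 h4 (Real.log_nonneg (by rw [le_div_iff₀ hr.1]; linarith [hr.2])) hD0
  have hsr : 0 < √r := Real.sqrt_pos.2 hr.1
  have hsR : √r ≤ √R := Real.sqrt_le_sqrt hr.2
  have h6 : w r ^ 2 ≤ 2 * w R ^ 2 + 2 * (D * (2 * (√R / √r))) := by
    nlinarith [sq_nonneg (2 * w R - w r)]
  calc w r ^ 2 * √r ≤ (2 * w R ^ 2 + 2 * (D * (2 * (√R / √r)))) * √r := by gcongr
    _ = 2 * w R ^ 2 * √r + 4 * D * √R := by field_simp; ring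
    _ ≤ 2 * w R ^ 2 * √R + 4 * D * √R := by gcongr
    _ = _ := by ring

theorem locallyAC_primitive {R β : ℝ} {g : ℝ → ℝ}
    (hg : ∀ ε ∈ Ioo 0 R, IntervalIntegrable g volume ε R) :
    LocallyAC R (fun r => β - ∫ s in r..R, g s) := by
  intro ε hε
  have h1 := (hg ε hε).absolutelyContinuousOnInterval_intervalIntegral (c := R) right_mem_uIcc
  have h2 : AbsolutelyContinuousOnInterval (fun _ : ℝ => β) ε R :=
    (LipschitzOnWith.of_dist_le_mul (K := 0) (by simp)).absolutelyContinuousOnInterval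
  have h3 : (fun r => β - ∫ s in r..R, g s) = fun r => β + ∫ s in R..r, g s := by
    funext r
    rw [intervalIntegral.integral_symm, sub_neg_eq_add]
  exact h3 ▸ h2.fun_add h1

/-- Lebesgue differentiation on each `[R/(n+2), R]`, with countably many null sets discarded; the
shift by `2` keeps the left endpoint strictly inside `(0, R)`. The base point is `R` since `g` need
not be integrable at `0`. -/
theorem ae_hasDerivAt_primitive {R β : ℝ} {g : ℝ → ℝ}
    (hg : ∀ ε ∈ Ioo 0 R, IntervalIntegrable g volume ε R) :
    ∀ᵐ r ∂volume.restrict (Ioo 0 R), HasDerivAt (fun r => β - ∫ s in r..R, g s) (g r) r := by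
  rw [ae_restrict_iff' measurableSet_Ioo]
  rcases le_or_gt R 0 with hR | hR
  · simp [Ioo_eq_empty hR.not_gt]
  have h : ∀ n : ℕ, ∀ᵐ r, r ∈ uIcc (R / (n + 2)) R →
      ∀ c ∈ uIcc (R / (n + 2)) R, HasDerivAt (fun x => ∫ t in c..x, g t) (g r) r := fun n =>
    (hg _ ⟨by positivity, div_lt_self hR (by linarith)⟩).ae_hasDerivAt_integral
  filter_upwards [ae_all_iff.2 h] with r hr hr0
  obtain ⟨n, hn⟩ := exists_nat_gt (R / r)
  have h1 : R / (n + 2) ≤ r := by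
    rw [div_lt_iff₀ hr0.1] at hn
    rw [div_le_iff₀ (by positivity)]
    nlinarith [hr0.1]
  have := (hr n (by rw [uIcc_of_le (h1.trans hr0.2.le)]; exact ⟨h1, hr0.2.le⟩) R
    right_mem_uIcc).const_add β
  simpa only [intervalIntegral.integral_symm R, sub_eq_add_neg, neg_neg] using this

/-- Let `f` be a weak limit of the weighted derivatives, and define the limit function as the
primitive of `f/√s` with value `β` at `R`. Testing against `1/√s` on `(r, R)` gives pointwise
convergence. The numbers `a n = 2⟨fₙ, f⟩ - ‖f‖²` encode weak lower semicontinuity: they lie below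
`‖fₙ‖²` and converge to `‖f‖²`, so they can be subtracted from energies and passed to further
subsequences without any `liminf`. -/
theorem exists_weak_limit {R β M : ℝ} {w : ℕ → ℝ → ℝ} (hw : ∀ n, LocallyAC R (w n))
    (hw2 : ∀ n, MemLp (fun r => √r * deriv (w n) r) 2 (volume.restrict (Ioo 0 R)))
    (hβ : ∀ n, w n R = β) (hM : ∀ n, ∫ r in Ioo 0 R, (√r * deriv (w n) r) ^ 2 ≤ M) :
    ∃ (w' : ℝ → ℝ) (φ : ℕ → ℕ) (a : ℕ → ℝ), StrictMono φ ∧ LocallyAC R w' ∧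
      MemLp (fun r => √r * deriv w' r) 2 (volume.restrict (Ioo 0 R)) ∧ w' R = β ∧
      (∀ r ∈ Ioc 0 R, Tendsto (fun n => w (φ n) r) atTop (𝓝 (w' r))) ∧
      Tendsto a atTop (𝓝 (∫ r in Ioo 0 R, (√r * deriv w' r) ^ 2)) ∧
      ∀ n, a n ≤ ∫ r in Ioo 0 R, (√r * deriv (w (φ n)) r) ^ 2 := by
  have : Fact ((2 : ENNReal) ≠ ⊤) := ⟨ENNReal.ofNat_ne_top⟩
  set μ := volume.restrict (Ioo 0 R) with hμ
  have key : ∀ {f g : ℝ → ℝ} (hf : MemLp f 2 μ) (hg : MemLp g 2 μ),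
      inner ℝ (hf.toLp f) (hg.toLp g) = ∫ x, f x * g x ∂μ := by
    intro f g hf hg
    rw [L2.inner_def]
    refine integral_congr_ae ?_
    filter_upwards [hf.coeFn_toLp, hg.coeFn_toLp] with x h1 h2
    simp [h1, h2, mul_comm]
  obtain ⟨y, φ, hφ, hy⟩ := exists_weakly_convergent_subseq (x := fun n => (hw2 n).toLp)
    (M := √M) (fun n => by
      refine Real.le_sqrt_of_sq_le ((le_of_eq ?_).trans (hM n))
      rw [← real_inner_self_eq_norm_sq, key]
      simp [pow_two])
  obtain ⟨f, hf, hyf⟩ : ∃ (f : ℝ → ℝ) (hf : MemLp f 2 μ), hf.toLp f = y :=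
    ⟨_, Lp.memLp y, Lp.toLp_coeFn y _⟩
  have hint : ∀ r ∈ Ioc 0 R, Integrable (fun s => f s * (1 / √s)) (volume.restrict (Ioo r R)) :=
    fun r hr => (hf.mono_measure (Measure.restrict_mono (Ioo_subset_Ioo_left hr.1.le) le_rfl)).integrable_mul
      (memLp_inv_sqrt hr.1)
  have hII : ∀ ε ∈ Ioo 0 R, IntervalIntegrable (fun s => f s * (1 / √s)) volume ε R := by
    intro ε hε
    rw [intervalIntegrable_iff_integrableOn_Ioo_of_le hε.2.le]
    exact hint ε ⟨hε.1, hε.2.le⟩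
  have hd : ∀ᵐ r ∂μ, √r * deriv (fun r => β - ∫ s in r..R, f s * (1 / √s)) r = f r := by
    filter_upwards [ae_hasDerivAt_primitive hII, ae_restrict_mem measurableSet_Ioo] with r h1 h2
    rw [h1.deriv]
    have := Real.sqrt_pos.2 h2.1
    field_simp
  refine ⟨fun r => β - ∫ s in r..R, f s * (1 / √s), φ,
    fun n => 2 * (∫ r, (√r * deriv (w (φ n)) r) * f r ∂μ) - ∫ r, f r ^ 2 ∂μ, hφ,
    locallyAC_primitive hII, hf.ae_eq (by filter_upwards [hd] with r hr using hr.symm),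
    by simp, fun r hr => ?_, ?_, fun n => ?_⟩
  · have hz : MemLp (indicator (Ioo r R) fun s : ℝ => 1 / √s) 2 μ := by
      rw [memLp_indicator_iff_restrict measurableSet_Ioo, hμ, Measure.restrict_restrict measurableSet_Ioo,
        inter_eq_left.2 (Ioo_subset_Ioo_left hr.1.le)]
      exact memLp_inv_sqrt hr.1
    have hind : ∀ g : ℝ → ℝ, ∫ s, g s * (indicator (Ioo r R) (fun s : ℝ => 1 / √s)) s ∂μ
        = ∫ s in Ioo r R, g s * (1 / √s) := by
      intro g
      simp_rw [← indicator_mul_right]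
      rw [integral_indicator measurableSet_Ioo, hμ, Measure.restrict_restrict measurableSet_Ioo,
        inter_eq_left.2 (Ioo_subset_Ioo_left hr.1.le)]
    have := hy (hz.toLp)
    rw [← hyf, key, hind] at this
    simp_rw [key, hind] at this
    have h2 : ∀ n, w (φ n) r = β - ∫ s in Ioo r R, (√s * deriv (w (φ n)) s) * (1 / √s) := by
      intro n
      rw [← hβ (φ n), eq_sub_iff_add_eq, add_comm, ← eq_sub_iff_add_eq, ← (hw (φ n)).setIntegral_deriv hr]
      refine setIntegral_congr_fun measurableSet_Ioo fun s hs => ?_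
      have : 0 < √s := Real.sqrt_pos.2 (hr.1.trans hs.1)
      field_simp
    simp_rw [h2]
    rw [intervalIntegral.integral_of_le hr.2, integral_Ioc_eq_integral_Ioo]
    exact this.const_sub β
  · have := hy y
    nth_rw 2 [← hyf] at this
    rw [← hyf, key] at this
    simp_rw [key] at this
    have h2 : ∫ r, (√r * deriv (fun r => β - ∫ s in r..R, f s * (1 / √s)) r) ^ 2 ∂μ
        = ∫ r, f r ^ 2 ∂μ := by
      refine integral_congr_ae ?_
      filter_upwards [hd] with r hr
      rw [hr]
    rw [h2]
    have h3 := (this.const_mul 2).sub_const (∫ r, f r ^ 2 ∂μ)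
    convert h3 using 2
    simp_rw [← pow_two]; ring
  · have h1 : Integrable (fun r => √r * deriv (w (φ n)) r * f r) μ := (hw2 (φ n)).integrable_mul hf
    have h2 := (hw2 (φ n)).integrable_sq
    have h3 := hf.integrable_sq
    rw [← sub_nonneg]
    have : 0 ≤ ∫ r, (√r * deriv (w (φ n)) r - f r) ^ 2 ∂μ := integral_nonneg fun s => sq_nonneg _
    have h4 : ∀ r, (√r * deriv (w (φ n)) r - f r) ^ 2 = (√r * deriv (w (φ n)) r) ^ 2
       - 2 * ((√r * deriv (w (φ n)) r) * f r) + f r ^ 2 := fun r => by ring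
    simp_rw [h4] at this
    have h5 : Integrable (fun r => (√r * deriv (w (φ n)) r) ^ 2
       - 2 * ((√r * deriv (w (φ n)) r) * f r)) μ := h2.sub (h1.const_mul 2)
    rw [integral_add h5 h3, integral_sub h2 (h1.const_mul 2), integral_const_mul] at this
    linarith

/-! ### The reduced bulk potential -/

/-- The cubic term `v (v² - 3 u²)` of the reduced bulk potential. -/
def cubic (x y : ℝ) : ℝ := y * (y ^ 2 - 3 * x ^ 2)

/-- The reduced bulk potential, divided by `L`. -/
def potential (L a b c x y : ℝ) : ℝ :=
  -(a ^ 2 / (2 * L)) * (x ^ 2 + y ^ 2) + c ^ 2 / (4 * L) * (x ^ 2 + y ^ 2) ^ 2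
    - b ^ 2 / (3 * L * √6) * cubic x y

/-- The cubic is the real part of `(y + ix)³`, hence at most `(x² + y²)^{3/2}` in modulus, and the
geometric mean of `δ s²` and `s / δ` is `s^{3/2}`. -/
theorem abs_cubic_le {x y δ : ℝ} (hδ : 0 < δ) :
    |cubic x y| ≤ (δ * (x ^ 2 + y ^ 2) ^ 2 + (x ^ 2 + y ^ 2) / δ) / 2 := by
  apply abs_le_of_sq_le_sq _ (by positivity)
  have h1 : cubic x y ^ 2 ≤ (x ^ 2 + y ^ 2) ^ 3 := by
    have : (x ^ 2 + y ^ 2) ^ 3 = cubic x y ^ 2 + (x * (x ^ 2 - 3 * y ^ 2)) ^ 2 := by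
      unfold cubic; ring
    rw [this]; nlinarith [sq_nonneg (x * (x ^ 2 - 3 * y ^ 2))]
  refine h1.trans ?_
  set s := x ^ 2 + y ^ 2
  have : ((δ * s ^ 2 + s / δ) / 2) ^ 2 - s ^ 3 = ((δ * s ^ 2 - s / δ) / 2) ^ 2 := by
    field_simp; ring
  nlinarith [sq_nonneg ((δ * s ^ 2 - s / δ) / 2)]

theorem exists_le_potential {L a b c : ℝ} (hL : 0 < L) (hc : 0 < c ^ 2) :
    ∃ C, ∀ x y, -C ≤ potential L a b c x y := by
  set A := a ^ 2 / (2 * L) with hA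
  set B := b ^ 2 / (3 * L * √6) with hB
  set C := c ^ 2 / (4 * L) with hC
  have hA0 : 0 ≤ A := by positivity
  have hB0 : 0 ≤ B := by positivity
  have hC0 : 0 < C := by positivity
  -- With this choice `B δ ≤ C`, so the cubic consumes at most half of the quartic term; the other
  -- half absorbs the quadratic one by completing the square. The `+ 1` covers `B = 0`.
  set δ := C / (B + 1) with hδ
  have hδ0 : 0 < δ := by positivity
  refine ⟨(A + B / (2 * δ)) ^ 2 / (2 * C), fun x y => ?_⟩
  have h1 := (abs_le.1 (abs_cubic_le (x := x) (y := y) hδ0)).2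
  unfold potential
  rw [← hA, ← hB, ← hC]
  set s := x ^ 2 + y ^ 2
  have h2 : B * cubic x y ≤ B * ((δ * s ^ 2 + s / δ) / 2) := by gcongr
  have h3 : B * δ ≤ C := by
    rw [hδ, mul_div_assoc', div_le_iff₀ (by positivity)]; nlinarith
  have h4 : B * ((δ * s ^ 2 + s / δ) / 2) = B * δ * s ^ 2 / 2 + B / (2 * δ) * s := by
    field_simp
  set E := A + B / (2 * δ) with hE
  have h5 : -(E ^ 2 / (2 * C)) ≤ -E * s + C / 2 * s ^ 2 := by
    have : -E * s + C / 2 * s ^ 2 + E ^ 2 / (2 * C) = (E - C * s) ^ 2 / (2 * C) := by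
      field_simp; ring
    have : 0 ≤ (E - C * s) ^ 2 / (2 * C) := by positivity
    linarith
  have h6 : B * δ * s ^ 2 ≤ C * s ^ 2 := by gcongr
  have h7 : E * s = A * s + B / (2 * δ) * s := by rw [hE]; ring
  linarith

/-! ### Finite Dirichlet energy, the reduced energy and the admissible set -/

/-- `w` is locally absolutely continuous on `(0, R]` with `√r w' ∈ L²(0, R)`. -/
structure FiniteDirichlet (R : ℝ) (w : ℝ → ℝ) : Prop where
  ac : LocallyAC R w
  memLp : MemLp (fun r => √r * deriv w r) 2 (volume.restrict (Ioo 0 R))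

theorem LocallyAC.aestronglyMeasurable {R : ℝ} {w : ℝ → ℝ} (hw : LocallyAC R w) :
    AEStronglyMeasurable w (volume.restrict (Ioo 0 R)) :=
  (hw.continuousOn.mono Ioo_subset_Ioc_self).aestronglyMeasurable measurableSet_Ioo

theorem FiniteDirichlet.exists_bound {R : ℝ} {w : ℝ → ℝ} (hw : FiniteDirichlet R w) :
    ∃ K, 0 ≤ K ∧ ∀ r ∈ Ioc 0 R, w r ^ 2 * √r ≤ K := 
  ⟨_, by have : 0 ≤ ∫ r in Ioo 0 R, (√r * deriv w r) ^ 2 := integral_nonneg fun s => sq_nonneg _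
         positivity, fun _ hr => sq_mul_sqrt_le hw.ac hw.memLp le_rfl hr⟩

/-- Since `(x² + y²)² r = ((x² + y²) √r)²`, the growth bound on each unknown controls quartic
integrands uniformly. All bulk integrals therefore converge with no `L⁴` condition in the admissible
set. -/
theorem abs_mul_le_of_growth {R K C x y g r : ℝ} (hC : 0 ≤ C) (hr : r ∈ Ioc 0 R)
    (hx : x ^ 2 * √r ≤ K) (hy : y ^ 2 * √r ≤ K) (hg : |g| ≤ C * (1 + (x ^ 2 + y ^ 2) ^ 2)) :
    ‖g * r‖ ≤ C * (R + (2 * K) ^ 2) := by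
  have h1 : (x ^ 2 + y ^ 2) ^ 2 * r = ((x ^ 2 + y ^ 2) * √r) ^ 2 := by
    rw [mul_pow, Real.sq_sqrt hr.1.le]
  have h2 : ((x ^ 2 + y ^ 2) * √r) ^ 2 ≤ (2 * K) ^ 2 := by
    exact pow_le_pow_left₀ (by positivity) (by linarith) 2
  rw [norm_mul, Real.norm_eq_abs, Real.norm_of_nonneg hr.1.le]
  calc |g| * r ≤ C * (1 + (x ^ 2 + y ^ 2) ^ 2) * r := by gcongr; exact hr.1.le
    _ = C * (r + (x ^ 2 + y ^ 2) ^ 2 * r) := by ring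
    _ ≤ _ := by rw [h1]; gcongr; exact hr.2

theorem FiniteDirichlet.integrable_comp {R C : ℝ} {u v : ℝ → ℝ} (hu : FiniteDirichlet R u)
    (hv : FiniteDirichlet R v) (hC : 0 ≤ C) {g : ℝ → ℝ → ℝ} (hg : Continuous (Function.uncurry g))
    (hgC : ∀ x y, |g x y| ≤ C * (1 + (x ^ 2 + y ^ 2) ^ 2)) :
    Integrable (fun r => g (u r) (v r) * r) (volume.restrict (Ioo 0 R)) := by
  obtain ⟨K, -, hK⟩ := hu.exists_bound
  obtain ⟨K', -, hK'⟩ := hv.exists_bound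
  refine Integrable.of_bound ?_ (C * (R + (2 * (max K K')) ^ 2)) ?_
  · exact (hg.comp_aestronglyMeasurable
      (hu.ac.aestronglyMeasurable.prodMk hv.ac.aestronglyMeasurable)).mul
      (by fun_prop)
  · filter_upwards [ae_restrict_mem measurableSet_Ioo] with r hr
    exact abs_mul_le_of_growth hC (Ioo_subset_Ioc_self hr)
      ((hK r (Ioo_subset_Ioc_self hr)).trans (le_max_left _ _))
      ((hK' r (Ioo_subset_Ioc_self hr)).trans (le_max_right _ _)) (hgC _ _)

theorem continuous_cubic : Continuous (Function.uncurry cubic) := by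
  unfold Function.uncurry cubic; fun_prop

theorem continuous_potential (L a b c : ℝ) : Continuous (Function.uncurry (potential L a b c)) := by
  unfold Function.uncurry potential cubic; fun_prop

theorem abs_cubic_le' (x y : ℝ) : |cubic x y| ≤ 1 * (1 + (x ^ 2 + y ^ 2) ^ 2) := by
  have := abs_cubic_le (x := x) (y := y) one_pos
  nlinarith [sq_nonneg ((x ^ 2 + y ^ 2) - 1)]

theorem exists_abs_potential_le (L a b c : ℝ) :
    ∃ C, 0 ≤ C ∧ ∀ x y, |potential L a b c x y| ≤ C * (1 + (x ^ 2 + y ^ 2) ^ 2) := by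
  refine ⟨|a ^ 2 / (2 * L)| + |c ^ 2 / (4 * L)| + |b ^ 2 / (3 * L * √6)|, by positivity,
    fun x y => ?_⟩
  have h1 := abs_cubic_le' x y
  unfold potential
  refine (abs_sub _ _).trans ((add_le_add_left (abs_add_le _ _) _).trans ?_)
  rw [abs_mul, abs_mul, abs_mul, abs_neg, abs_of_nonneg (sq_nonneg (x ^ 2 + y ^ 2)),
    abs_of_nonneg (by positivity : 0 ≤ x ^ 2 + y ^ 2)]
  set s := x ^ 2 + y ^ 2
  rw [one_mul] at h1
  rw [add_mul, add_mul]
  have hs : s ≤ 1 + s ^ 2 := by nlinarith [sq_nonneg (s - 1)]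
  gcongr
  linarith

/-- The part of the reduced energy density without derivatives. -/
def density (L a b c : ℝ) (k : ℤ) (r x y : ℝ) : ℝ :=
  (k : ℝ) ^ 2 / 2 * (x / √r) ^ 2 + potential L a b c x y * r

theorem FiniteDirichlet.integrable_density {R : ℝ} {u v : ℝ → ℝ} (hu : FiniteDirichlet R u)
    (hv : FiniteDirichlet R v) (hu2 : MemLp (fun r => u r / √r) 2 (volume.restrict (Ioo 0 R)))
    (L a b c : ℝ) (k : ℤ) :
    Integrable (fun r => density L a b c k r (u r) (v r)) (volume.restrict (Ioo 0 R)) := by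
  obtain ⟨C, hC, hCp⟩ := exists_abs_potential_le L a b c
  exact (hu2.integrable_sq.const_mul _).add
    (hu.integrable_comp hv hC (continuous_potential L a b c) hCp)

/-- Separates the two Dirichlet integrals, treated by weak lower semicontinuity, from the density
without derivatives, treated by Fatou's lemma. Additivity of the integral needs each piece to be
integrable, which the growth bound supplies. -/
theorem reducedEnergy_eq {R : ℝ} (hR : 0 < R) {u v : ℝ → ℝ} (hu : FiniteDirichlet R u)
    (hv : FiniteDirichlet R v) (hu2 : MemLp (fun r => u r / √r) 2 (volume.restrict (Ioo 0 R)))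
    (L a b c : ℝ) (k : ℤ) :
    reducedEnergy L R a b c k u v = 1 / 2 * (∫ r in Ioo 0 R, (√r * deriv u r) ^ 2)
      + 1 / 2 * (∫ r in Ioo 0 R, (√r * deriv v r) ^ 2)
      + ∫ r in Ioo 0 R, density L a b c k r (u r) (v r) := by
  have hi := hu.integrable_density hv hu2 L a b c k
  have hcub := hu.integrable_comp hv zero_le_one continuous_cubic abs_cubic_le'
  have h1 := hu.memLp.integrable_sq
  have h2 := hv.memLp.integrable_sq
  have h3 : ∀ f : ℝ → ℝ, ∫ r in (0 : ℝ)..R, f r = ∫ r in Ioo 0 R, f r := fun f => by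
    rw [intervalIntegral.integral_of_le hR.le, integral_Ioc_eq_integral_Ioo]
  have h4 : EqOn (fun r => (1 / 2 * ((deriv u r) ^ 2 + (deriv v r) ^ 2 + (k : ℝ) ^ 2 / r ^ 2 * (u r) ^ 2)
        - a ^ 2 / (2 * L) * ((u r) ^ 2 + (v r) ^ 2)
        + c ^ 2 / (4 * L) * ((u r) ^ 2 + (v r) ^ 2) ^ 2) * r)
      (fun r => (1 / 2 * (√r * deriv u r) ^ 2 + 1 / 2 * (√r * deriv v r) ^ 2
        + density L a b c k r (u r) (v r)) + b ^ 2 / (3 * L * √6) * (cubic (u r) (v r) * r)) (Ioo 0 R) := by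
    intro r hr
    have hr0 := hr.1.ne'
    simp only [density, potential, mul_pow, div_pow, Real.sq_sqrt hr.1.le]
    have : (k : ℝ) ^ 2 / r ^ 2 * u r ^ 2 * r = (k : ℝ) ^ 2 * (u r ^ 2 / r) := by field_simp
    linear_combination this / 2
  have h5 : Integrable (fun r => 1 / 2 * (√r * deriv u r) ^ 2 + 1 / 2 * (√r * deriv v r) ^ 2)
      (volume.restrict (Ioo 0 R)) := (h1.const_mul (1 / 2)).add (h2.const_mul (1 / 2))
  have h6 : Integrable (fun r => 1 / 2 * (√r * deriv u r) ^ 2 + 1 / 2 * (√r * deriv v r) ^ 2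
        + density L a b c k r (u r) (v r)) (volume.restrict (Ioo 0 R)) := h5.add hi
  unfold reducedEnergy
  rw [h3, h3, setIntegral_congr_fun measurableSet_Ioo h4, integral_add h6 (hcub.const_mul _),
    integral_add h5 hi, integral_add (h1.const_mul _) (h2.const_mul _), integral_const_mul,
    integral_const_mul, integral_const_mul]
  simp only [cubic]
  ring

/-- The condition `√r v ∈ L²` is automatic: `v² √r` is bounded, hence so is `√r v`. -/
theorem mem_admissible_iff {R a b c : ℝ} {u v : ℝ → ℝ} :
    (u, v) ∈ admissible R a b c ↔ FiniteDirichlet R u ∧ FiniteDirichlet R v ∧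
      MemLp (fun r => u r / √r) 2 (volume.restrict (Ioo 0 R)) ∧
      u R = sPlus a b c / √2 ∧ v R = -(sPlus a b c / √6) := by
  constructor
  · rintro ⟨h1, h2, h3, h4, h5, h6, h7, h8⟩
    exact ⟨⟨h1, h3⟩, ⟨h2, h4⟩, h5, h7, h8⟩
  · rintro ⟨h1, h2, h3, h4, h5⟩
    refine ⟨h1.ac, h2.ac, h1.memLp, h2.memLp, h3, ?_, h4, h5⟩
    obtain ⟨K, hK0, hK⟩ := h2.exists_bound
    refine MemLp.of_bound (Measurable.aestronglyMeasurable (by fun_prop) |>.mul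
      h2.ac.aestronglyMeasurable) (1 + K * √R) ?_
    filter_upwards [ae_restrict_mem measurableSet_Ioo] with r hr
    have h6 : (√r * v r) ^ 2 ≤ K * √R := by
      have := hK r (Ioo_subset_Ioc_self hr)
      calc (√r * v r) ^ 2 = v r ^ 2 * √r * √r := by ring
        _ ≤ K * √R := mul_le_mul this (Real.sqrt_le_sqrt hr.2.le) (by positivity) hK0
    rw [Real.norm_eq_abs]
    have h7 := sq_abs (√r * v r)
    nlinarith [abs_nonneg (√r * v r), sq_nonneg (|√r * v r| - 1)]

theorem admissible_nonempty {R : ℝ} (hR : 0 < R) (a b c : ℝ) : (admissible R a b c).Nonempty := by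
  have hlin : ∀ α β : ℝ, FiniteDirichlet R (fun r => α * r + β) := by
    intro α β
    have hd : ∀ r, deriv (fun r => α * r + β) r = α := fun r => by
      simp
    refine ⟨fun ε _ => ContDiffOn.absolutelyContinuousOnInterval (by fun_prop), ?_⟩
    simp only [hd]
    refine MemLp.of_bound (Measurable.aestronglyMeasurable (by fun_prop)) (√R * |α|) ?_
    filter_upwards [ae_restrict_mem measurableSet_Ioo] with r hr
    rw [norm_mul, Real.norm_eq_abs, Real.norm_eq_abs, abs_of_nonneg (Real.sqrt_nonneg r)]
    gcongr
    exact hr.2.le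
  -- A linear `u` vanishing at the origin, so that `u/√r` is a multiple of `√r`, together with a
  -- constant `v`.
  refine ⟨(fun r => (sPlus a b c / √2 / R) * r + 0, fun r => 0 * r + -(sPlus a b c / √6)),
    mem_admissible_iff.2 ⟨hlin _ _, hlin _ _, ?_, by field_simp; simp, by simp⟩⟩
  refine MemLp.of_bound (Measurable.aestronglyMeasurable (by fun_prop))
    (|sPlus a b c / √2 / R| * √R) ?_
  filter_upwards [ae_restrict_mem measurableSet_Ioo] with r hr
  have : (sPlus a b c / √2 / R * r + 0) / √r = (sPlus a b c / √2 / R) * √r := by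
    rw [add_zero, mul_div_assoc, Real.div_sqrt]
  rw [this, norm_mul, Real.norm_eq_abs, Real.norm_eq_abs, abs_of_nonneg (Real.sqrt_nonneg r)]
  gcongr
  exact hr.2.le

theorem LocallyAC.aestronglyMeasurable_div_sqrt {R : ℝ} {u : ℝ → ℝ} (hu : LocallyAC R u) :
    AEStronglyMeasurable (fun r => u r / √r) (volume.restrict (Ioo 0 R)) :=
  (hu.aestronglyMeasurable.aemeasurable.div
    (Real.continuous_sqrt.measurable.aemeasurable)).aestronglyMeasurable

theorem aestronglyMeasurable_density {R : ℝ} {u v : ℝ → ℝ} (hu : LocallyAC R u)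
    (hv : LocallyAC R v) (L a b c : ℝ) (k : ℤ) :
    AEStronglyMeasurable (fun r => density L a b c k r (u r) (v r))
      (volume.restrict (Ioo 0 R)) :=
  ((hu.aestronglyMeasurable_div_sqrt.pow 2).const_mul _).add
    (((continuous_potential L a b c).comp_aestronglyMeasurable
      (hu.aestronglyMeasurable.prodMk hv.aestronglyMeasurable)).mul (by fun_prop))

/-! ### Existence of a minimiser -/

/-- A form of Fatou's lemma for Bochner integrals of nonnegative functions. -/
theorem integrable_and_integral_le_of_tendsto {X : Type*} [MeasurableSpace X] {μ : Measure X}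
    {G : ℕ → X → ℝ} {G' : X → ℝ} {e : ℕ → ℝ} {ℓ : ℝ} (hG : ∀ n, Integrable (G n) μ)
    (hG0 : ∀ n, 0 ≤ᵐ[μ] G n) (hG' : AEStronglyMeasurable G' μ)
    (hlim : ∀ᵐ x ∂μ, Tendsto (fun n => G n x) atTop (𝓝 (G' x)))
    (hle : ∀ n, ∫ x, G n x ∂μ ≤ e n) (he : Tendsto e atTop (𝓝 ℓ)) :
    Integrable G' μ ∧ ∫ x, G' x ∂μ ≤ ℓ := by
  have hG'0 : 0 ≤ᵐ[μ] G' := by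
    filter_upwards [ae_all_iff.2 hG0, hlim] with x h1 h2
    exact ge_of_tendsto' h2 h1
  have h0 : 0 ≤ ℓ := ge_of_tendsto' he fun n => (integral_nonneg_of_ae (hG0 n)).trans (hle n)
  have hfatou : ∫⁻ x, ENNReal.ofReal (G' x) ∂μ ≤ ENNReal.ofReal ℓ := by
    calc ∫⁻ x, ENNReal.ofReal (G' x) ∂μ
        = ∫⁻ x, liminf (fun n => ENNReal.ofReal (G n x)) atTop ∂μ := by
          refine lintegral_congr_ae ?_
          filter_upwards [hlim] with x hx
          exact ((ENNReal.continuous_ofReal.tendsto _).comp hx).liminf_eq.symm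
      _ ≤ liminf (fun n => ∫⁻ x, ENNReal.ofReal (G n x) ∂μ) atTop :=
          lintegral_liminf_le' fun n => (hG n).aestronglyMeasurable.aemeasurable.ennreal_ofReal
      _ ≤ liminf (fun n => ENNReal.ofReal (e n)) atTop := by
          refine liminf_le_liminf (Eventually.of_forall fun n => ?_)
          rw [← ofReal_integral_eq_lintegral_ofReal (hG n) (hG0 n)]
          exact ENNReal.ofReal_le_ofReal (hle n)
      _ = ENNReal.ofReal ℓ := ((ENNReal.continuous_ofReal.tendsto _).comp he).liminf_eq
  have hint : Integrable G' μ := by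
    refine ⟨hG', ?_⟩
    rw [hasFiniteIntegral_iff_ofReal hG'0]
    exact hfatou.trans_lt ENNReal.ofReal_lt_top
  refine ⟨hint, ?_⟩
  rw [← ofReal_integral_eq_lintegral_ofReal hint hG'0] at hfatou
  exact (ENNReal.ofReal_le_ofReal_iff h0).1 hfatou

set_option maxHeartbeats 1000000 in
theorem exists_minimizer {a b c L R : ℝ} (hc : 0 < c ^ 2) (k : ℤ) (hk : k ≠ 0) (hL : 0 < L)
    (hR : 0 < R) : ∃ u v, (u, v) ∈ admissible R a b c ∧
      ∀ p ∈ admissible R a b c, reducedEnergy L R a b c k u v ≤ reducedEnergy L R a b c k p.1 p.2 := by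
  obtain ⟨C, hC⟩ := exists_le_potential (a := a) (b := b) hL hc
  set μ := volume.restrict (Ioo 0 R) with hμ
  -- the density is bounded below
  have hdens : ∀ r ∈ Ioo 0 R, ∀ x y, 0 ≤ density L a b c k r x y + C * r := by
    intro r hr x y
    have := hC x y
    have h1 : 0 ≤ (k : ℝ) ^ 2 / 2 * (x / √r) ^ 2 := by positivity
    unfold density
    nlinarith [hr.1]
  have hCint : Integrable (fun r : ℝ => C * r) μ :=
    (continuous_const.mul continuous_id).integrableOn_Icc.mono_set Ioo_subset_Icc_self
  have hlow : ∀ u v, FiniteDirichlet R u → FiniteDirichlet R v →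
      MemLp (fun r => u r / √r) 2 μ →
      -(∫ r, C * r ∂μ) ≤ ∫ r, density L a b c k r (u r) (v r) ∂μ := by
    intro u v hu hv hu2
    have := integral_nonneg_of_ae (μ := μ) (f := fun r => density L a b c k r (u r) (v r) + C * r)
      (by filter_upwards [ae_restrict_mem measurableSet_Ioo] with r hr using hdens r hr _ _)
    rw [integral_add (hu.integrable_density hv hu2 L a b c k) hCint] at this
    linarith
  set I := ∫ r, C * r ∂μ with hI
  have hpos : ∀ w : ℝ → ℝ, 0 ≤ ∫ r, (√r * deriv w r) ^ 2 ∂μ := fun w =>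
    integral_nonneg fun r => sq_nonneg _
  set T := (fun p : (ℝ → ℝ) × (ℝ → ℝ) => reducedEnergy L R a b c k p.1 p.2) '' admissible R a b c
  have hTb : BddBelow T := by
    refine ⟨-I, ?_⟩
    rintro _ ⟨⟨u, v⟩, hp, rfl⟩
    obtain ⟨hu, hv, hu2, -, -⟩ := mem_admissible_iff.1 hp
    simp only
    rw [reducedEnergy_eq hR hu hv hu2]
    linarith [hlow u v hu hv hu2, hpos u, hpos v]
  obtain ⟨e, -, he, heT⟩ := exists_seq_tendsto_sInf ((admissible_nonempty hR a b c).image _) hTb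
  choose p hp hpe using heT
  have hp' := fun n => mem_admissible_iff.1 (hp n)
  obtain ⟨M, hM⟩ := he.bddAbove_range
  have hM' : ∀ n, e n ≤ M := fun n => hM (mem_range_self n)
  have hen : ∀ n, e n = 1 / 2 * (∫ r, (√r * deriv (p n).1 r) ^ 2 ∂μ)
      + 1 / 2 * (∫ r, (√r * deriv (p n).2 r) ^ 2 ∂μ)
      + ∫ r, density L a b c k r ((p n).1 r) ((p n).2 r) ∂μ := fun n => by
    rw [← hpe n]
    exact reducedEnergy_eq hR (hp' n).1 (hp' n).2.1 (hp' n).2.2.1 L a b c k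
  have hA : ∀ n, ∫ r, (√r * deriv (p n).1 r) ^ 2 ∂μ ≤ 2 * (M + I) := fun n => by
    linarith [hM' n, hen n, hpos (p n).1, hpos (p n).2,
      hlow _ _ (hp' n).1 (hp' n).2.1 (hp' n).2.2.1]
  have hB : ∀ n, ∫ r, (√r * deriv (p n).2 r) ^ 2 ∂μ ≤ 2 * (M + I) := fun n => by
    linarith [hM' n, hen n, hpos (p n).1, hpos (p n).2,
      hlow _ _ (hp' n).1 (hp' n).2.1 (hp' n).2.2.1]
  -- Two successive extractions: `v` is extracted along the subsequence already chosen for `u`, and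
  -- pointwise convergence of `u` survives.
  obtain ⟨u, φ, α, hφ, huac, hu2, huR, hulim, hα, hαle⟩ := exists_weak_limit
    (fun n => (hp' n).1.ac) (fun n => (hp' n).1.memLp) (fun n => (hp' n).2.2.2.1) hA
  obtain ⟨v, ψ, β, hψ, hvac, hv2, hvR, hvlim, hβ, hβle⟩ := exists_weak_limit
    (fun n => (hp' (φ n)).2.1.ac) (fun n => (hp' (φ n)).2.1.memLp)
    (fun n => (hp' (φ n)).2.2.2.2) (fun n => hB (φ n))
  have hu : FiniteDirichlet R u := ⟨huac, hu2⟩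
  have hv : FiniteDirichlet R v := ⟨hvac, hv2⟩
  -- Fatou's lemma for the remaining terms
  set χ := fun n => φ (ψ n)
  have hχ : Tendsto χ atTop atTop := hφ.tendsto_atTop.comp hψ.tendsto_atTop
  -- Adding `C r` makes the density nonnegative, as Fatou's lemma requires; its integral `I` is
  -- restored afterwards.
  set G : ℕ → ℝ → ℝ := fun n r => density L a b c k r ((p (χ n)).1 r) ((p (χ n)).2 r) + C * r
    with hG
  set G' : ℝ → ℝ := fun r => density L a b c k r (u r) (v r) + C * r with hG'
  have hGi : ∀ n, Integrable (G n) μ := fun n =>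
    ((hp' _).1.integrable_density (hp' _).2.1 (hp' _).2.2.1 L a b c k).add hCint
  have hGlim : ∀ r ∈ Ioo 0 R, Tendsto (fun n => G n r) atTop (𝓝 (G' r)) := by
    intro r hr
    have h1 : Tendsto (fun n => (p (χ n)).1 r) atTop (𝓝 (u r)) :=
      (hulim r (Ioo_subset_Ioc_self hr)).comp hψ.tendsto_atTop
    have h2 : Tendsto (fun n => (p (χ n)).2 r) atTop (𝓝 (v r)) :=
      hvlim r (Ioo_subset_Ioc_self hr)
    have hcont : Continuous fun z : ℝ × ℝ => density L a b c k r z.1 z.2 := by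
      unfold density potential cubic; fun_prop
    exact ((hcont.tendsto (u r, v r)).comp (h1.prodMk_nhds h2)).add_const _
  have hGint : ∀ n, ∫ r, G n r ∂μ ≤ e (χ n) - 1 / 2 * α (ψ n) - 1 / 2 * β n + I := by
    intro n
    rw [hG, integral_add ((hp' _).1.integrable_density (hp' _).2.1 (hp' _).2.2.1 L a b c k) hCint]
    linarith [hen (χ n), hαle (ψ n), hβle n]
  set ℓ := sInf T - 1 / 2 * (∫ r, (√r * deriv u r) ^ 2 ∂μ)
    - 1 / 2 * (∫ r, (√r * deriv v r) ^ 2 ∂μ) + I with hℓ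
  have hlim : Tendsto (fun n => e (χ n) - 1 / 2 * α (ψ n) - 1 / 2 * β n + I) atTop (𝓝 ℓ) :=
    (((he.comp hχ).sub ((hα.comp hψ.tendsto_atTop).const_mul _)).sub (hβ.const_mul _)).add_const I
  have hG0 : ∀ n, 0 ≤ᵐ[μ] G n := fun n => by
    filter_upwards [ae_restrict_mem measurableSet_Ioo] with r hr using hdens r hr _ _
  obtain ⟨hG'i, h1⟩ := integrable_and_integral_le_of_tendsto (G' := G') hGi hG0
    ((aestronglyMeasurable_density huac hvac L a b c k).add hCint.aestronglyMeasurable)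
    (by filter_upwards [ae_restrict_mem measurableSet_Ioo] with r hr using hGlim r hr) hGint hlim
  have hpot : Integrable (fun r => potential L a b c (u r) (v r) * r) μ := by
    obtain ⟨C, hC, hCp⟩ := exists_abs_potential_le L a b c
    exact hu.integrable_comp hv hC (continuous_potential L a b c) hCp
  -- Fatou makes the limit density integrable and the growth bound does so for its potential part.
  -- What remains is `k²/2 (u/√r)²`, and dividing by `k²` recovers the weighted condition on `u`.
  have hk2 : 0 < (k : ℝ) ^ 2 := by positivity
  have hu3 : MemLp (fun r => u r / √r) 2 μ := by
    rw [memLp_two_iff_integrable_sq huac.aestronglyMeasurable_div_sqrt]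
    refine (((hG'i.sub hCint).sub hpot).const_mul (2 / (k : ℝ) ^ 2)).congr
      (Eventually.of_forall fun r => ?_)
    change 2 / (k : ℝ) ^ 2 * (density L a b c k r (u r) (v r) + C * r - C * r
      - potential L a b c (u r) (v r) * r) = (u r / √r) ^ 2
    unfold density
    field_simp
    ring
  refine ⟨u, v, mem_admissible_iff.2 ⟨hu, hv, hu3, huR, hvR⟩, fun q hq => ?_⟩
  refine le_trans ?_ (csInf_le hTb (mem_image_of_mem _ hq))
  rw [reducedEnergy_eq hR hu hv hu3]
  rw [hG', integral_add (hu.integrable_density hv hu3 L a b c k) hCint] at h1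
  linarith

/-! ### The first variation -/

theorem LocallyAC.ae_differentiableAt {R : ℝ} {w : ℝ → ℝ} (hw : LocallyAC R w) :
    ∀ᵐ r ∂volume.restrict (Ioo 0 R), DifferentiableAt ℝ w r := by
  rw [ae_restrict_iff' measurableSet_Ioo]
  rcases le_or_gt R 0 with hR | hR
  · simp [Ioo_eq_empty hR.not_gt]
  have h : ∀ n : ℕ, ∀ᵐ r, r ∈ uIcc (R / (n + 2)) R → DifferentiableAt ℝ w r := fun n =>
    (hw _ ⟨by positivity, div_lt_self hR (by linarith)⟩).ae_differentiableAt
  filter_upwards [ae_all_iff.2 h] with r hr hr0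
  obtain ⟨n, hn⟩ := exists_nat_gt (R / r)
  have h1 : R / (n + 2) ≤ r := by
    rw [div_lt_iff₀ hr0.1] at hn
    rw [div_le_iff₀ (by positivity)]
    nlinarith [hr0.1]
  exact hr n (by rw [uIcc_of_le (h1.trans hr0.2.le)]; exact ⟨h1, hr0.2.le⟩)

theorem LocallyAC.ae_deriv_add_const_mul {R : ℝ} {u η : ℝ → ℝ} (hu : LocallyAC R u)
    (hη : LocallyAC R η) (t : ℝ) : ∀ᵐ r ∂volume.restrict (Ioo 0 R),
      deriv (fun r => u r + t * η r) r = deriv u r + t * deriv η r := by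
  filter_upwards [hu.ae_differentiableAt, hη.ae_differentiableAt] with r h1 h2
  exact (h1.hasDerivAt.add (h2.hasDerivAt.const_mul t)).deriv

theorem FiniteDirichlet.add_const_mul {R : ℝ} {u η : ℝ → ℝ} (hu : FiniteDirichlet R u)
    (hη : FiniteDirichlet R η) (t : ℝ) : FiniteDirichlet R (fun r => u r + t * η r) := by
  refine ⟨fun ε hε => (hu.ac ε hε).fun_add ((hη.ac ε hε).const_mul t), ?_⟩
  refine (hu.memLp.add (hη.memLp.const_mul t)).ae_eq ?_
  filter_upwards [hu.ac.ae_deriv_add_const_mul hη.ac t] with r hr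
  simp only [Pi.add_apply, hr]
  ring

theorem FiniteDirichlet.integral_add_const_mul {R : ℝ} {u η : ℝ → ℝ} (hu : FiniteDirichlet R u)
    (hη : FiniteDirichlet R η) (t : ℝ) :
    ∫ r in Ioo 0 R, (√r * deriv (fun r => u r + t * η r) r) ^ 2 =
      (∫ r in Ioo 0 R, (√r * deriv u r) ^ 2)
      + 2 * t * (∫ r in Ioo 0 R, (√r * deriv u r) * (√r * deriv η r))
      + t ^ 2 * ∫ r in Ioo 0 R, (√r * deriv η r) ^ 2 := by
  have h1 := hu.memLp.integrable_sq
  have h2 : Integrable (fun r => (√r * deriv u r) * (√r * deriv η r))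
    (volume.restrict (Ioo 0 R)) := hu.memLp.integrable_mul hη.memLp
  have h3 := hη.memLp.integrable_sq
  have h4 : Integrable (fun r => (√r * deriv u r) ^ 2
      + 2 * t * ((√r * deriv u r) * (√r * deriv η r))) (volume.restrict (Ioo 0 R)) :=
    h1.add (h2.const_mul _)
  rw [← integral_const_mul, ← integral_const_mul, ← integral_add h1 (h2.const_mul _),
    ← integral_add h4 (h3.const_mul _)]
  refine integral_congr_ae ?_
  filter_upwards [hu.ac.ae_deriv_add_const_mul hη.ac t] with r hr
  simp only [hr]
  ring

/-- Variations supported in `[ε, R]` and vanishing at `R`. -/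
structure IsVariation (ε R : ℝ) (η : ℝ → ℝ) : Prop extends FiniteDirichlet R η where
  eq_zero : ∀ r ∈ Ioc 0 ε, η r = 0
  apply_right : η R = 0

theorem IsVariation.zero (ε R : ℝ) : IsVariation ε R (fun _ => 0) := by
  refine ⟨⟨fun ε _ => ContDiffOn.absolutelyContinuousOnInterval (by fun_prop), ?_⟩, by simp, rfl⟩
  simp

theorem exists_bound_of_continuousOn_Ioc {ε R : ℝ} (hε : 0 < ε) {f : ℝ → ℝ}
    (hf : ContinuousOn f (Ioc 0 R)) : ∃ M, ∀ r ∈ Icc ε R, |f r| ≤ M := by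
  obtain ⟨M, hM⟩ := (isCompact_Icc (a := ε) (b := R)).exists_bound_of_continuousOn
    (hf.mono fun r hr => ⟨hε.trans_le hr.1, hr.2⟩)
  exact ⟨M, hM⟩

theorem integrable_of_continuousOn_of_eq_zero {ε R : ℝ} (hε : 0 < ε) {f : ℝ → ℝ}
    (hf : ContinuousOn f (Ioc 0 R)) (hf0 : ∀ r ∈ Ioc 0 ε, f r = 0) :
    Integrable f (volume.restrict (Ioo 0 R)) := by
  obtain ⟨M, hM⟩ := exists_bound_of_continuousOn_Ioc hε hf
  refine Integrable.of_bound ((hf.mono Ioo_subset_Ioc_self).aestronglyMeasurable measurableSet_Ioo)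
    (max M 0) ?_
  filter_upwards [ae_restrict_mem measurableSet_Ioo] with r hr
  rcases le_or_gt r ε with h | h
  · simp [hf0 r ⟨hr.1, h⟩]
  · exact (hM r ⟨h.le, hr.2.le⟩).trans (le_max_left _ _)

/-- The partial derivative of the potential in the first variable. -/
def potentialX (L a b c x y : ℝ) : ℝ :=
  -(a ^ 2 / L) * x + c ^ 2 / L * (x ^ 2 + y ^ 2) * x + b ^ 2 / (3 * L * √6) * (6 * x * y)

/-- The partial derivative of the potential in the second variable. -/
def potentialY (L a b c x y : ℝ) : ℝ :=
  -(a ^ 2 / L) * y + c ^ 2 / L * (x ^ 2 + y ^ 2) * y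
    - b ^ 2 / (3 * L * √6) * (3 * y ^ 2 - 3 * x ^ 2)

/-- The potential is a polynomial, so the second-order remainder is `t²` times a polynomial in all
five variables, bounded on a compact box. A one-sided bound is enough, since minimality is used only
as an inequality. -/
theorem exists_potential_taylor_bound (L a b c M : ℝ) :
    ∃ C, ∀ t x y p q, |t| ≤ 1 → |x| ≤ M → |y| ≤ M → |p| ≤ M → |q| ≤ M →
      potential L a b c (x + t * p) (y + t * q) ≤ potential L a b c x y
        + t * (potentialX L a b c x y * p + potentialY L a b c x y * q) + t ^ 2 * C := by
  -- The exact quotient of the Taylor remainder by `t²`, in the variables `(t, x, y, p, q)`.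
  let f : ℝ × ℝ × ℝ × ℝ × ℝ → ℝ := fun z =>
    -(a ^ 2 / (2 * L)) * (z.2.2.2.1 ^ 2 + z.2.2.2.2 ^ 2) + c ^ 2 / (4 * L) *
      ((2 * (z.2.1 * z.2.2.2.1 + z.2.2.1 * z.2.2.2.2)) ^ 2
        + 2 * (z.2.1 ^ 2 + z.2.2.1 ^ 2) * (z.2.2.2.1 ^ 2 + z.2.2.2.2 ^ 2)
        + 2 * z.1 * (2 * (z.2.1 * z.2.2.2.1 + z.2.2.1 * z.2.2.2.2)) *
          (z.2.2.2.1 ^ 2 + z.2.2.2.2 ^ 2)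
        + z.1 ^ 2 * (z.2.2.2.1 ^ 2 + z.2.2.2.2 ^ 2) ^ 2)
      - b ^ 2 / (3 * L * √6) * (3 * z.2.2.1 * z.2.2.2.2 ^ 2 + z.1 * z.2.2.2.2 ^ 3
        - 3 * z.2.2.2.1 ^ 2 * z.2.2.1 - 6 * z.2.1 * z.2.2.2.1 * z.2.2.2.2
        - 3 * z.1 * z.2.2.2.1 ^ 2 * z.2.2.2.2)
  have hf : Continuous f := by fun_prop
  obtain ⟨C, hC⟩ := ((isCompact_Icc (a := (-1 : ℝ)) (b := 1)).prod
    ((isCompact_Icc (a := -M) (b := M)).prod ((isCompact_Icc (a := -M) (b := M)).prod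
    ((isCompact_Icc (a := -M) (b := M)).prod
    (isCompact_Icc (a := -M) (b := M)))))).exists_bound_of_continuousOn hf.continuousOn
  refine ⟨C, fun t x y p q ht hx hy hp hq => ?_⟩
  have h1 : f (t, x, y, p, q) ≤ C := (le_abs_self _).trans
    (hC (t, x, y, p, q) ⟨abs_le.1 ht, abs_le.1 hx, abs_le.1 hy, abs_le.1 hp, abs_le.1 hq⟩)
  have h2 : potential L a b c (x + t * p) (y + t * q) = potential L a b c x y
        + t * (potentialX L a b c x y * p + potentialY L a b c x y * q)
        + t ^ 2 * f (t, x, y, p, q) := by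
    simp only [potential, potentialX, potentialY, cubic, f]
    ring
  rw [h2]
  gcongr

/-- Taking `t = ± s` gives `|e| ≤ s C` for all small `s`. This extracts stationarity from minimality
without differentiating the energy. -/
theorem eq_zero_of_forall_nonneg {e C : ℝ} (h : ∀ t : ℝ, |t| ≤ 1 → 0 ≤ t * e + t ^ 2 * C) :
    e = 0 := by
  have h1 : ∀ s : ℝ, 0 < s → s ≤ 1 → |e| ≤ s * C := by
    intro s hs hs1
    have h2 := h s (by rw [abs_of_pos hs]; exact hs1)
    have h3 := h (-s) (by rw [abs_neg, abs_of_pos hs]; exact hs1)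
    rw [abs_le]
    constructor <;> nlinarith
  by_contra he
  have he' : 0 < |e| := abs_pos.2 he
  have hC : 0 < C := by have := h1 1 one_pos le_rfl; linarith
  have h4 := h1 (min 1 (|e| / (2 * C))) (by positivity) (min_le_left _ _)
  have h5 : min 1 (|e| / (2 * C)) * C ≤ |e| / 2 := by
    calc _ ≤ |e| / (2 * C) * C := by gcongr; exact min_le_right _ _
      _ = |e| / 2 := by field_simp
  linarith

/-- The Euler-Lagrange equation of the reduced energy in weak form. -/
theorem first_variation_eq_zero {a b c L R ε : ℝ} {k : ℤ} (hR : 0 < R) (hε : 0 < ε)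
    {u v η ζ : ℝ → ℝ} (huv : (u, v) ∈ admissible R a b c)
    (hmin : ∀ p ∈ admissible R a b c,
      reducedEnergy L R a b c k u v ≤ reducedEnergy L R a b c k p.1 p.2)
    (hη : IsVariation ε R η) (hζ : IsVariation ε R ζ) :
    (∫ r in Ioo 0 R, (√r * deriv u r) * (√r * deriv η r))
      + (∫ r in Ioo 0 R, (√r * deriv v r) * (√r * deriv ζ r))
      + ∫ r in Ioo 0 R, ((k : ℝ) ^ 2 * u r / r * η r + (potentialX L a b c (u r) (v r) * η r
        + potentialY L a b c (u r) (v r) * ζ r) * r) = 0 := by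
  obtain ⟨hu, hv, hu2, huR, hvR⟩ := mem_admissible_iff.1 huv
  obtain ⟨M1, hM1⟩ := exists_bound_of_continuousOn_Ioc hε hu.ac.continuousOn
  obtain ⟨M2, hM2⟩ := exists_bound_of_continuousOn_Ioc hε hv.ac.continuousOn
  obtain ⟨M3, hM3⟩ := exists_bound_of_continuousOn_Ioc hε hη.ac.continuousOn
  obtain ⟨M4, hM4⟩ := exists_bound_of_continuousOn_Ioc hε hζ.ac.continuousOn
  set M := max (max M1 M2) (max M3 M4)
  obtain ⟨C, hC⟩ := exists_potential_taylor_bound L a b c M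
  set μ := volume.restrict (Ioo 0 R) with hμ
  set D : ℝ → ℝ := fun r => (k : ℝ) ^ 2 * u r / r * η r + (potentialX L a b c (u r) (v r) * η r
        + potentialY L a b c (u r) (v r) * ζ r) * r with hD
  have hDi : Integrable D μ := by
    refine integrable_of_continuousOn_of_eq_zero hε ?_ fun r hr => ?_
    · have h1 := hu.ac.continuousOn
      have h2 := hv.ac.continuousOn
      have h3 := hη.ac.continuousOn
      have h4 := hζ.ac.continuousOn
      have h5 : ∀ r ∈ Ioc 0 R, r ≠ 0 := fun r hr => hr.1.ne'
      unfold D potentialX potentialY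
      fun_prop (disch := assumption)
    · simp [hD, hη.eq_zero r hr, hζ.eq_zero r hr]
  -- On `(0, ε]` the variations vanish and only a nonnegative constant is added. On `[ε, R]` all
  -- four functions are bounded by `M`, and `η²/r ≤ M²/ε` controls the quadratic part of the
  -- centrifugal term.
  have hdens : ∀ t : ℝ, |t| ≤ 1 → ∀ r ∈ Ioo 0 R,
      density L a b c k r (u r + t * η r) (v r + t * ζ r) ≤ density L a b c k r (u r) (v r)
        + t * D r + t ^ 2 * ((k : ℝ) ^ 2 / 2 * (M ^ 2 / ε) + |C| * R) := by
    intro t ht r hr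
    rcases le_or_gt r ε with h | h
    · have h0 : 0 ≤ t ^ 2 * ((k : ℝ) ^ 2 / 2 * (M ^ 2 / ε) + |C| * R) := by positivity
      simpa [hD, hη.eq_zero r ⟨hr.1, h⟩, hζ.eq_zero r ⟨hr.1, h⟩] using h0
    · have hr' : r ∈ Icc ε R := ⟨h.le, hr.2.le⟩
      have h1 : |u r| ≤ M := (hM1 r hr').trans ((le_max_left _ _).trans (le_max_left _ _))
      have h2 : |v r| ≤ M := (hM2 r hr').trans ((le_max_right _ _).trans (le_max_left _ _))
      have h3 : |η r| ≤ M := (hM3 r hr').trans ((le_max_left _ _).trans (le_max_right _ _))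
      have h4 : |ζ r| ≤ M := (hM4 r hr').trans ((le_max_right _ _).trans (le_max_right _ _))
      have h5 := hC t (u r) (v r) (η r) (ζ r) ht h1 h2 h3 h4
      have h6 : (η r) ^ 2 / r ≤ M ^ 2 / ε := by
        exact div_le_div₀ (sq_nonneg M) (sq_le_sq' (abs_le.1 h3).1 (abs_le.1 h3).2) hε h.le
      have h7 : ((u r + t * η r) / √r) ^ 2 = (u r / √r) ^ 2 + 2 * t * (u r * η r / r)
          + t ^ 2 * (η r ^ 2 / r) := by
        simp only [div_pow, Real.sq_sqrt hr.1.le]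
        ring
      have h8 : C * r ≤ |C| * R :=
        mul_le_mul (le_abs_self C) hr.2.le hr.1.le (abs_nonneg C)
      have h9 : potential L a b c (u r + t * η r) (v r + t * ζ r) * r ≤
          (potential L a b c (u r) (v r) + t * (potentialX L a b c (u r) (v r) * η r
          + potentialY L a b c (u r) (v r) * ζ r) + t ^ 2 * C) * r := by
        gcongr
        exact hr.1.le
      have h10 : t ^ 2 * (C * r) ≤ t ^ 2 * (|C| * R) := by gcongr
      have h11 : t ^ 2 * ((k : ℝ) ^ 2 / 2 * (η r ^ 2 / r)) ≤
        t ^ 2 * ((k : ℝ) ^ 2 / 2 * (M ^ 2 / ε)) := by gcongr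
      have h12 : (k : ℝ) ^ 2 * u r / r * η r = (k : ℝ) ^ 2 * (u r * η r / r) := by ring
      unfold density
      rw [h7]
      simp only [hD, h12]
      linarith
  refine eq_zero_of_forall_nonneg (C := (∫ r, (√r * deriv η r) ^ 2 ∂μ) / 2
    + (∫ r, (√r * deriv ζ r) ^ 2 ∂μ) / 2
    + R * ((k : ℝ) ^ 2 / 2 * (M ^ 2 / ε) + |C| * R)) fun t ht => ?_
  -- Vanishing near the origin keeps the perturbed pair in the admissible set despite the singular
  -- weight.
  have hηq : MemLp (fun r => η r / √r) 2 μ := by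
    rw [memLp_two_iff_integrable_sq hη.ac.aestronglyMeasurable_div_sqrt]
    refine integrable_of_continuousOn_of_eq_zero hε ?_ fun r hr => ?_
    · refine (hη.ac.continuousOn.div (by fun_prop) fun r hr => ?_).pow 2
      exact (Real.sqrt_pos.2 hr.1).ne'
    · simp [hη.eq_zero r hr]
  have hut := hu.add_const_mul hη.toFiniteDirichlet t
  have hvt := hv.add_const_mul hζ.toFiniteDirichlet t
  have hut2 : MemLp (fun r => (u r + t * η r) / √r) 2 μ := by
    refine (hu2.add (hηq.const_mul t)).ae_eq (Eventually.of_forall fun r => ?_)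
    simp only [Pi.add_apply]
    ring
  have hle := hmin (fun r => u r + t * η r, fun r => v r + t * ζ r)
    (mem_admissible_iff.2 ⟨hut, hvt, hut2, by simp [hη.apply_right, huR],
      by simp [hζ.apply_right, hvR]⟩)
  rw [reducedEnergy_eq hR hu hv hu2, reducedEnergy_eq hR hut hvt hut2,
    hu.integral_add_const_mul hη.toFiniteDirichlet, hv.integral_add_const_mul
    hζ.toFiniteDirichlet] at hle
  have hdi := hu.integrable_density hv hu2 L a b c k
  have hdiD : Integrable (fun r => density L a b c k r (u r) (v r) + t * D r) μ :=
    hdi.add (hDi.const_mul t)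
  have h1 := integral_mono_ae (μ := μ) (hut.integrable_density hvt hut2 L a b c k)
    (hdiD.add (integrable_const _))
    (by filter_upwards [ae_restrict_mem measurableSet_Ioo] with r hr using hdens t ht r hr)
  simp only [Pi.add_apply] at h1
  rw [integral_add hdiD (integrable_const _), integral_add hdi (hDi.const_mul t),
    integral_const_mul, integral_const] at h1
  have h2 : μ.real univ = R := by simp [hμ, hR.le, Measure.real]
  rw [h2, smul_eq_mul] at h1
  linarith

/-! ### The du Bois-Reymond lemma -/

theorem intervalIntegrable_of_continuousOn_Ioc {R : ℝ} {q : ℝ → ℝ} (hq : ContinuousOn q (Ioc 0 R)) :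
    ∀ ε ∈ Ioo 0 R, IntervalIntegrable q volume ε R := by
  intro ε hε
  refine ContinuousOn.intervalIntegrable (hq.mono ?_)
  rw [uIcc_of_le hε.2.le]
  exact fun r hr => ⟨hε.1.trans_le hr.1, hr.2⟩

theorem LocallyAC.congr_neg_primitive {R : ℝ} {q : ℝ → ℝ}
    (hq : ∀ ε ∈ Ioo 0 R, IntervalIntegrable q volume ε R) :
    LocallyAC R (fun r => ∫ s in r..R, q s) ∧
    ∀ᵐ r ∂volume.restrict (Ioo 0 R), HasDerivAt (fun r => ∫ s in r..R, q s) (-q r) r := by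
  constructor
  · intro ε hε
    simpa using (locallyAC_primitive (β := 0) hq ε hε).fun_neg
  · filter_upwards [ae_hasDerivAt_primitive (β := 0) hq] with r hr
    simpa using hr.fun_neg

/-- Zero mean makes the primitive that vanishes at `R` vanish to the left of `ε` too, so any square
integrable `ψ` of zero mean on `(ε, R)` is the derivative of an admissible variation. -/
theorem isVariation_primitive {ε R : ℝ} (hε : ε ∈ Ioo 0 R) {ψ : ℝ → ℝ}
    (hψ : MemLp ψ 2 (volume.restrict (Ioo ε R))) (hψ0 : ∀ r, r ∉ Ioo ε R → ψ r = 0)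
    (hint : ∫ r in Ioo ε R, ψ r = 0) :
    IsVariation ε R (fun r => 0 - ∫ s in r..R, ψ s) ∧
      ∀ᵐ r ∂volume.restrict (Ioo 0 R), deriv (fun r => 0 - ∫ s in r..R, ψ s) r = ψ r := by
  have hind : indicator (Ioo ε R) ψ = ψ := indicator_eq_self.2 fun r hr => by
    by_contra h; exact hr (hψ0 r h)
  have hmem : MemLp ψ 2 volume := by
    rw [← hind, memLp_indicator_iff_restrict measurableSet_Ioo]; exact hψ
  have hi : Integrable ψ volume := by
    rw [← hind, integrable_indicator_iff measurableSet_Ioo]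
    exact hψ.integrable one_le_two
  have hd := ae_hasDerivAt_primitive (R := R) (β := 0) (g := ψ) fun _ _ => hi.intervalIntegrable
  have hd' : ∀ᵐ r ∂volume.restrict (Ioo 0 R), deriv (fun r => 0 - ∫ s in r..R, ψ s) r = ψ r := by
    filter_upwards [hd] with r hr using hr.deriv
  refine ⟨⟨⟨locallyAC_primitive fun _ _ => hi.intervalIntegrable, ?_⟩, fun r hr => ?_, by simp⟩, hd'⟩
  · have h1 : MemLp (fun r => √r * ψ r) 2 (volume.restrict (Ioo 0 R)) := by
      refine MemLp.of_le_mul (c := √R) (hmem.restrict (Ioo 0 R))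
        ((Real.continuous_sqrt.aestronglyMeasurable).mul
          (hmem.restrict (Ioo 0 R)).aestronglyMeasurable) ?_
      filter_upwards [ae_restrict_mem measurableSet_Ioo] with r hr
      rw [norm_mul, Real.norm_of_nonneg (Real.sqrt_nonneg r)]
      gcongr
      exact hr.2.le
    refine h1.ae_eq ?_
    filter_upwards [hd'] with r hr
    rw [hr]
  · have h1 : ∫ s in r..R, ψ s = ∫ s in Ioo ε R, ψ s := by
      rw [intervalIntegral.integral_of_le (hr.2.trans hε.2.le), ← hind,
        setIntegral_indicator measurableSet_Ioo, setIntegral_indicator measurableSet_Ioo,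
        inter_self, inter_eq_right.2 (show Ioo ε R ⊆ Ioc r R from
          fun s hs => ⟨hr.2.trans_lt hs.1, hs.2.le⟩)]
    simp [h1, hint]

/-- The du Bois-Reymond lemma, on a subinterval. -/
theorem exists_const_of_variation {ε R : ℝ} (hε : ε ∈ Ioo 0 R) {u q : ℝ → ℝ}
    (hu : FiniteDirichlet R u) (hq : ContinuousOn q (Ioc 0 R))
    (h : ∀ η, IsVariation ε R η → (∫ r in Ioo 0 R, (√r * deriv u r) * (√r * deriv η r))
      + ∫ r in Ioo 0 R, q r * η r = 0) :
    ∃ m, ∀ᵐ r ∂volume.restrict (Ioo ε R), r * deriv u r + ∫ t in r..R, q t = m := by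
  have hqi := intervalIntegrable_of_continuousOn_Ioc hq
  obtain ⟨hQac, hQd⟩ := LocallyAC.congr_neg_primitive hqi
  set Q : ℝ → ℝ := fun r => ∫ t in r..R, q t with hQ
  set μ := volume.restrict (Ioo ε R) with hμ
  have hsub : Ioo ε R ⊆ Ioo 0 R := Ioo_subset_Ioo_left hε.1.le
  have hμle : μ ≤ volume.restrict (Ioo 0 R) := Measure.restrict_mono hsub le_rfl
  have hP : MemLp (fun r => r * deriv u r) 2 μ := by
    refine MemLp.of_le_mul (c := √R) (hu.memLp.mono_measure hμle)
      (measurable_id.mul (measurable_deriv u)).aestronglyMeasurable ?_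
    filter_upwards [ae_restrict_mem measurableSet_Ioo] with r hr
    have h1 : r * deriv u r = √r * (√r * deriv u r) := by
      rw [← mul_assoc, Real.mul_self_sqrt (hε.1.trans hr.1).le]
    rw [h1, norm_mul, Real.norm_of_nonneg (Real.sqrt_nonneg r)]
    gcongr
    exact hr.2.le
  have hQm : MemLp Q 2 μ := by
    obtain ⟨M, hM⟩ := exists_bound_of_continuousOn_Ioc hε.1 hQac.continuousOn
    refine MemLp.of_bound (hQac.aestronglyMeasurable.mono_measure hμle) M ?_
    filter_upwards [ae_restrict_mem measurableSet_Ioo] with r hr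
    exact hM r ⟨hr.1.le, hr.2.le⟩
  set F : ℝ → ℝ := fun r => r * deriv u r + Q r with hF
  have hFm : MemLp F 2 μ := hP.add hQm
  -- The mean of `F`: with this constant `F - m` has zero mean and is itself an admissible test
  -- derivative.
  set m := (∫ r, F r ∂μ) / (R - ε) with hm
  have hvol : μ.real univ = R - ε := by simp [hμ, hε.2.le, Measure.real]
  set ψ := indicator (Ioo ε R) (fun r => F r - m) with hψ
  have hFmm : MemLp (fun r => F r - m) 2 μ := hFm.sub (memLp_const m)
  have hψae : ψ =ᵐ[μ] fun r => F r - m := by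
    filter_upwards [ae_restrict_mem measurableSet_Ioo] with r hr using indicator_of_mem hr _
  have hψm : MemLp ψ 2 μ := hFmm.ae_eq hψae.symm
  have hRε : R - ε ≠ 0 := by linarith [hε.2]
  have hψint : ∫ r, ψ r ∂μ = 0 := by
    rw [integral_congr_ae hψae, integral_sub (hFm.integrable one_le_two) (integrable_const m),
      integral_const, hvol, smul_eq_mul, hm]
    field_simp
    ring
  obtain ⟨hη, hηd⟩ := isVariation_primitive hε hψm (fun r hr => indicator_of_notMem hr _) hψint
  set η : ℝ → ℝ := fun r => 0 - ∫ s in r..R, ψ s with hη_def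
  have h1 : ∫ r in Ioo 0 R, (√r * deriv u r) * (√r * deriv η r) = ∫ r, r * deriv u r * ψ r ∂μ := by
    rw [← setIntegral_eq_of_subset_of_forall_sdiff_eq_zero measurableSet_Ioo hsub
      (f := fun r => r * deriv u r * ψ r) fun r hr => by
        simp [hψ, indicator_of_notMem hr.2]]
    refine integral_congr_ae ?_
    filter_upwards [hηd, ae_restrict_mem measurableSet_Ioo] with r hr hr0
    rw [hr]
    linear_combination deriv u r * ψ r * Real.mul_self_sqrt hr0.1.le
  -- Integration by parts on `[ε, R]` with `Q' = -q`; the boundary terms vanish because `η` does at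
  -- both ends.
  have h2 : ∫ r in Ioo 0 R, q r * η r = ∫ r, Q r * ψ r ∂μ := by
    rw [setIntegral_eq_of_subset_of_forall_sdiff_eq_zero measurableSet_Ioo hsub fun r hr => by
      have : r ≤ ε := by by_contra hh; exact hr.2 ⟨not_le.1 hh, hr.1.2⟩
      rw [hη.eq_zero r ⟨hr.1.1, this⟩, mul_zero]]
    have h3 := AbsolutelyContinuousOnInterval.integral_mul_deriv_eq_deriv_mul (hQac ε hε) (hη.ac ε hε)
    rw [hη.apply_right, hη.eq_zero ε ⟨hε.1, le_rfl⟩, intervalIntegral.integral_of_le hε.2.le,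
      intervalIntegral.integral_of_le hε.2.le, integral_Ioc_eq_integral_Ioo,
      integral_Ioc_eq_integral_Ioo] at h3
    have h4 : ∫ r, Q r * deriv η r ∂μ = ∫ r, Q r * ψ r ∂μ := by
      refine integral_congr_ae ?_
      filter_upwards [ae_mono hμle hηd] with r hr
      rw [hr]
    have h5 : ∫ r, deriv Q r * η r ∂μ = - ∫ r, q r * η r ∂μ := by
      rw [← integral_neg]
      refine integral_congr_ae ?_
      filter_upwards [ae_mono hμle hQd] with r hr
      rw [hr.deriv, neg_mul]
    rw [h4, h5] at h3
    linarith
  have h3 := h η hη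
  have h4 : Integrable (fun r => r * deriv u r * ψ r) μ := hP.integrable_mul hψm
  have h5 : Integrable (fun r => Q r * ψ r) μ := hQm.integrable_mul hψm
  rw [h1, h2, ← integral_add h4 h5] at h3
  -- Here `∫ (F - m)² = ∫ F ψ - m ∫ ψ`: the first term is the weak equation, the second the zero
  -- mean.
  have h6 : ∫ r, (F r - m) ^ 2 ∂μ = 0 := by
    have h7 : Integrable (fun r => r * deriv u r * ψ r + Q r * ψ r) μ := h4.add h5
    have : ∫ r, (F r - m) ^ 2 ∂μ
        = ∫ r, ((r * deriv u r * ψ r + Q r * ψ r) - m * ψ r) ∂μ := by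
      refine integral_congr_ae ?_
      filter_upwards [hψae] with r hr
      rw [hr, hF]
      ring
    rw [this, integral_sub h7 ((hψm.integrable one_le_two).const_mul m), h3, integral_const_mul,
      hψint]
    simp
  rw [integral_eq_zero_iff_of_nonneg (fun r => sq_nonneg _) hFmm.integrable_sq] at h6
  refine ⟨m, ?_⟩
  filter_upwards [h6] with r hr
  have : F r - m = 0 := by simpa using hr
  linarith

/-- The du Bois-Reymond lemma: weak solutions of `(r u')' = q` are classical. -/
theorem eq_primitive_of_variation {R : ℝ} (hR : 0 < R) {u q : ℝ → ℝ}
    (hu : FiniteDirichlet R u) (hq : ContinuousOn q (Ioc 0 R))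
    (h : ∀ ε ∈ Ioo 0 R, ∀ η, IsVariation ε R η →
      (∫ r in Ioo 0 R, (√r * deriv u r) * (√r * deriv η r)) + ∫ r in Ioo 0 R, q r * η r = 0) :
    ∃ m, ∀ r ∈ Ioc 0 R, u r = u R - ∫ s in r..R, (m - ∫ t in s..R, q t) / s := by
  have hR2 : R / 2 ∈ Ioo 0 R := ⟨by linarith, by linarith⟩
  obtain ⟨m, hm⟩ := exists_const_of_variation hR2 hu hq (h _ hR2)
  -- The constants for different `ε` agree because the intervals share `(max ε (R/2), R)`, a set of
  -- positive measure.
  have hall : ∀ ε ∈ Ioo 0 R, ∀ᵐ r ∂volume.restrict (Ioo ε R),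
      r * deriv u r + ∫ t in r..R, q t = m := by
    intro ε hε
    obtain ⟨m', hm'⟩ := exists_const_of_variation hε hu hq (h _ hε)
    have hmax : max ε (R / 2) < R := max_lt hε.2 hR2.2
    have hne : (ae (volume.restrict (Ioo (max ε (R / 2)) R))).NeBot := by
      rw [ae_neBot, Ne, Measure.restrict_eq_zero, Real.volume_Ioo]
      simpa using hmax
    have h1 := hm'.filter_mono (ae_mono (Measure.restrict_mono
      (Ioo_subset_Ioo_left (le_max_left ε (R / 2))) le_rfl))
    have h2 := hm.filter_mono (ae_mono (Measure.restrict_mono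
      (Ioo_subset_Ioo_left (le_max_right ε (R / 2))) le_rfl))
    obtain ⟨s, hs1, hs2⟩ := (h1.and h2).exists
    rwa [← hs1.symm.trans hs2]
  refine ⟨m, fun r hr => ?_⟩
  rcases hr.2.eq_or_lt with rfl | hrR
  · simp
  rw [intervalIntegral.integral_of_le hr.2, integral_Ioc_eq_integral_Ioo]
  have h1 := hu.ac.setIntegral_deriv hr
  have h2 : ∫ s in Ioo r R, (m - ∫ t in s..R, q t) / s = ∫ s in Ioo r R, deriv u s := by
    refine integral_congr_ae ?_
    filter_upwards [hall r ⟨hr.1, hrR⟩, ae_restrict_mem measurableSet_Ioo] with s hs hs0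
    have : s ≠ 0 := (hr.1.trans hs0.1).ne'
    rw [← hs]
    field_simp
    ring
  rw [h2]
  linarith

/-! ### Interior regularity of the integrated equation -/

theorem primitive_regularity {R m : ℝ} {u q : ℝ → ℝ} (hq : ContinuousOn q (Ioc 0 R))
    (hu : ∀ r ∈ Ioc 0 R, u r = u R - ∫ s in r..R, (m - ∫ t in s..R, q t) / s) :
    ContinuousOn (fun s => ∫ t in s..R, q t) (Ioc 0 R) ∧
    (∀ r ∈ Ioo 0 R, HasDerivAt u ((m - ∫ t in r..R, q t) / r) r) ∧
    ∀ r ∈ Ioo 0 R, HasDerivAt (fun s => ∫ t in s..R, q t) (-q r) r := by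
  -- For continuous integrands the fundamental theorem of calculus holds at every interior point,
  -- which upgrades the almost everywhere derivatives.
  have key : ∀ f : ℝ → ℝ, ContinuousOn f (Ioc 0 R) → ∀ r ∈ Ioo 0 R,
      HasDerivAt (fun s => ∫ t in s..R, f t) (-f r) r := by
    intro f hf r hr
    refine intervalIntegral.integral_hasDerivAt_left
      (intervalIntegrable_of_continuousOn_Ioc hf r hr) ?_ ?_
    · exact ContinuousOn.stronglyMeasurableAtFilter isOpen_Ioo (hf.mono Ioo_subset_Ioc_self) r hr
    · exact hf.continuousAt (mem_of_superset (Ioo_mem_nhds hr.1 hr.2) Ioo_subset_Ioc_self)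
  have hQ := (LocallyAC.congr_neg_primitive (intervalIntegrable_of_continuousOn_Ioc hq)).1.continuousOn
  refine ⟨hQ, fun r hr => ?_, key q hq⟩
  have hf : ContinuousOn (fun s => (m - ∫ t in s..R, q t) / s) (Ioc 0 R) :=
    (continuousOn_const.sub hQ).div continuousOn_id fun r hr => hr.1.ne'
  have h1 := (key _ hf r hr).const_sub (u R)
  rw [neg_neg] at h1
  refine h1.congr_of_eventuallyEq ?_
  filter_upwards [Ioo_mem_nhds hr.1 hr.2] with s hs using hu s (Ioo_subset_Ioc_self hs)

theorem contDiffOn_succ_of_hasDerivAt {s : Set ℝ} (hs : IsOpen s) {n : ℕ} {f f' : ℝ → ℝ}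
    (hf : ∀ x ∈ s, HasDerivAt f (f' x) x) (hf' : ContDiffOn ℝ n f' s) :
    ContDiffOn ℝ (n + 1) f s := by
  rw [contDiffOn_succ_iff_deriv_of_isOpen hs]
  refine ⟨fun x hx => (hf x hx).differentiableAt.differentiableWithinAt, by simp,
    hf'.congr fun x hx => (hf x hx).deriv⟩

/-! ### Behaviour at the origin -/

theorem abs_potentialY_le (L a b c : ℝ) :
    ∃ C, 0 ≤ C ∧ ∀ x y, |potentialY L a b c x y| ≤ C * (1 + (x ^ 2 + y ^ 2) ^ 2) := by
  refine ⟨|a ^ 2 / L| + |c ^ 2 / L| + |b ^ 2 / (3 * L * √6)| * 3, by positivity, fun x y => ?_⟩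
  have h1 : |y| ≤ 1 + (x ^ 2 + y ^ 2) ^ 2 := by
    have := sq_abs y
    nlinarith [sq_nonneg (|y| - 1), sq_nonneg (x ^ 2 + y ^ 2 - 1), sq_nonneg x]
  have h2 : |(x ^ 2 + y ^ 2) * y| ≤ 1 + (x ^ 2 + y ^ 2) ^ 2 := by
    rw [abs_mul, abs_of_nonneg (by positivity : 0 ≤ x ^ 2 + y ^ 2)]
    have h3 : |y| ≤ (1 + (x ^ 2 + y ^ 2)) / 2 := by
      have := sq_abs y
      nlinarith [sq_nonneg (|y| - 1), sq_nonneg x]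
    have h4 : (x ^ 2 + y ^ 2) * |y| ≤ (x ^ 2 + y ^ 2) * ((1 + (x ^ 2 + y ^ 2)) / 2) := by gcongr
    nlinarith [sq_nonneg (x ^ 2 + y ^ 2 - 1)]
  have h3 : |3 * y ^ 2 - 3 * x ^ 2| ≤ 3 * (1 + (x ^ 2 + y ^ 2) ^ 2) := by
    have h4 : x ^ 2 + y ^ 2 ≤ 1 + (x ^ 2 + y ^ 2) ^ 2 := by
      nlinarith [sq_nonneg (x ^ 2 + y ^ 2 - 1)]
    rw [abs_le]
    constructor <;> nlinarith [sq_nonneg x, sq_nonneg y]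
  unfold potentialY
  refine (abs_sub _ _).trans ((add_le_add_left (abs_add_le _ _) _).trans ?_)
  rw [abs_mul, mul_assoc, abs_mul, abs_mul, abs_neg, add_mul, add_mul, mul_assoc _ 3]
  gcongr
  · rw [← abs_mul]; exact h2
  · rw [abs_mul]; gcongr

/-- If `g / r` is integrable near `0` and `g` has a limit at `0`, then that limit is `0`. -/
theorem eq_zero_of_tendsto_of_integrable_div {R ℓ : ℝ} (hR : 0 < R) {g : ℝ → ℝ}
    (hg : Tendsto g (𝓝[>] 0) (𝓝 ℓ))
    (hi : Integrable (fun r => g r / r) (volume.restrict (Ioo 0 R))) : ℓ = 0 := by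
  by_contra hℓ
  have h1 : ∀ᶠ r in 𝓝[>] (0 : ℝ), |ℓ| / 2 < |g r| :=
    hg.abs.eventually_const_lt (half_lt_self (abs_pos.2 hℓ))
  obtain ⟨δ, hδ0, hδ⟩ := mem_nhdsGT_iff_exists_Ioo_subset.1 h1
  set d := min δ R
  have hd : 0 < d := lt_min hδ0 hR
  have h2 : IntegrableOn (fun r : ℝ => r⁻¹) (Ioo 0 d) := by
    refine Integrable.mono' (((hi.mono_measure (Measure.restrict_mono
      (Ioo_subset_Ioo_right (min_le_right δ R)) le_rfl)).norm.const_mul (2 / |ℓ|)))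
      measurable_inv.aestronglyMeasurable ?_
    filter_upwards [ae_restrict_mem measurableSet_Ioo] with r hr
    have h3 : |ℓ| / 2 < |g r| := hδ ⟨hr.1, hr.2.trans_le (min_le_left _ _)⟩
    have h4 : 0 < |ℓ| := abs_pos.2 hℓ
    rw [norm_inv, norm_div, Real.norm_eq_abs, Real.norm_eq_abs, inv_eq_one_div,
      abs_of_pos hr.1, mul_div_assoc']
    have := hr.1
    gcongr
    rw [div_mul_eq_mul_div, le_div_iff₀ h4]
    linarith
  rw [← intervalIntegrable_iff_integrableOn_Ioo_of_le hd.le, intervalIntegrable_inv_iff] at h2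
  rcases h2 with h2 | h2
  · exact hd.ne h2
  · exact h2 left_mem_uIcc

theorem tendsto_integral_right {R : ℝ} (hR : 0 < R) {f : ℝ → ℝ}
    (hf : Integrable f (volume.restrict (Ioo 0 R))) :
    Tendsto (fun r => ∫ t in r..R, f t) (𝓝[>] 0) (𝓝 (∫ t in (0 : ℝ)..R, f t)) := by
  have hi : IntervalIntegrable f volume 0 R :=
    (intervalIntegrable_iff_integrableOn_Ioo_of_le hR.le).2 hf
  have h1 := (intervalIntegral.continuousOn_primitive_interval' hi right_mem_uIcc) 0 left_mem_uIcc
  have h2 : Tendsto (fun r => ∫ t in R..r, f t) (𝓝[>] 0) (𝓝 (∫ t in R..0, f t)) := by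
    refine h1.mono_left ?_
    rw [uIcc_of_le hR.le, nhdsWithin_Icc_eq_nhdsGE hR]
    exact nhdsWithin_mono _ Ioi_subset_Ici_self
  simpa only [← intervalIntegral.integral_symm] using h2.neg

theorem LocallyAC.congr {R : ℝ} {u w : ℝ → ℝ} (hu : LocallyAC R u) (h : EqOn u w (Ioc 0 R)) :
    LocallyAC R w := by
  intro ε hε
  refine (hu ε hε).congr' (eventually_inf_principal.2 (Eventually.of_forall fun E hE => ?_))
  refine Finset.sum_congr rfl fun i hi => ?_
  have h1 : uIcc ε R ⊆ Ioc 0 R := by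
    rw [uIcc_of_le hε.2.le]
    exact fun r hr => ⟨hε.1.trans_le hr.1, hr.2⟩
  rw [h (h1 (hE.1 i hi).1), h (h1 (hE.1 i hi).2)]

theorem deriv_eqOn {R : ℝ} {u w : ℝ → ℝ} (h : EqOn u w (Ioc 0 R)) :
    EqOn (deriv u) (deriv w) (Ioo 0 R) := fun _ hr =>
  Filter.EventuallyEq.deriv_eq
    (mem_of_superset (Ioo_mem_nhds hr.1 hr.2) fun _ hs => h (Ioo_subset_Ioc_self hs))

theorem FiniteDirichlet.congr {R : ℝ} {u w : ℝ → ℝ} (hu : FiniteDirichlet R u)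
    (h : EqOn u w (Ioc 0 R)) : FiniteDirichlet R w := by
  refine ⟨hu.ac.congr h, hu.memLp.ae_eq ?_⟩
  filter_upwards [ae_restrict_mem measurableSet_Ioo] with r hr
  rw [deriv_eqOn h hr]

/-- Admissibility and energy see only `(0, R]`, so representatives may be altered for `r ≤ 0`. This
is how `u(0) = 0` and a `C¹` extension of `v` are arranged. -/
theorem admissible_congr {R a b c : ℝ} (hR : 0 < R) {u v u' v' : ℝ → ℝ}
    (h : (u, v) ∈ admissible R a b c)
    (hu : EqOn u u' (Ioc 0 R)) (hv : EqOn v v' (Ioc 0 R)) : (u', v') ∈ admissible R a b c := by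
  obtain ⟨h1, h2, h3, h4, h5⟩ := mem_admissible_iff.1 h
  refine mem_admissible_iff.2 ⟨h1.congr hu, h2.congr hv, h3.ae_eq ?_,
    hu ⟨hR, le_rfl⟩ ▸ h4, hv ⟨hR, le_rfl⟩ ▸ h5⟩
  filter_upwards [ae_restrict_mem measurableSet_Ioo] with r hr
  rw [hu (Ioo_subset_Ioc_self hr)]

theorem reducedEnergy_congr {R : ℝ} (hR : 0 < R) {u v u' v' : ℝ → ℝ} (L a b c : ℝ) (k : ℤ)
    (hu : EqOn u u' (Ioc 0 R)) (hv : EqOn v v' (Ioc 0 R)) :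
    reducedEnergy L R a b c k u v = reducedEnergy L R a b c k u' v' := by
  unfold reducedEnergy
  simp only [intervalIntegral.integral_of_le hR.le, integral_Ioc_eq_integral_Ioo]
  congr 1
  · refine setIntegral_congr_fun measurableSet_Ioo fun r hr => ?_
    simp only [deriv_eqOn hu hr, deriv_eqOn hv hr, hu (Ioo_subset_Ioc_self hr),
      hv (Ioo_subset_Ioc_self hr)]
  · congr 1
    refine setIntegral_congr_fun measurableSet_Ioo fun r hr => ?_
    simp only [hu (Ioo_subset_Ioc_self hr), hv (Ioo_subset_Ioc_self hr)]

/-- The derivative `2 u u' = 2 (u/√r) (√r u')` of `u²` is integrable up to `0`, so `u²` has a limit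
there; integrability of `u²/r` forces that limit to be `0`. -/
theorem FiniteDirichlet.tendsto_zero {R : ℝ} (hR : 0 < R) {u : ℝ → ℝ} (hu : FiniteDirichlet R u)
    (hu2 : MemLp (fun r => u r / √r) 2 (volume.restrict (Ioo 0 R))) :
    Tendsto u (𝓝[>] 0) (𝓝 0) := by
  have h1 : Integrable (fun r => 2 * (u r / √r * (√r * deriv u r)))
      (volume.restrict (Ioo 0 R)) := (hu2.integrable_mul hu.memLp).const_mul 2
  have h2 := (tendsto_integral_right hR h1).const_sub (u R ^ 2)
  have h3 : ∀ r ∈ Ioo 0 R,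
      u R ^ 2 - ∫ t in r..R, 2 * (u t / √t * (√t * deriv u t)) = u r ^ 2 := by
    intro r hr
    have hac := hu.ac r hr
    have h4 := hac.integral_deriv_mul_eq_sub hac
    have h5 : ∫ t in r..R, 2 * (u t / √t * (√t * deriv u t))
        = ∫ t in r..R, (deriv u t * u t + u t * deriv u t) := by
      refine intervalIntegral.integral_congr fun t ht => ?_
      rw [uIcc_of_le hr.2.le] at ht
      have := Real.sqrt_pos.2 (hr.1.trans_le ht.1)
      field_simp
      ring
    rw [h5, h4]
    ring
  have h4 : Tendsto (fun r => u r ^ 2) (𝓝[>] 0) (𝓝 (u R ^ 2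
      - ∫ t in (0 : ℝ)..R, 2 * (u t / √t * (√t * deriv u t)))) := by
    refine h2.congr' ?_
    filter_upwards [Ioo_mem_nhdsGT hR] with r hr using h3 r hr
  have h5 := eq_zero_of_tendsto_of_integrable_div hR h4 (by
    refine hu2.integrable_sq.congr ?_
    filter_upwards [ae_restrict_mem measurableSet_Ioo] with r hr
    rw [div_pow, Real.sq_sqrt hr.1.le])
  rw [h5] at h4
  have h6 := h4.sqrt
  simp only [Real.sqrt_sq_eq_abs, Real.sqrt_zero] at h6
  exact (tendsto_zero_iff_abs_tendsto_zero _).2 h6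

/-! ### The Euler-Lagrange system and the regularity of the minimiser -/

/-- Minimisers solve the Euler-Lagrange system in integrated form. -/
theorem exists_integrated_equations {a b c L R : ℝ} {k : ℤ} (hR : 0 < R) {u v : ℝ → ℝ}
    (huv : (u, v) ∈ admissible R a b c)
    (hmin : ∀ p ∈ admissible R a b c,
      reducedEnergy L R a b c k u v ≤ reducedEnergy L R a b c k p.1 p.2) :
    ContinuousOn (fun r => (k : ℝ) ^ 2 * u r / r + potentialX L a b c (u r) (v r) * r) (Ioc 0 R) ∧
    ContinuousOn (fun r => potentialY L a b c (u r) (v r) * r) (Ioc 0 R) ∧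
    (∃ m, ∀ r ∈ Ioc 0 R, u r = u R - ∫ s in r..R,
      (m - ∫ t in s..R, ((k : ℝ) ^ 2 * u t / t + potentialX L a b c (u t) (v t) * t)) / s) ∧
    ∃ m, ∀ r ∈ Ioc 0 R, v r = v R - ∫ s in r..R,
      (m - ∫ t in s..R, potentialY L a b c (u t) (v t) * t) / s := by
  obtain ⟨hu, hv, -⟩ := mem_admissible_iff.1 huv
  have h1 := hu.ac.continuousOn
  have h2 := hv.ac.continuousOn
  have h5 : ∀ r ∈ Ioc 0 R, r ≠ 0 := fun r hr => hr.1.ne'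
  have hq1 : ContinuousOn (fun r => (k : ℝ) ^ 2 * u r / r + potentialX L a b c (u r) (v r) * r)
      (Ioc 0 R) := by
    unfold potentialX
    fun_prop (disch := assumption)
  have hq2 : ContinuousOn (fun r => potentialY L a b c (u r) (v r) * r) (Ioc 0 R) := by
    unfold potentialY
    fun_prop
  refine ⟨hq1, hq2, eq_primitive_of_variation hR hu hq1 fun ε hε η hη => ?_,
    eq_primitive_of_variation hR hv hq2 fun ε hε η hη => ?_⟩
  · have := first_variation_eq_zero hR hε.1 huv hmin hη (IsVariation.zero ε R)
    simp only [deriv_const', mul_zero, integral_zero, add_zero] at this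
    refine Eq.trans ?_ this
    congr 2
    funext r
    ring
  · have := first_variation_eq_zero hR hε.1 huv hmin (IsVariation.zero ε R) hη
    simp only [deriv_const', mul_zero, integral_zero, zero_add] at this
    refine Eq.trans ?_ this
    congr 2
    funext r
    ring

/-- Bootstrap on a first-order system: the four derivatives are smooth expressions in `r > 0`, `u`,
`v`, `Q₁`, `Q₂`, so each round gains one derivative for all four at once. -/
theorem contDiffOn_of_system {a b c L R m₁ m₂ : ℝ} {k : ℤ} {u v Q₁ Q₂ : ℝ → ℝ}
    (hu : ∀ r ∈ Ioo 0 R, HasDerivAt u ((m₁ - Q₁ r) / r) r)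
    (hv : ∀ r ∈ Ioo 0 R, HasDerivAt v ((m₂ - Q₂ r) / r) r)
    (hQ₁ : ∀ r ∈ Ioo 0 R,
      HasDerivAt Q₁ (-((k : ℝ) ^ 2 * u r / r + potentialX L a b c (u r) (v r) * r)) r)
    (hQ₂ : ∀ r ∈ Ioo 0 R, HasDerivAt Q₂ (-(potentialY L a b c (u r) (v r) * r)) r) :
    ContDiffOn ℝ ∞ u (Ioo 0 R) ∧ ContDiffOn ℝ ∞ v (Ioo 0 R) := by
  have h0 : ∀ r ∈ Ioo 0 R, r ≠ 0 := fun r hr => hr.1.ne'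
  have key : ∀ n : ℕ, ContDiffOn ℝ n u (Ioo 0 R) ∧ ContDiffOn ℝ n v (Ioo 0 R) ∧
      ContDiffOn ℝ n Q₁ (Ioo 0 R) ∧ ContDiffOn ℝ n Q₂ (Ioo 0 R) := by
    intro n
    induction n with
    | zero =>
      simp only [Nat.cast_zero, contDiffOn_zero]
      exact ⟨fun r hr => (hu r hr).continuousAt.continuousWithinAt,
        fun r hr => (hv r hr).continuousAt.continuousWithinAt,
        fun r hr => (hQ₁ r hr).continuousAt.continuousWithinAt,
        fun r hr => (hQ₂ r hr).continuousAt.continuousWithinAt⟩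
    | succ n ih =>
      obtain ⟨h1, h2, h3, h4⟩ := ih
      push_cast
      refine ⟨contDiffOn_succ_of_hasDerivAt isOpen_Ioo hu ?_,
        contDiffOn_succ_of_hasDerivAt isOpen_Ioo hv ?_,
        contDiffOn_succ_of_hasDerivAt isOpen_Ioo hQ₁ ?_,
        contDiffOn_succ_of_hasDerivAt isOpen_Ioo hQ₂ ?_⟩
      · fun_prop (disch := assumption)
      · fun_prop (disch := assumption)
      · unfold potentialX
        fun_prop (disch := assumption)
      · unfold potentialY
        fun_prop (disch := assumption)
  exact ⟨contDiffOn_infty.2 fun n => (key n).1, contDiffOn_infty.2 fun n => (key n).2.1⟩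

/-- With `r w' = m - Q` and `Q' = -q` one has `(r w')' = q`, that is `w'' + w'/r = q/r`. The
remainder is a comparison of coefficients, using `√(2/3) = 2/√6`. -/
theorem solvesODE_of_system {a b c L R m₁ m₂ : ℝ} {k : ℤ} {u v Q₁ Q₂ : ℝ → ℝ}
    (hu : ∀ r ∈ Ioo 0 R, HasDerivAt u ((m₁ - Q₁ r) / r) r)
    (hv : ∀ r ∈ Ioo 0 R, HasDerivAt v ((m₂ - Q₂ r) / r) r)
    (hQ₁ : ∀ r ∈ Ioo 0 R,
      HasDerivAt Q₁ (-((k : ℝ) ^ 2 * u r / r + potentialX L a b c (u r) (v r) * r)) r)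
    (hQ₂ : ∀ r ∈ Ioo 0 R, HasDerivAt Q₂ (-(potentialY L a b c (u r) (v r) * r)) r) :
    SolvesODE L R a b c k u v := by
  have hsnd : ∀ {w Q q : ℝ → ℝ} {m : ℝ}, (∀ r ∈ Ioo 0 R, HasDerivAt w ((m - Q r) / r) r) →
      (∀ r ∈ Ioo 0 R, HasDerivAt Q (-q r) r) → ∀ r ∈ Ioo 0 R,
      deriv (deriv w) r + deriv w r / r = q r / r := by
    intro w Q q m hw hQ r hr
    have h1 : deriv w =ᶠ[𝓝 r] fun r => (m - Q r) / r := by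
      filter_upwards [Ioo_mem_nhds hr.1 hr.2] with s hs using (hw s hs).deriv
    have h2 := ((hQ r hr).const_sub m).fun_div (hasDerivAt_id' r) hr.1.ne'
    rw [h1.deriv_eq, h2.deriv, (hw r hr).deriv]
    have := hr.1.ne'
    field_simp
    ring
  intro r hr
  have hr0 := hr.1.ne'
  have h6 : √6 ^ 2 = 6 := Real.sq_sqrt (by norm_num)
  have h6' : √(2 / 3) = 2 / √6 := by
    rw [Real.sqrt_eq_iff_mul_self_eq (by norm_num) (by positivity), div_mul_div_comm,
      Real.mul_self_sqrt (by norm_num)]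
    norm_num
  constructor
  · rw [hsnd hu hQ₁ r hr, h6']
    unfold potentialX
    field_simp
    ring
  · rw [hsnd hv hQ₂ r hr]
    unfold potentialY
    field_simp
    ring

/-- Once the flux `p = r v'` is known to vanish at `0`, it equals the integral of `q` from `0`, and
estimates on `q` pass to `v' = p / r`. Two rounds are needed, since boundedness of `v` is available
only after the first. -/
theorem exists_continuous_derivative {a b c L R m : ℝ} (hR : 0 < R) {u v : ℝ → ℝ}
    (hu : FiniteDirichlet R u) (hv : FiniteDirichlet R v)
    (hu2 : MemLp (fun r => u r / √r) 2 (volume.restrict (Ioo 0 R)))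
    (hq : ContinuousOn (fun r => potentialY L a b c (u r) (v r) * r) (Ioc 0 R))
    (hv' : ∀ r ∈ Ioc 0 R, v r = v R - ∫ s in r..R,
      (m - ∫ t in s..R, potentialY L a b c (u t) (v t) * t) / s) :
    ∃ w : ℝ → ℝ, Continuous w ∧ w 0 = 0 ∧ ∀ r ∈ Ioc 0 R, v r = v R - ∫ s in r..R, w s := by
  set q : ℝ → ℝ := fun r => potentialY L a b c (u r) (v r) * r with hq_def
  obtain ⟨hQ, hvd, hQd⟩ := primitive_regularity hq hv'
  obtain ⟨C, hC0, hC⟩ := abs_potentialY_le L a b c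
  have hqi : Integrable q (volume.restrict (Ioo 0 R)) :=
    hu.integrable_comp hv hC0 (by unfold Function.uncurry potentialY; fun_prop) hC
  set p : ℝ → ℝ := fun s => m - ∫ t in s..R, q t with hp
  have hplim : Tendsto p (𝓝[>] 0) (𝓝 (m - ∫ t in (0 : ℝ)..R, q t)) :=
    (tendsto_integral_right hR hqi).const_sub m
  -- The flux has a limit at `0`, and `p²/r = (√r v')²` is integrable, so the limit is `0`.
  have hm : m - ∫ t in (0 : ℝ)..R, q t = 0 := by
    have h1 := eq_zero_of_tendsto_of_integrable_div hR (hplim.pow 2) (by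
      refine hv.memLp.integrable_sq.congr ?_
      filter_upwards [ae_restrict_mem measurableSet_Ioo] with r hr
      rw [(hvd r hr).deriv, mul_pow, Real.sq_sqrt hr.1.le]
      have := hr.1.ne'
      simp only [hp]
      field_simp)
    exact pow_eq_zero_iff two_ne_zero |>.1 h1
  have hqII : IntervalIntegrable q volume 0 R :=
    (intervalIntegrable_iff_integrableOn_Ioo_of_le hR.le).2 hqi
  have hp0 : ∀ r ∈ Ioc 0 R, p r = ∫ t in (0 : ℝ)..r, q t := by
    intro r hr
    have h1 : IntervalIntegrable q volume 0 r := hqII.mono_set (by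
      rw [uIcc_of_le hr.1.le, uIcc_of_le hR.le]; exact Icc_subset_Icc_right hr.2)
    have h2 : IntervalIntegrable q volume r R := hqII.mono_set (by
      rw [uIcc_of_le hr.2, uIcc_of_le hR.le]; exact Icc_subset_Icc_left hr.1.le)
    have := intervalIntegral.integral_add_adjacent_intervals h1 h2
    simp only [hp]
    linarith
  have hpb : ∀ r ∈ Ioc 0 R, ∀ M, (∀ s ∈ Ioc 0 r, |q s| ≤ M) → |p r| ≤ M * r := by
    intro r hr M hM
    rw [hp0 r hr]
    have := intervalIntegral.norm_integral_le_of_norm_le_const (a := 0) (b := r) (f := q)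
      (C := M) (fun s hs => hM s (by rwa [uIoc_of_le hr.1.le] at hs))
    simpa [abs_of_pos hr.1] using this
  obtain ⟨K, -, hK⟩ := hu.exists_bound
  obtain ⟨K', -, hK'⟩ := hv.exists_bound
  -- First round: the growth bounds alone make `q` bounded, hence `p / r` bounded, hence `v`
  -- bounded.
  set B := C * (R + (2 * (max K K')) ^ 2)
  have hqB : ∀ r ∈ Ioc 0 R, |q r| ≤ B := fun r hr =>
    abs_mul_le_of_growth hC0 hr ((hK r hr).trans (le_max_left _ _))
      ((hK' r hr).trans (le_max_right _ _)) (hC _ _)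
  have hdivB : ∀ r ∈ Ioc 0 R, |p r / r| ≤ B := by
    intro r hr
    rw [abs_div, abs_of_pos hr.1, div_le_iff₀ hr.1]
    exact hpb r hr B fun s hs => hqB s ⟨hs.1, hs.2.trans hr.2⟩
  have hB0 : 0 ≤ B := (abs_nonneg _).trans (hqB R ⟨hR, le_rfl⟩)
  have hvB : ∀ r ∈ Ioc 0 R, |v r| ≤ |v R| + B * R := by
    intro r hr
    rw [hv' r hr]
    refine (abs_sub _ _).trans (add_le_add_right ?_ _)
    have := intervalIntegral.norm_integral_le_of_norm_le_const (a := r) (b := R)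
      (f := fun s => p s / s) (C := B) (fun s hs => by
        rw [uIoc_of_le hr.2] at hs
        exact hdivB s ⟨hr.1.trans hs.1, hs.2⟩)
    rw [abs_of_nonneg (by linarith [hr.2])] at this
    refine this.trans ?_
    gcongr
    linarith [hr.1]
  obtain ⟨Mu, hMu⟩ : ∃ Mu, ∀ r ∈ Ioc 0 R, |u r| ≤ Mu := by
    have h1 : ∀ᶠ r in 𝓝[>] (0 : ℝ), |u r| < 1 := by
      simpa using (hu.tendsto_zero hR hu2).abs.eventually_lt_const (u := 1) (by simp)
    obtain ⟨δ, hδ0, hδ⟩ := mem_nhdsGT_iff_exists_Ioo_subset.1 h1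
    obtain ⟨M, hM⟩ := exists_bound_of_continuousOn_Ioc (R := R) hδ0 hu.ac.continuousOn
    refine ⟨max 1 M, fun r hr => ?_⟩
    rcases lt_or_ge r δ with h | h
    · exact (le_of_lt (hδ ⟨hr.1, h⟩)).trans (le_max_left _ _)
    · exact (hM r ⟨h, hr.2⟩).trans (le_max_right _ _)
  -- Second round: with `u` and `v` bounded, `|q| ≤ B' r`, so `|p| ≤ B' r²` and `p / r` tends to
  -- `0`.
  set B' := C * (1 + (Mu ^ 2 + (|v R| + B * R) ^ 2) ^ 2)
  have hB'0 : 0 ≤ B' := by positivity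
  have hqB' : ∀ r ∈ Ioc 0 R, |q r| ≤ B' * r := by
    intro r hr
    rw [hq_def, abs_mul, abs_of_pos hr.1]
    have h1 := abs_le.1 (hMu r hr)
    have h2 := abs_le.1 (hvB r hr)
    have h3 : u r ^ 2 ≤ Mu ^ 2 := sq_le_sq' h1.1 h1.2
    have h4 : v r ^ 2 ≤ (|v R| + B * R) ^ 2 := sq_le_sq' h2.1 h2.2
    have := hr.1
    gcongr
    exact (hC _ _).trans (mul_le_mul_of_nonneg_left (by gcongr) hC0)
  have hdivB' : ∀ r ∈ Ioc 0 R, |p r / r| ≤ B' * r := by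
    intro r hr
    rw [abs_div, abs_of_pos hr.1, div_le_iff₀ hr.1]
    exact hpb r hr _ fun s hs => (hqB' s ⟨hs.1, hs.2.trans hr.2⟩).trans (by gcongr; exact hs.2)
  set w₀ : ℝ → ℝ := fun r => if r ≤ 0 then 0 else p r / r with hw₀
  have hw₀c : ContinuousOn w₀ (Icc 0 R) := by
    intro r hr
    rcases hr.1.eq_or_lt with rfl | h0
    · have h1 : Tendsto (fun r : ℝ => B' * r) (𝓝[Icc 0 R] 0) (𝓝 0) := by
        have : Tendsto (fun r : ℝ => B' * r) (𝓝 0) (𝓝 (B' * 0)) :=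
          (continuous_const.mul continuous_id).tendsto 0
        rw [mul_zero] at this
        exact this.mono_left nhdsWithin_le_nhds
      have h2 : w₀ 0 = 0 := by simp [hw₀]
      rw [ContinuousWithinAt, h2]
      refine squeeze_zero_norm' ?_ h1
      filter_upwards [self_mem_nhdsWithin] with r hr
      rcases hr.1.eq_or_lt with rfl | h0
      · simp [hw₀]
      · rw [Real.norm_eq_abs, hw₀]
        simp only [h0.not_ge, if_false]
        exact hdivB' r ⟨h0, hr.2⟩
    · have h1 : ContinuousOn (fun r => p r / r) (Ioc 0 R) :=
        (continuousOn_const.sub hQ).div continuousOn_id fun r hr => hr.1.ne'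
      have h2 : ContinuousOn w₀ (Ioc 0 R) := h1.congr fun s hs => by simp [hw₀, hs.1.not_ge]
      refine (h2 r ⟨h0, hr.2⟩).mono_of_mem_nhdsWithin ?_
      filter_upwards [self_mem_nhdsWithin, mem_nhdsWithin_of_mem_nhds (Ioi_mem_nhds h0)]
        with s hs hs' using ⟨hs', hs.2⟩
  -- The continuous extension to the whole line turns the primitive of `w` into a `C¹` function on
  -- `ℝ`, so no one-sided regularity has to be argued at the endpoints.
  refine ⟨IccExtend hR.le ((Icc 0 R).domRestrict w₀),
    (continuousOn_iff_continuous_domRestrict.1 hw₀c).Icc_extend',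
    (IccExtend_of_mem hR.le _ ⟨le_rfl, hR.le⟩).trans (if_pos le_rfl), fun r hr => ?_⟩
  · rw [hv' r hr]
    congr 1
    refine intervalIntegral.integral_congr fun s hs => ?_
    rw [uIcc_of_le hr.2] at hs
    have hs0 : 0 < s := hr.1.trans_le hs.1
    rw [IccExtend_of_mem hR.le _ ⟨hs0.le, hs.2⟩]
    exact (if_neg hs0.not_ge).symm

/-- Existence and regularity of a minimiser of the reduced energy. -/
theorem exists_regular_minimizer {a b c L R : ℝ} (hc : 0 < c ^ 2) {k : ℤ} (hk : k ≠ 0)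
    (hL : 0 < L) (hR : 0 < R) : ∃ u v : ℝ → ℝ, (u, v) ∈ admissible R a b c ∧
      (∀ p ∈ admissible R a b c,
        reducedEnergy L R a b c k u v ≤ reducedEnergy L R a b c k p.1 p.2) ∧
      ContDiffOn ℝ ∞ u (Ioo 0 R) ∧ ContinuousOn u (Icc 0 R) ∧
      ContDiffOn ℝ ∞ v (Ioo 0 R) ∧ ContDiffOn ℝ 1 v (Icc 0 R) ∧
      SolvesODE L R a b c k u v ∧ u 0 = 0 ∧ HasDerivWithinAt v 0 (Icc 0 R) 0 := by
  obtain ⟨u, v, huv, hmin⟩ := exists_minimizer (a := a) (b := b) hc k hk hL hR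
  obtain ⟨hu, hv, hu2, -⟩ := mem_admissible_iff.1 huv
  set u' : ℝ → ℝ := fun r => if r ≤ 0 then 0 else u r with hu'
  have huu' : EqOn u u' (Ioc 0 R) := fun r hr => by simp [hu', hr.1.not_ge]
  obtain ⟨-, hq2, -, m, hm⟩ := exists_integrated_equations hR huv hmin
  obtain ⟨w, hw, hw0, hvw⟩ := exists_continuous_derivative hR hu hv hu2 hq2 hm
  -- Agrees with `v` on `(0, R]` and supplies its values for `r ≤ 0`, with derivative `w`
  -- everywhere.
  set v' : ℝ → ℝ := fun r => v R - ∫ s in r..R, w s with hv'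
  have hvv' : EqOn v v' (Ioc 0 R) := fun r hr => hvw r hr
  have hv'd : ∀ r, HasDerivAt v' (w r) r := by
    intro r
    have := (intervalIntegral.integral_hasDerivAt_left (hw.intervalIntegrable r R)
      (hw.stronglyMeasurableAtFilter _ _) hw.continuousAt).const_sub (v R)
    rwa [neg_neg] at this
  have huv' := admissible_congr hR huv huu' hvv'
  have hmin' : ∀ p ∈ admissible R a b c,
      reducedEnergy L R a b c k u' v' ≤ reducedEnergy L R a b c k p.1 p.2 := fun p hp => by
    rw [← reducedEnergy_congr hR L a b c k huu' hvv']
    exact hmin p hp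
  obtain ⟨h1, h2, ⟨m₁, hm₁⟩, ⟨m₂, hm₂⟩⟩ := exists_integrated_equations hR huv' hmin'
  obtain ⟨-, hud, hQ₁⟩ := primitive_regularity h1 hm₁
  obtain ⟨-, hvd, hQ₂⟩ := primitive_regularity h2 hm₂
  obtain ⟨hus, hvs⟩ := contDiffOn_of_system hud hvd hQ₁ hQ₂
  refine ⟨u', v', huv', hmin', hus, fun r hr => ?_, hvs, ?_,
    solvesODE_of_system hud hvd hQ₁ hQ₂, by simp [hu'], ?_⟩
  · rcases hr.1.eq_or_lt with rfl | h0
    · have h3 : Tendsto u' (𝓝[>] 0) (𝓝 0) := by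
        refine (hu.tendsto_zero hR hu2).congr' ?_
        filter_upwards [self_mem_nhdsWithin] with r hr
        simp [hu', not_le.2 (show 0 < r from hr)]
      have h4 : ContinuousWithinAt u' (Ioi 0) 0 := by
        simpa [ContinuousWithinAt, hu'] using h3
      exact (continuousWithinAt_Ioi_iff_Ici.1 h4).mono Icc_subset_Ici_self
    · have h3 := (mem_admissible_iff.1 huv').1.ac.continuousOn
      refine (h3 r ⟨h0, hr.2⟩).mono_of_mem_nhdsWithin ?_
      filter_upwards [self_mem_nhdsWithin, mem_nhdsWithin_of_mem_nhds (Ioi_mem_nhds h0)]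
        with s hs hs' using ⟨hs', hs.2⟩
  · refine ContDiff.contDiffOn (contDiff_one_iff_deriv.2
      ⟨fun r => (hv'd r).differentiableAt, ?_⟩)
    rwa [show deriv v' = w from funext fun r => (hv'd r).deriv]
  · have := (hv'd 0).hasDerivWithinAt (s := Icc 0 R)
    rwa [hw0] at this

/-! ### Removing the origin: distributional divergence on the disk -/

theorem integrable_mul_of_tsupport_subset {U : Set Plane} (hU : IsOpen U) {f g : Plane → ℝ}
    (hf : ContinuousOn f U) (hg : Continuous g) (hgc : HasCompactSupport g)
    (hgU : tsupport g ⊆ U) : Integrable (fun x => f x * g x) := by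
  refine Continuous.integrable_of_hasCompactSupport ?_ hgc.mul_left
  rw [continuous_iff_continuousAt]
  intro x
  by_cases hx : x ∈ tsupport g
  · exact (hf.continuousAt (hU.mem_nhds (hgU hx))).mul hg.continuousAt
  · have h1 : (fun x => f x * g x) =ᶠ[𝓝 x] fun _ => 0 := by
      filter_upwards [notMem_tsupport_iff_eventuallyEq.1 hx] with y hy
      simp [hy]
    exact h1.continuousAt

/-- Integration by parts against test functions supported where the field is differentiable. -/
theorem integral_div_of_tsupport_subset {U : Set Plane} (hU : IsOpen U) {F F' : Fin 2 → Plane → ℝ}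
    (hF : ∀ m, ContinuousOn (F m) U) (hF' : ∀ m, ContinuousOn (F' m) U)
    (hd : ∀ m, ∀ x ∈ U, HasLineDerivAt ℝ (F m) (F' m x) x (EuclideanSpace.single m 1))
    {φ : Plane → ℝ} (hφ : ContDiff ℝ ∞ φ) (hφc : HasCompactSupport φ) (hφU : tsupport φ ⊆ U) :
    ∫ x, ∑ m, F m x * fderiv ℝ φ x (EuclideanSpace.single m 1) =
      -∫ x, (∑ m, F' m x) * φ x := by
  have hφ' : ∀ m : Fin 2, Continuous fun x => fderiv ℝ φ x (EuclideanSpace.single m 1) := fun m =>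
    (hφ.continuous_fderiv (by simp)).clm_apply continuous_const
  have hi1 : ∀ m, Integrable fun x => F m x * fderiv ℝ φ x (EuclideanSpace.single m 1) := fun m =>
    integrable_mul_of_tsupport_subset hU (hF m) (hφ' m) (hφc.fderiv_apply ℝ _)
      ((tsupport_fderiv_apply_subset ℝ _).trans hφU)
  have hi2 : ∀ m, Integrable fun x => F' m x * φ x := fun m =>
    integrable_mul_of_tsupport_subset hU (hF' m) hφ.continuous hφc hφU
  have hi3 : ∀ m, Integrable fun x => F m x * φ x := fun m =>
    integrable_mul_of_tsupport_subset hU (hF m) hφ.continuous hφc hφU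
  simp_rw [Finset.sum_mul]
  rw [integral_finsetSum _ fun m _ => hi1 m, integral_finsetSum _ fun m _ => hi2 m,
    ← Finset.sum_neg_distrib]
  refine Finset.sum_congr rfl fun m _ => ?_
  exact integral_bilinear_hasLineDerivAt_right_eq_neg_left_of_integrable
    (B := ContinuousLinearMap.mul ℝ ℝ) (hi2 m) (hi1 m) (hi3 m) (fun x hx => hd m x (hφU hx))
    (fun x _ => ((hφ.differentiable (by simp)) x).hasFDerivAt.hasLineDerivAt _)

/-- Cutoff functions vanishing near the origin, with gradient bounded in `L²`. -/
theorem exists_cutoff : ∃ (χ : ℕ → Plane → ℝ) (C : ℝ), 0 ≤ C ∧ (∀ n, ContDiff ℝ ∞ (χ n)) ∧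
    (∀ n, (0 : Plane) ∉ tsupport (χ n)) ∧ (∀ n x, |χ n x| ≤ 1) ∧
    (∀ x ≠ 0, ∀ᶠ n in atTop, χ n x = 1) ∧
    (∀ (n : ℕ) x v, ‖v‖ ≤ 1 → |fderiv ℝ (χ n) x v| ≤ C * (n + 1)) ∧
    ∀ (n : ℕ) x v, 2 / (n + 1 : ℝ) < ‖x‖ → fderiv ℝ (χ n) x v = 0 := by
  -- The cutoffs are `1 - b((n+1)x)`: they vanish near `0` and equal `1` once `‖x‖ ≥ 2/(n+1)`.
  let b : ContDiffBump (0 : Plane) := ⟨1, 2, one_pos, one_lt_two⟩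
  have hbd : ContDiff ℝ ∞ b := b.contDiff
  obtain ⟨C, hC⟩ := (hbd.continuous_fderiv (by simp)).bounded_above_of_compact_support
    (b.hasCompactSupport.fderiv ℝ)
  have hχ : ∀ n : ℕ, ContDiff ℝ ∞ fun x => 1 - b ((n + 1 : ℝ) • x) := fun n => by fun_prop
  have hn : ∀ n : ℕ, (0 : ℝ) < n + 1 := fun n => by positivity
  have hfd : ∀ n : ℕ, ∀ x v, fderiv ℝ (fun x => 1 - b ((n + 1 : ℝ) • x)) x v
      = -((n + 1 : ℝ) * fderiv ℝ b ((n + 1 : ℝ) • x) v) := by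
    intro n x v
    have h1 : HasFDerivAt (fun x : Plane => (n + 1 : ℝ) • x)
      ((n + 1 : ℝ) • ContinuousLinearMap.id ℝ Plane) x :=
      ((n + 1 : ℝ) • ContinuousLinearMap.id ℝ Plane).hasFDerivAt
    have h2 := ((((hbd.differentiable (by simp)) _).hasFDerivAt).comp x h1).const_sub 1
    have h3 : fderiv ℝ (fun x => 1 - b ((n + 1 : ℝ) • x)) x = _ := h2.fderiv
    rw [h3]
    simp
  refine ⟨fun n x => 1 - b ((n + 1 : ℝ) • x), C, (norm_nonneg _).trans (hC 0), hχ, fun n => ?_,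
    fun n x => ?_, fun x hx => ?_, fun n x v hv => ?_, fun n x v hx => ?_⟩
  · rw [notMem_tsupport_iff_eventuallyEq]
    have h1 : ∀ᶠ x : Plane in 𝓝 0, (n + 1 : ℝ) • x ∈ Metric.closedBall (0 : Plane) 1 := by
      have : Tendsto (fun x : Plane => (n + 1 : ℝ) • x) (𝓝 0) (𝓝 ((n + 1 : ℝ) • 0)) :=
        (continuous_const_smul _).tendsto 0
      rw [smul_zero] at this
      exact this.eventually (Metric.closedBall_mem_nhds _ one_pos)
    filter_upwards [h1] with x hx
    simp [b.one_of_mem_closedBall hx]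
  · have h1 := b.nonneg (x := (n + 1 : ℝ) • x)
    have h2 := b.le_one (x := (n + 1 : ℝ) • x)
    rw [abs_of_nonneg (by linarith)]
    linarith
  · obtain ⟨N, hN⟩ := exists_nat_gt (2 / ‖x‖)
    have hx0 : 0 < ‖x‖ := norm_pos_iff.2 hx
    filter_upwards [eventually_ge_atTop N] with n hnN
    have h1 : (N : ℝ) ≤ n := by exact_mod_cast hnN
    rw [b.zero_of_le_dist]
    · simp
    · rw [dist_zero_right, norm_smul, Real.norm_of_nonneg (hn n).le]
      change (2 : ℝ) ≤ _
      rw [div_lt_iff₀ hx0] at hN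
      nlinarith
  · rw [hfd, abs_neg, abs_mul, abs_of_pos (hn n), mul_comm]
    gcongr
    refine (((fderiv ℝ b ((n + 1 : ℝ) • x)).le_opNorm v).trans ?_).trans (hC ((n + 1 : ℝ) • x))
    exact mul_le_of_le_one_right (norm_nonneg _) hv
  · rw [hfd]
    have h1 : (n + 1 : ℝ) • x ∉ tsupport (fderiv ℝ b) := by
      intro h
      have h2 := tsupport_fderiv_subset ℝ h
      rw [b.tsupport_eq, mem_closedBall_zero_iff, norm_smul, Real.norm_of_nonneg (hn n).le] at h2
      change _ ≤ (2 : ℝ) at h2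
      rw [div_lt_iff₀ (hn n)] at hx
      linarith
    simp [image_eq_zero_of_notMem_tsupport h1]

/-- A square integrable vector field which is differentiable away from the origin and whose
divergence is integrable has this divergence in the sense of distributions. -/
theorem integral_div_of_memLp {R : ℝ} {F F' : Fin 2 → Plane → ℝ} {g : Plane → ℝ}
    (hF : ∀ m, ContinuousOn (F m) (Metric.ball 0 R \ {0}))
    (hF' : ∀ m, ContinuousOn (F' m) (Metric.ball 0 R \ {0}))
    (hd : ∀ m, ∀ x ∈ Metric.ball 0 R \ {0},
      HasLineDerivAt ℝ (F m) (F' m x) x (EuclideanSpace.single m 1))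
    (hF2 : ∀ m, MemLp (F m) 2 (volume.restrict (Metric.ball 0 R)))
    (hg : ∀ x ∈ Metric.ball 0 R \ {0}, g x = ∑ m, F' m x)
    (hgi : Integrable g (volume.restrict (Metric.ball 0 R)))
    {φ : Plane → ℝ} (hφ : ContDiff ℝ ∞ φ) (hφc : HasCompactSupport φ)
    (hφU : tsupport φ ⊆ Metric.ball 0 R) :
    ∫ x in Metric.ball 0 R, ∑ m, F m x * fderiv ℝ φ x (EuclideanSpace.single m 1) =
      -∫ x in Metric.ball 0 R, g x * φ x := by
  obtain ⟨χ, C, hC0, hχ, hχ0, hχ1, hχlim, hχd, hχd0⟩ := exists_cutoff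
  set Ω : Set Plane := Metric.ball 0 R with hΩ
  set μ := volume.restrict Ω with hμ
  have hU : IsOpen (Ω \ {0}) := Metric.isOpen_ball.sdiff isClosed_singleton
  have hfin : IsFiniteMeasure μ := ⟨by rw [hμ, Measure.restrict_apply_univ]; exact measure_ball_lt_top⟩
  have hne : ∀ᵐ x ∂μ, x ≠ 0 := ae_restrict_of_ae (Measure.ae_ne volume 0)
  obtain ⟨A, hA⟩ := hφ.continuous.bounded_above_of_compact_support hφc
  have hφd : ∀ m : Fin 2, Continuous fun x => fderiv ℝ φ x (EuclideanSpace.single m 1) := fun m =>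
    (hφ.continuous_fderiv (by simp)).clm_apply continuous_const
  have hφdm : ∀ m : Fin 2, MemLp (fun x => fderiv ℝ φ x (EuclideanSpace.single m 1)) 2 μ := fun m =>
    ((hφd m).memLp_of_hasCompactSupport (hφc.fderiv_apply ℝ _)).restrict Ω
  have hχdc : ∀ n (m : Fin 2), Continuous fun x => fderiv ℝ (χ n) x (EuclideanSpace.single m 1) :=
    fun n m => ((hχ n).continuous_fderiv (by simp)).clm_apply continuous_const
  have hχc : ∀ n, Continuous (χ n) := fun n => (hχ n).continuous
  have hsum : Integrable (fun x => ∑ m, F m x * fderiv ℝ φ x (EuclideanSpace.single m 1)) μ :=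
    integrable_finsetSum _ fun m _ => (hF2 m).integrable_mul (hφdm m)
  have hφχ : ∀ n (m : Fin 2),
      MemLp (fun x => φ x * fderiv ℝ (χ n) x (EuclideanSpace.single m 1)) 2 μ := fun n m =>
    ((hφ.continuous.mul (hχdc n m)).memLp_of_hasCompactSupport hφc.mul_right).restrict Ω
  have hFχ : ∀ n m, Integrable
      (fun x => F m x * (φ x * fderiv ℝ (χ n) x (EuclideanSpace.single m 1))) μ := fun n m =>
    (hF2 m).integrable_mul (hφχ n m)
  -- integrate by parts against `χ n * φ`
  have hparts : ∀ n, (∫ x, χ n x * (∑ m, F m x * fderiv ℝ φ x (EuclideanSpace.single m 1)) ∂μ)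
      + (∑ m, ∫ x, F m x * (φ x * fderiv ℝ (χ n) x (EuclideanSpace.single m 1)) ∂μ)
      = -∫ x, χ n x * (g x * φ x) ∂μ := by
    intro n
    have h0 : ∀ x ∉ Ω, φ x = 0 := fun x hx => image_eq_zero_of_notMem_tsupport fun h => hx (hφU h)
    have h0' : ∀ x ∉ Ω, ∀ v, fderiv ℝ φ x v = 0 := fun x hx v => by
      rw [image_eq_zero_of_notMem_tsupport (f := fderiv ℝ φ)
        fun h => hx (hφU (tsupport_fderiv_subset ℝ h))]
      simp
    have hfd : ∀ x v, fderiv ℝ (fun x => χ n x * φ x) x v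
        = χ n x * fderiv ℝ φ x v + φ x * fderiv ℝ (χ n) x v := by
      intro x v
      rw [fderiv_fun_mul ((hχ n).differentiable (by simp) x) (hφ.differentiable (by simp) x)]
      simp
    have h1 := integral_div_of_tsupport_subset hU hF hF' hd (φ := fun x => χ n x * φ x)
      ((hχ n).mul hφ) hφc.mul_left fun x hx => ⟨hφU (tsupport_mul_subset_right hx), fun h =>
        hχ0 n (mem_singleton_iff.1 h ▸ tsupport_mul_subset_left hx)⟩
    simp_rw [hfd] at h1
    rw [← setIntegral_eq_integral_of_forall_compl_eq_zero (s := Ω) fun x hx => by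
      simp [h0 x hx, h0' x hx], ← setIntegral_eq_integral_of_forall_compl_eq_zero (s := Ω)
      (f := fun x => (∑ m, F' m x) * (χ n x * φ x)) fun x hx => by simp [h0 x hx]] at h1
    have h2 : ∫ x, (∑ m, F' m x) * (χ n x * φ x) ∂μ = ∫ x, χ n x * (g x * φ x) ∂μ := by
      refine integral_congr_ae ?_
      filter_upwards [hne, ae_restrict_mem measurableSet_ball] with x hx hxΩ
      rw [hg x ⟨hxΩ, hx⟩]
      ring
    rw [← h2, ← h1, ← integral_finsetSum _ fun m _ => hFχ n m, ← integral_add]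
    · congr 1
      funext x
      rw [Finset.mul_sum, ← Finset.sum_add_distrib]
      exact Finset.sum_congr rfl fun m _ => by ring
    · exact hsum.bdd_mul (c := 1) (hχc n).aestronglyMeasurable (Eventually.of_forall (hχ1 n))
    · exact integrable_finsetSum _ fun m _ => hFχ n m
  have hgφ : Integrable (fun x => g x * φ x) μ :=
    hgi.mul_bdd (c := A) hφ.continuous.aestronglyMeasurable (Eventually.of_forall hA)
  have hlim : ∀ {f : Plane → ℝ}, Integrable f μ →
      Tendsto (fun n => ∫ x, χ n x * f x ∂μ) atTop (𝓝 (∫ x, f x ∂μ)) := by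
    intro f hf
    refine tendsto_integral_of_dominated_convergence (fun x => ‖f x‖)
      (fun n => (hχc n).aestronglyMeasurable.mul hf.aestronglyMeasurable) hf.norm
      (fun n => Eventually.of_forall fun x => ?_) ?_
    · rw [norm_mul]
      exact mul_le_of_le_one_left (norm_nonneg _) (hχ1 n x)
    · filter_upwards [hne] with x hx
      refine tendsto_const_nhds.congr' ?_
      filter_upwards [hχlim x hx] with n hn
      rw [hn, one_mul]
  -- The gradients of the cutoffs need not tend to `0` in `L²`, but they live on balls shrinking to
  -- the origin, where the `L²` mass of `F` does tend to `0`; Cauchy-Schwarz combines the two.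
  have herr : ∀ m, Tendsto (fun n => ∫ x, F m x *
      (φ x * fderiv ℝ (χ n) x (EuclideanSpace.single m 1)) ∂μ) atTop (𝓝 0) := by
    intro m
    set B : ℕ → Set Plane := fun n => Metric.closedBall 0 (2 / (n + 1 : ℝ)) with hB
    have hBm : ∀ n, MeasurableSet (B n) := fun n => Metric.isClosed_closedBall.measurableSet
    -- Squared gradient at most `C² (n+1)²` times the area `4/(n+1)²` of the ball, up to `|B₁|`: in
    -- dimension two the powers of `n + 1` cancel.
    set K : ℝ := (A * C) ^ 2 * (4 * volume.real (Metric.ball (0 : Plane) 1))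
    have h1 : ∀ n, ∫ x, (φ x * fderiv ℝ (χ n) x (EuclideanSpace.single m 1)) ^ 2 ∂μ ≤ K := by
      intro n
      have hn : (0 : ℝ) < n + 1 := by positivity
      have h2 : ∀ x, (φ x * fderiv ℝ (χ n) x (EuclideanSpace.single m 1)) ^ 2 ≤
          (B n).indicator (fun _ => (A * C) ^ 2 * (n + 1 : ℝ) ^ 2) x := by
        intro x
        by_cases hx : x ∈ B n
        · rw [indicator_of_mem hx, ← mul_pow, mul_assoc]
          have h3 := hχd n x (EuclideanSpace.single m 1) (by simp)
          have h4 := hA x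
          rw [Real.norm_eq_abs] at h4
          rw [← sq_abs, abs_mul]
          gcongr
          exact (abs_nonneg _).trans h4
        · rw [indicator_of_notMem hx, hχd0 n x _ (by simpa [hB] using hx)]
          simp
      refine (integral_mono (hφχ n m).integrable_sq
        ((integrable_const _).indicator (hBm n)) h2).trans ?_
      rw [integral_indicator (hBm n), setIntegral_const, smul_eq_mul]
      have h5 : μ.real (B n) ≤ volume.real (B n) :=
        ENNReal.toReal_mono measure_closedBall_lt_top.ne (Measure.restrict_apply_le _ _)
      have h6 := Measure.addHaar_real_closedBall volume (0 : Plane)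
        (r := 2 / (n + 1 : ℝ)) (by positivity)
      rw [finrank_euclideanSpace, Fintype.card_fin] at h6
      replace h5 := h5.trans h6.le
      calc _ ≤ (2 / (n + 1 : ℝ)) ^ 2 * volume.real (Metric.ball (0 : Plane) 1)
            * ((A * C) ^ 2 * (n + 1 : ℝ) ^ 2) := by gcongr
        _ = K := by simp only [K]; field_simp; ring
    have h2 : Tendsto (fun n => ∫ x, (B n).indicator (F m) x ^ 2 ∂μ) atTop (𝓝 0) := by
      rw [show (0 : ℝ) = ∫ _, (0 : ℝ) ∂μ by simp]
      refine tendsto_integral_of_dominated_convergence (fun x => F m x ^ 2)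
        (fun n => (((hF2 m).aestronglyMeasurable.indicator (hBm n)).pow 2))
        (hF2 m).integrable_sq (fun n => Eventually.of_forall fun x => ?_) ?_
      · rw [Real.norm_of_nonneg (sq_nonneg _)]
        by_cases hx : x ∈ B n
        · rw [indicator_of_mem hx]
        · simp [indicator_of_notMem hx, sq_nonneg]
      · filter_upwards [hne] with x hx
        refine tendsto_const_nhds.congr' ?_
        obtain ⟨N, hN⟩ := exists_nat_gt (2 / ‖x‖)
        have hx0 : 0 < ‖x‖ := norm_pos_iff.2 hx
        filter_upwards [eventually_ge_atTop N] with n hnN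
        have h1 : (N : ℝ) ≤ n := by exact_mod_cast hnN
        rw [indicator_of_notMem]
        · simp
        · rw [hB, mem_closedBall_zero_iff, not_le, div_lt_iff₀ (by positivity)]
          rw [div_lt_iff₀ hx0] at hN
          nlinarith
    have h3 : Tendsto (fun n => √((∫ x, (B n).indicator (F m) x ^ 2 ∂μ) * K)) atTop (𝓝 0) := by
      simpa using (h2.mul_const K).sqrt
    refine squeeze_zero_norm (fun n => ?_) h3
    rw [Real.norm_eq_abs]
    apply Real.abs_le_sqrt
    have h4 : ∫ x, F m x * (φ x * fderiv ℝ (χ n) x (EuclideanSpace.single m 1)) ∂μ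
        = ∫ x, (B n).indicator (F m) x
          * (φ x * fderiv ℝ (χ n) x (EuclideanSpace.single m 1)) ∂μ := by
      congr 1
      funext x
      by_cases hx : x ∈ B n
      · rw [indicator_of_mem hx]
      · rw [indicator_of_notMem hx, hχd0 n x _ (by simpa [hB] using hx)]
        simp
    rw [h4]
    refine (sq_integral_mul_le ((hF2 m).indicator (hBm n)) (hφχ n m)).trans ?_
    exact mul_le_mul_of_nonneg_left (h1 n) (integral_nonneg fun x => sq_nonneg _)
  have h1 := (hlim hsum).add (tendsto_finsetSum Finset.univ fun m _ => herr m)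
  simp_rw [hparts] at h1
  have h2 := tendsto_nhds_unique h1 (hlim hgφ).neg
  simpa using h2

/-! ### Angular modes -/

/-- The complex number with the same coordinates. -/
def toComplex (x : Plane) : ℂ := ⟨x 0, x 1⟩

/-- The field `rotated m = x₁² + x₂²` times the `m`-th partial derivative of the polar angle. -/
def rotated (m : Fin 2) (x : Plane) : ℝ := ![-x 1, x 0] m

/-- An angular Fourier mode. -/
def mode (k : ℤ) (α : ℝ) (x : Plane) : ℝ := Real.cos (k * angle x + α)

theorem norm_toComplex (x : Plane) : ‖toComplex x‖ = ‖x‖ := by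
  rw [EuclideanSpace.norm_eq, Complex.norm_eq_sqrt_sq_add_sq]
  simp [toComplex, Fin.sum_univ_two]

theorem sq_norm_eq (x : Plane) : ‖x‖ ^ 2 = x 0 ^ 2 + x 1 ^ 2 := by
  simp [EuclideanSpace.norm_sq_eq, Fin.sum_univ_two]

/-- An integer power of `x/‖x‖` has no branch cut, so the discontinuity of the argument disappears
and modes can be handled as smooth functions off the origin. -/
theorem mode_eq (k : ℤ) (α : ℝ) {x : Plane} (hx : x ≠ 0) :
    mode k α x = (Complex.exp (α * Complex.I) * (toComplex x / ‖x‖) ^ k).re := by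
  have h1 : toComplex x / ‖x‖ = Complex.exp (angle x * Complex.I) := by
    have h2 := Complex.norm_mul_exp_arg_mul_I (toComplex x)
    have h3 : (‖x‖ : ℂ) ≠ 0 := by simpa using hx
    rw [norm_toComplex] at h2
    rw [div_eq_iff h3, mul_comm]
    exact h2.symm
  rw [h1, ← Complex.exp_int_mul, ← Complex.exp_add,
    show (α * Complex.I + k * (angle x * Complex.I)) = ((k * angle x + α : ℝ) : ℂ) * Complex.I by
      push_cast; ring, Complex.exp_ofReal_mul_I_re, mode]

theorem continuousOn_mode (k : ℤ) (α : ℝ) : ContinuousOn (mode k α) {0}ᶜ := by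
  have h1 : ∀ x ∈ ({0}ᶜ : Set Plane), (‖x‖ : ℂ) ≠ 0 := fun x hx => by simpa using hx
  have h2 : Continuous toComplex := by
    have : toComplex = fun x => (x 0 : ℂ) + x 1 * Complex.I := by
      funext x; apply Complex.ext <;> simp [toComplex]
    rw [this]
    fun_prop
  have h3 : ContinuousOn (fun x : Plane => toComplex x / ‖x‖) {0}ᶜ :=
    h2.continuousOn.div (by fun_prop) h1
  have h4 : ContinuousOn (fun x : Plane => (toComplex x / ‖x‖) ^ k) {0}ᶜ :=
    h3.zpow₀ k fun x hx => Or.inl (by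
      rw [div_ne_zero_iff]
      refine ⟨?_, h1 x hx⟩
      rw [← norm_ne_zero_iff, norm_toComplex]
      simpa using hx)
  refine (Complex.continuous_re.comp_continuousOn ((continuousOn_const (c := Complex.exp (α * Complex.I))).mul h4)).congr ?_
  exact fun x hx => mode_eq k α hx

theorem hasLineDerivAt_norm {x : Plane} (hx : x ≠ 0) (m : Fin 2) :
    HasLineDerivAt ℝ (fun x : Plane => ‖x‖) (x m / ‖x‖) x (EuclideanSpace.single m 1) := by
  have h1 : HasDerivAt (fun t : ℝ => x + t • EuclideanSpace.single m (1 : ℝ))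
      (EuclideanSpace.single m (1 : ℝ)) 0 := by
    simpa using ((hasDerivAt_id (0 : ℝ)).smul_const (EuclideanSpace.single m (1 : ℝ))).const_add x
  have h2 := h1.norm_sq.sqrt (by simpa using hx)
  simp only [Real.sqrt_sq (norm_nonneg _), zero_smul, add_zero] at h2
  refine h2.congr_deriv ?_
  simp [EuclideanSpace.inner_single_right]
  ring

/-- The unit complex number `E = x/‖x‖` satisfies `∂ₘE = iE ∂ₘφ`; differentiating `E^k` brings down
`k i ∂ₘφ`, and the factor `i` is the phase shift by `π/2`. -/
theorem hasLineDerivAt_mode (k : ℤ) (α : ℝ) {x : Plane} (hx : x ≠ 0) (m : Fin 2) :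
    HasLineDerivAt ℝ (mode k α) (k * mode k (α + Real.pi / 2) x * (rotated m x / ‖x‖ ^ 2)) x
      (EuclideanSpace.single m 1) := by
  set e : Plane := EuclideanSpace.single m 1 with he
  set w : ℂ := ![1, Complex.I] m with hw
  have hx0 : ‖x‖ ≠ 0 := by simpa using hx
  have hxc : (‖x‖ : ℂ) ≠ 0 := by exact_mod_cast hx0
  have h1 : ∀ t : ℝ, toComplex (x + t • e) = toComplex x + t * w := by
    intro t
    fin_cases m <;> apply Complex.ext <;> simp [toComplex, he, hw]
  have h2 : HasDerivAt (fun t : ℝ => toComplex (x + t • e)) w 0 := by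
    simp_rw [h1]
    simpa using ((Complex.ofRealCLM.hasDerivAt (x := 0)).mul_const w).const_add (toComplex x)
  have h3 : HasDerivAt (fun t : ℝ => ((‖x + t • e‖ : ℝ) : ℂ)) ((x m / ‖x‖ : ℝ) : ℂ) 0 :=
    HasDerivAt.ofReal_comp (hasLineDerivAt_norm hx m)
  set E : ℂ := toComplex x / ‖x‖ with hE
  have hE0 : E ≠ 0 := by
    rw [hE, div_ne_zero_iff]
    refine ⟨?_, hxc⟩
    rw [← norm_ne_zero_iff, norm_toComplex]
    exact hx0
  have h4 : HasDerivAt (fun t : ℝ => toComplex (x + t • e) / ((‖x + t • e‖ : ℝ) : ℂ))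
      (Complex.I * E * ((rotated m x / ‖x‖ ^ 2 : ℝ) : ℂ)) 0 := by
    refine (h2.fun_div h3 (by simpa using hxc)).congr_deriv ?_
    have h5 : (‖x‖ : ℂ) ^ 2 = (x 0 : ℂ) ^ 2 + (x 1 : ℂ) ^ 2 := by exact_mod_cast sq_norm_eq x
    have h6 : toComplex x = x 0 + x 1 * Complex.I := by
      apply Complex.ext <;> simp [toComplex]
    simp only [zero_smul, add_zero, hE]
    push_cast
    rw [h6]
    field_simp
    fin_cases m
    · simp [rotated, hw, h5]
      linear_combination (x 1 : ℂ) ^ 2 * Complex.I_sq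
    · simp [rotated, hw, h5]
      linear_combination (-(x 0 : ℂ) * x 1) * Complex.I_sq
  have h7 : HasDerivAt (fun t : ℝ =>
      Complex.exp (α * Complex.I) * (toComplex (x + t • e) / ((‖x + t • e‖ : ℝ) : ℂ)) ^ k)
      (Complex.exp (α * Complex.I) * (k * E ^ (k - 1) *
        (Complex.I * E * ((rotated m x / ‖x‖ ^ 2 : ℝ) : ℂ)))) 0 := by
    refine HasDerivAt.const_mul _ ?_
    have h8 := hasDerivAt_zpow k E (Or.inl hE0)
    have h9 : E = toComplex (x + (0 : ℝ) • e) / ((‖x + (0 : ℝ) • e‖ : ℝ) : ℂ) := by simp [hE]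
    rw [h9] at h8
    have := HasDerivAt.comp (0 : ℝ) h8 h4
    rw [← h9] at this
    exact this
  have h8 : HasDerivAt (fun t : ℝ =>
      (Complex.exp (α * Complex.I) * (toComplex (x + t • e) / ((‖x + t • e‖ : ℝ) : ℂ)) ^ k).re)
      _ 0 := (Complex.reCLM.hasFDerivAt.comp_hasDerivAt (0 : ℝ) h7)
  have h9 : (fun t : ℝ => mode k α (x + t • e)) =ᶠ[𝓝 0] fun t : ℝ =>
      (Complex.exp (α * Complex.I) * (toComplex (x + t • e) / ((‖x + t • e‖ : ℝ) : ℂ)) ^ k).re := by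
    have hc : ContinuousAt (fun t : ℝ => x + t • e) 0 := by fun_prop
    filter_upwards [hc.eventually_ne (by simpa using hx)] with t ht
    exact mode_eq k α ht
  refine (h8.congr_of_eventuallyEq h9).congr_deriv ?_
  rw [mode_eq k _ hx, ← hE]
  have h10 : Complex.exp (((α + Real.pi / 2 : ℝ) : ℂ) * Complex.I)
      = Complex.exp (α * Complex.I) * Complex.I := by
    push_cast
    rw [add_mul, Complex.exp_add, Complex.exp_pi_div_two_mul_I]
  have h11 : Complex.exp (α * Complex.I) * (k * E ^ (k - 1) *
        (Complex.I * E * ((rotated m x / ‖x‖ ^ 2 : ℝ) : ℂ)))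
      = ((k * (rotated m x / ‖x‖ ^ 2) : ℝ) : ℂ) *
        (Complex.exp (((α + Real.pi / 2 : ℝ) : ℂ) * Complex.I) * E ^ k) := by
    rw [h10, zpow_sub_one₀ hE0]
    push_cast
    field_simp
  rw [h11]
  simp only [Complex.reCLM_apply, Complex.re_ofReal_mul]
  ring

/-! ### The weak Laplacian of a mode -/

/-- `f` is a bounded function on `Ω` with weak gradient `F ∈ L²` and distributional Laplacian
`g ∈ L¹`. -/
structure HasWeakLaplacian (Ω : Set Plane) (f : Plane → ℝ) (F : Fin 2 → Plane → ℝ)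
    (g : Plane → ℝ) : Prop where
  memLp_top : MemLp f ⊤ (volume.restrict Ω)
  hasWeakPartial : ∀ m, HasWeakPartial Ω m f (F m)
  memLp : ∀ m, MemLp (F m) 2 (volume.restrict Ω)
  integrable : Integrable g (volume.restrict Ω)
  integral_eq : ∀ φ : Plane → ℝ, ContDiff ℝ ∞ φ → HasCompactSupport φ → tsupport φ ⊆ Ω →
    ∫ x in Ω, ∑ m, F m x * fderiv ℝ φ x (EuclideanSpace.single m 1) = -∫ x in Ω, g x * φ x

theorem aestronglyMeasurable_of_continuousOn_punctured {R : ℝ} {f : Plane → ℝ}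
    (hf : ContinuousOn f (Metric.ball 0 R \ {0})) :
    AEStronglyMeasurable f (volume.restrict (Metric.ball 0 R)) := by
  have h1 := hf.aestronglyMeasurable (μ := volume) (measurableSet_ball.diff (measurableSet_singleton 0))
  have h2 : volume.restrict (Metric.ball (0 : Plane) R \ {0}) = volume.restrict (Metric.ball 0 R) :=
    Measure.restrict_congr_set (sdiff_null_ae_eq_self (by simp))
  rwa [h2] at h1

theorem hasLineDerivAt_mul {f g : Plane → ℝ} {f' g' : ℝ} {x v : Plane}
    (hf : HasLineDerivAt ℝ f f' x v) (hg : HasLineDerivAt ℝ g g' x v) :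
    HasLineDerivAt ℝ (fun x => f x * g x) (f' * g x + f x * g') x v := by
  have := HasDerivAt.fun_mul hf hg
  simpa [HasLineDerivAt] using this

theorem hasLineDerivAt_radial {h : ℝ → ℝ} {h' : ℝ} {x : Plane} (hx : x ≠ 0) (m : Fin 2)
    (hh : HasDerivAt h h' ‖x‖) :
    HasLineDerivAt ℝ (fun x : Plane => h ‖x‖) (h' * (x m / ‖x‖)) x (EuclideanSpace.single m 1) := by
  have h1 : HasDerivAt (fun t : ℝ => ‖x + t • EuclideanSpace.single m (1 : ℝ)‖) (x m / ‖x‖) 0 :=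
    hasLineDerivAt_norm hx m
  have h2 : ‖x‖ = ‖x + (0 : ℝ) • EuclideanSpace.single m (1 : ℝ)‖ := by simp
  rw [h2] at hh
  have := HasDerivAt.comp (0 : ℝ) hh h1
  exact this

theorem hasLineDerivAt_coord (x : Plane) (m : Fin 2) :
    HasLineDerivAt ℝ (fun x : Plane => x m) 1 x (EuclideanSpace.single m 1) := by
  have : HasDerivAt (fun t : ℝ => x m + t) 1 0 := (hasDerivAt_id (0 : ℝ)).const_add _
  simpa [HasLineDerivAt] using this

theorem hasLineDerivAt_rotated (x : Plane) (m : Fin 2) :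
    HasLineDerivAt ℝ (rotated m) 0 x (EuclideanSpace.single m 1) := by
  have h : ∀ t : ℝ, rotated m (x + t • EuclideanSpace.single m (1 : ℝ)) = rotated m x := by
    intro t
    fin_cases m <;> simp [rotated]
  simp only [HasLineDerivAt, h]
  exact hasDerivAt_const _ _

/-- The gradient of `h(|x|) cos (k φ + α)`. -/
def modeGrad (k : ℤ) (α : ℝ) (h h' : ℝ → ℝ) (m : Fin 2) (x : Plane) : ℝ :=
  h' ‖x‖ * (x m * ‖x‖⁻¹ * mode k α x)
    + h ‖x‖ * (k * (mode k (α + Real.pi / 2) x * (rotated m x * (‖x‖ ^ 2)⁻¹)))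

/-- The second derivative of `h(|x|) cos (k φ + α)` in the `m`-th direction. -/
def modeSecond (k : ℤ) (α : ℝ) (h h' h'' : ℝ → ℝ) (m : Fin 2) (x : Plane) : ℝ :=
  (h'' ‖x‖ * (x m / ‖x‖)) * (x m * ‖x‖⁻¹ * mode k α x)
    + h' ‖x‖ * ((1 * ‖x‖⁻¹ + x m * (-(‖x‖ ^ 2)⁻¹ * (x m / ‖x‖))) * mode k α x
      + x m * ‖x‖⁻¹ * (k * mode k (α + Real.pi / 2) x * (rotated m x / ‖x‖ ^ 2)))
    + ((h' ‖x‖ * (x m / ‖x‖)) *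
        (k * (mode k (α + Real.pi / 2) x * (rotated m x * (‖x‖ ^ 2)⁻¹)))
      + h ‖x‖ * (k * ((k * mode k (α + Real.pi) x * (rotated m x / ‖x‖ ^ 2)) *
          (rotated m x * (‖x‖ ^ 2)⁻¹)
        + mode k (α + Real.pi / 2) x * (0 * (‖x‖ ^ 2)⁻¹ +
          rotated m x * (-(2 * ‖x‖) / (‖x‖ ^ 2) ^ 2 * (x m / ‖x‖))))))

theorem hasLineDerivAt_mode_mul {k : ℤ} {α : ℝ} {h h' : ℝ → ℝ} {x : Plane} (hx : x ≠ 0)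
    (hh : HasDerivAt h (h' ‖x‖) ‖x‖) (m : Fin 2) :
    HasLineDerivAt ℝ (fun x => h ‖x‖ * mode k α x) (modeGrad k α h h' m x) x
      (EuclideanSpace.single m 1) := by
  have := hasLineDerivAt_mul (hasLineDerivAt_radial hx m hh) (hasLineDerivAt_mode k α hx m)
  convert this using 1
  simp only [modeGrad]
  ring

/-- The product rule, factor by factor. `modeSecond` is its unsimplified output; the cancellations
take place only in the sum over `m`. -/
theorem hasLineDerivAt_modeGrad {k : ℤ} {α : ℝ} {h h' h'' : ℝ → ℝ} {x : Plane} (hx : x ≠ 0)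
    (hh : HasDerivAt h (h' ‖x‖) ‖x‖) (hh' : HasDerivAt h' (h'' ‖x‖) ‖x‖) (m : Fin 2) :
    HasLineDerivAt ℝ (modeGrad k α h h' m) (modeSecond k α h h' h'' m x) x
      (EuclideanSpace.single m 1) := by
  have hx0 : ‖x‖ ≠ 0 := by simpa using hx
  have hinv := hasLineDerivAt_radial hx m (hasDerivAt_inv hx0)
  have hinv2 := hasLineDerivAt_radial hx m (h := fun ρ => (ρ ^ 2)⁻¹)
    (h' := -(2 * ‖x‖) / (‖x‖ ^ 2) ^ 2) (by
      have := (hasDerivAt_pow 2 ‖x‖).fun_inv (pow_ne_zero 2 hx0)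
      simpa using this)
  have hc := hasLineDerivAt_coord x m
  have hr := hasLineDerivAt_rotated x m
  have hm := hasLineDerivAt_mode k α hx m
  have hm' := hasLineDerivAt_mode k (α + Real.pi / 2) hx m
  rw [add_assoc, add_halves] at hm'
  have hk : HasLineDerivAt ℝ (fun _ : Plane => (k : ℝ)) 0 x (EuclideanSpace.single m 1) :=
    hasDerivAt_const _ _
  have h1 := hasLineDerivAt_mul (hasLineDerivAt_radial hx m hh')
    (hasLineDerivAt_mul (hasLineDerivAt_mul hc hinv) hm)
  have h2 := hasLineDerivAt_mul (hasLineDerivAt_radial hx m hh) (hasLineDerivAt_mul hk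
    (hasLineDerivAt_mul hm' (hasLineDerivAt_mul hr hinv2)))
  have h3 := HasDerivAt.fun_add h1 h2
  rw [zero_mul, zero_add] at h3
  exact h3

/-- The Laplacian in polar coordinates. Mixed radial-angular terms cancel because `rotated` is
orthogonal to `x`, and two phase shifts by `π/2` produce the sign of `-k²`. -/
theorem sum_modeSecond {k : ℤ} {α : ℝ} {h h' h'' : ℝ → ℝ} {x : Plane} (hx : x ≠ 0) :
    ∑ m, modeSecond k α h h' h'' m x
      = (h'' ‖x‖ + h' ‖x‖ / ‖x‖ - (k : ℝ) ^ 2 * h ‖x‖ / ‖x‖ ^ 2) * mode k α x := by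
  have hx0 : ‖x‖ ≠ 0 := by simpa using hx
  have h1 : mode k (α + Real.pi) x = -mode k α x := by
    unfold mode
    rw [← add_assoc, Real.cos_add_pi]
  have h2 : x 0 ^ 2 = ‖x‖ ^ 2 - x 1 ^ 2 := by rw [sq_norm_eq]; ring
  simp only [Fin.sum_univ_two, modeSecond, h1, rotated, Matrix.cons_val_zero, Matrix.cons_val_one]
  field_simp
  ring_nf
  simp only [h2]
  ring

theorem abs_mode_le (k : ℤ) (α : ℝ) (x : Plane) : |mode k α x| ≤ 1 := Real.abs_cos_le_one _

theorem abs_rotated_le (m : Fin 2) (x : Plane) : |rotated m x| ≤ ‖x‖ := by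
  apply abs_le_of_sq_le_sq _ (norm_nonneg x)
  rw [sq_norm_eq]
  fin_cases m <;> simp [rotated, sq_nonneg]

theorem sq_modeGrad_le (k : ℤ) (α : ℝ) (h h' : ℝ → ℝ) (m : Fin 2) {x : Plane} (hx : x ≠ 0) :
    modeGrad k α h h' m x ^ 2 ≤ 2 * (h' ‖x‖ ^ 2 + (k : ℝ) ^ 2 * h ‖x‖ ^ 2 / ‖x‖ ^ 2) := by
  have hx0 : 0 < ‖x‖ := by simpa using hx
  have h1 : (x m * ‖x‖⁻¹ * mode k α x) ^ 2 ≤ 1 := by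
    rw [sq_le_one_iff_abs_le_one, abs_mul, abs_mul, abs_of_pos (inv_pos.2 hx0)]
    refine mul_le_one₀ ?_ (abs_nonneg _) (abs_mode_le _ _ _)
    rw [← div_eq_mul_inv, div_le_one hx0]
    exact PiLp.norm_apply_le x m
  have h2 : (mode k (α + Real.pi / 2) x * (rotated m x * ‖x‖⁻¹)) ^ 2 ≤ 1 := by
    rw [sq_le_one_iff_abs_le_one, abs_mul, abs_mul, abs_of_pos (inv_pos.2 hx0)]
    refine mul_le_one₀ (abs_mode_le _ _ _) (by positivity) ?_
    rw [← div_eq_mul_inv, div_le_one hx0]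
    exact abs_rotated_le m x
  have h3 : modeGrad k α h h' m x = h' ‖x‖ * (x m * ‖x‖⁻¹ * mode k α x)
    + (k * h ‖x‖ / ‖x‖) * (mode k (α + Real.pi / 2) x * (rotated m x * ‖x‖⁻¹)) := by
    unfold modeGrad
    field_simp
  rw [h3]
  refine add_sq_le.trans ?_
  rw [mul_pow (h' ‖x‖), mul_pow (k * h ‖x‖ / ‖x‖), div_pow, mul_pow (k : ℝ)]
  gcongr
  · exact mul_le_of_le_one_right (sq_nonneg _) h1
  · exact mul_le_of_le_one_right (by positivity) h2

theorem continuousOn_rotated (m : Fin 2) (s : Set Plane) : ContinuousOn (rotated m) s := by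
  fin_cases m
  · change ContinuousOn (fun x : Plane => -x 1) s
    fun_prop
  · change ContinuousOn (fun x : Plane => x 0) s
    fun_prop

/-- Everything is classical off the origin. In polar coordinates the two weighted integrability
conditions say that the gradient is in `L²`, so the removability of the origin applies to the
function and again to its gradient. -/
theorem hasWeakLaplacian_mode {R B B' : ℝ} {k : ℤ} (α : ℝ) {h h' h'' : ℝ → ℝ}
    (hh : ∀ ρ ∈ Ioo 0 R, HasDerivAt h (h' ρ) ρ) (hh' : ∀ ρ ∈ Ioo 0 R, HasDerivAt h' (h'' ρ) ρ)
    (hh'' : ContinuousOn h'' (Ioo 0 R)) (hB : ∀ ρ ∈ Ioo 0 R, |h ρ| ≤ B)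
    (hi : IntegrableOn (fun ρ => h' ρ ^ 2 * ρ) (Ioo 0 R))
    (hi' : IntegrableOn (fun ρ => (k : ℝ) ^ 2 * h ρ ^ 2 / ρ) (Ioo 0 R))
    (hB' : ∀ ρ ∈ Ioo 0 R, |h'' ρ + h' ρ / ρ - (k : ℝ) ^ 2 * h ρ / ρ ^ 2| ≤ B') :
    HasWeakLaplacian (Metric.ball 0 R) (fun x => h ‖x‖ * mode k α x) (modeGrad k α h h')
      (fun x => (h'' ‖x‖ + h' ‖x‖ / ‖x‖ - (k : ℝ) ^ 2 * h ‖x‖ / ‖x‖ ^ 2) * mode k α x) := by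
  set Ω : Set Plane := Metric.ball 0 R with hΩ
  have hfin : IsFiniteMeasure (volume.restrict Ω) :=
    ⟨by rw [Measure.restrict_apply_univ]; exact measure_ball_lt_top⟩
  have hne : ∀ᵐ x ∂volume.restrict Ω, x ∈ Ω \ {0} := by
    filter_upwards [ae_restrict_mem measurableSet_ball,
      ae_restrict_of_ae (Measure.ae_ne volume 0)] with x h1 h2 using ⟨h1, h2⟩
  have hmem : ∀ x ∈ Ω \ {0}, ‖x‖ ∈ Ioo 0 R := fun x hx =>
    ⟨norm_pos_iff.2 hx.2, by simpa [hΩ] using hx.1⟩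
  have hn0 : ∀ x ∈ Ω \ {0}, ‖x‖ ≠ 0 := fun x hx => (hmem x hx).1.ne'
  have hn0' : ∀ x ∈ Ω \ {0}, ‖x‖ ^ 2 ≠ 0 := fun x hx => pow_ne_zero 2 (hn0 x hx)
  have hn0'' : ∀ x ∈ Ω \ {0}, (‖x‖ ^ 2) ^ 2 ≠ 0 := fun x hx => pow_ne_zero 2 (hn0' x hx)
  have hcomp : ∀ g : ℝ → ℝ, ContinuousOn g (Ioo 0 R) →
      ContinuousOn (fun x : Plane => g ‖x‖) (Ω \ {0}) := fun g hg =>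
    hg.comp continuous_norm.continuousOn hmem
  have hc0 := hcomp h fun ρ hρ => (hh ρ hρ).continuousAt.continuousWithinAt
  have hc1 := hcomp h' fun ρ hρ => (hh' ρ hρ).continuousAt.continuousWithinAt
  have hc2 := hcomp h'' hh''
  have hcm : ∀ β, ContinuousOn (mode k β) (Ω \ {0}) := fun β =>
    (continuousOn_mode k β).mono fun x hx => hx.2
  have hcr : ∀ m, ContinuousOn (rotated m) (Ω \ {0}) := fun m => continuousOn_rotated m _
  have hf : ContinuousOn (fun x => h ‖x‖ * mode k α x) (Ω \ {0}) := hc0.mul (hcm α)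
  have hcx : ∀ m, ContinuousOn (fun x : Plane => x m) (Ω \ {0}) := fun m => by fun_prop
  have hnm : ContinuousOn (fun x : Plane => ‖x‖) (Ω \ {0}) := continuous_norm.continuousOn
  have hF : ∀ m, ContinuousOn (modeGrad k α h h' m) (Ω \ {0}) := by
    intro m
    exact (hc1.mul (((hcx m).mul (hnm.inv₀ hn0)).mul (hcm α))).add (hc0.mul
      (continuousOn_const.mul ((hcm _).mul ((hcr m).mul ((hnm.pow 2).inv₀ hn0')))))
  have hF' : ∀ m, ContinuousOn (modeSecond k α h h' h'' m) (Ω \ {0}) := by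
    intro m
    have hi1 := hnm.inv₀ hn0
    have hi2 := (hnm.pow 2).inv₀ hn0'
    have hxn := (hcx m).div hnm hn0
    have hrn := (hcr m).div (hnm.pow 2) hn0'
    have hcc : ∀ β : ℝ, ContinuousOn (fun _ : Plane => β) (Ω \ {0}) := fun β => continuousOn_const
    exact ((hc2.mul hxn).mul (((hcx m).mul hi1).mul (hcm α))).add (hc1.mul
      (((((hcc 1).mul hi1).add ((hcx m).mul (hi2.neg.mul hxn))).mul (hcm α)).add
        (((hcx m).mul hi1).mul (((hcc k).mul (hcm _)).mul hrn)))) |>.add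
      (((hc1.mul hxn).mul ((hcc k).mul ((hcm _).mul ((hcr m).mul hi2)))).add
        (hc0.mul ((hcc k).mul ((((((hcc k).mul (hcm _)).mul hrn)).mul ((hcr m).mul hi2)).add
          ((hcm _).mul (((hcc 0).mul hi2).add ((hcr m).mul
            (((((hcc 2).mul hnm).neg).div ((hnm.pow 2).pow 2) hn0'').mul hxn))))))))
  have hd : ∀ m, ∀ x ∈ Ω \ {0}, HasLineDerivAt ℝ (fun x => h ‖x‖ * mode k α x)
      (modeGrad k α h h' m x) x (EuclideanSpace.single m 1) := fun m x hx =>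
    hasLineDerivAt_mode_mul hx.2 (hh _ (hmem x hx)) m
  have hd' : ∀ m, ∀ x ∈ Ω \ {0}, HasLineDerivAt ℝ (modeGrad k α h h' m)
      (modeSecond k α h h' h'' m x) x (EuclideanSpace.single m 1) := fun m x hx =>
    hasLineDerivAt_modeGrad hx.2 (hh _ (hmem x hx)) (hh' _ (hmem x hx)) m
  have hfm := aestronglyMeasurable_of_continuousOn_punctured hf
  have hfb : ∀ᵐ x ∂volume.restrict Ω, |h ‖x‖ * mode k α x| ≤ B := by
    filter_upwards [hne] with x hx
    rw [abs_mul]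
    have h1 := hB _ (hmem x hx)
    calc |h ‖x‖| * |mode k α x| ≤ |h ‖x‖| * 1 := by gcongr; exact abs_mode_le _ _ _
      _ ≤ B := by rwa [mul_one]
  have hf2 : MemLp (fun x => h ‖x‖ * mode k α x) 2 (volume.restrict Ω) := MemLp.of_bound hfm B hfb
  have hF2 : ∀ m, MemLp (modeGrad k α h h' m) 2 (volume.restrict Ω) := by
    intro m
    have hFm := aestronglyMeasurable_of_continuousOn_punctured (hF m)
    rw [memLp_two_iff_integrable_sq hFm]
    have h1 : Integrable (fun x : Plane => 2 * (h' ‖x‖ ^ 2 + (k : ℝ) ^ 2 * h ‖x‖ ^ 2 / ‖x‖ ^ 2))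
        (volume.restrict Ω) := by
      refine Integrable.const_mul ?_ 2
      -- Polar coordinates, with Jacobian `ρ`, reduce the planar integral to the two radial
      -- hypotheses.
      refine (integrableOn_fun_norm_addHaar volume
        (f := fun ρ => h' ρ ^ 2 + (k : ℝ) ^ 2 * h ρ ^ 2 / ρ ^ 2)).2 ?_
      refine (hi.add hi').congr_fun (fun ρ hρ => ?_) measurableSet_Ioo
      have := hρ.1.ne'
      simp only [finrank_euclideanSpace, Fintype.card_fin, smul_eq_mul, Pi.add_apply]
      field_simp
      norm_num
      ring
    refine h1.mono' (hFm.pow 2) ?_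
    filter_upwards [hne] with x hx
    rw [Real.norm_of_nonneg (sq_nonneg _)]
    exact sq_modeGrad_le k α h h' m hx.2
  have hFi : ∀ m, Integrable (modeGrad k α h h' m) (volume.restrict Ω) := fun m =>
    (hF2 m).integrable one_le_two
  have hgm : AEStronglyMeasurable (fun x : Plane =>
      (h'' ‖x‖ + h' ‖x‖ / ‖x‖ - (k : ℝ) ^ 2 * h ‖x‖ / ‖x‖ ^ 2) * mode k α x)
      (volume.restrict Ω) := by
    refine aestronglyMeasurable_of_continuousOn_punctured ?_
    exact ((hc2.add (hc1.div hnm hn0)).sub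
      ((continuousOn_const.mul hc0).div (hnm.pow 2) hn0')).mul (hcm α)
  have hgi : Integrable (fun x : Plane =>
      (h'' ‖x‖ + h' ‖x‖ / ‖x‖ - (k : ℝ) ^ 2 * h ‖x‖ / ‖x‖ ^ 2) * mode k α x)
      (volume.restrict Ω) := by
    refine Integrable.of_bound hgm B' ?_
    filter_upwards [hne] with x hx
    rw [norm_mul, Real.norm_eq_abs, Real.norm_eq_abs]
    have h1 := hB' _ (hmem x hx)
    calc _ ≤ |h'' ‖x‖ + h' ‖x‖ / ‖x‖ - (k : ℝ) ^ 2 * h ‖x‖ / ‖x‖ ^ 2| * 1 := by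
          gcongr; exact abs_mode_le _ _ _
      _ ≤ B' := by rwa [mul_one]
  refine ⟨memLp_top_of_bound hfm B hfb, fun m => ⟨?_, ?_, fun φ hφ hφc hφU => ?_⟩, hF2, hgi,
    fun φ hφ hφc hφU => ?_⟩
  · exact IntegrableOn.locallyIntegrableOn (hf2.integrable one_le_two)
  · exact IntegrableOn.locallyIntegrableOn (hFi m)
  -- The vector field whose only nonzero component is the `m`-th one has the `m`-th partial
  -- derivative as divergence, so the divergence statement also yields weak partials.
  · have := integral_div_of_memLp
      (F := fun j x => if j = m then h ‖x‖ * mode k α x else 0)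
      (F' := fun j x => if j = m then modeGrad k α h h' m x else 0)
      (g := modeGrad k α h h' m) (R := R)
      (fun j => by
        by_cases hj : j = m
        · simpa only [hj, if_true] using hf
        · simpa only [hj, if_false] using continuousOn_const)
      (fun j => by
        by_cases hj : j = m
        · simpa only [hj, if_true] using hF m
        · simpa only [hj, if_false] using continuousOn_const)
      (fun j x hx => by
        by_cases hj : j = m
        · subst hj; simpa using hd j x hx
        · simp only [hj, if_false]; exact hasDerivAt_const _ _)
      (fun j => by
        by_cases hj : j = m
        · simpa only [hj, if_true] using hf2
        · simpa only [hj, if_false] using MemLp.zero')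
      (fun x _ => by simp) (hFi m) hφ hφc hφU
    simpa using this
  · exact integral_div_of_memLp hF hF' hd' hF2 (fun x hx => (sum_modeSecond hx.2).symm) hgi
      hφ hφc hφU

/-! ### Calculus of weak derivatives -/

theorem integrable_mul_of_locallyIntegrableOn {Ω : Set Plane} {f φ : Plane → ℝ}
    (hf : LocallyIntegrableOn f Ω) (hφ : Continuous φ) (hφc : HasCompactSupport φ)
    (hφU : tsupport φ ⊆ Ω) : Integrable (fun x => f x * φ x) := by
  have h1 : IntegrableOn (fun x => f x * φ x) (tsupport φ) :=
    (hf.integrableOn_compact_subset hφU hφc).mul_continuousOn hφ.continuousOn hφc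
  refine (integrableOn_iff_integrable_of_support_subset fun x hx => ?_).1 h1
  exact subset_tsupport φ fun h => hx (by simp [h])

theorem continuous_fderiv_apply {φ : Plane → ℝ} (hφ : ContDiff ℝ ∞ φ) (v : Plane) :
    Continuous fun x => fderiv ℝ φ x v :=
  (hφ.continuous_fderiv (by simp)).clm_apply continuous_const

theorem hasCompactSupport_fderiv_apply {φ : Plane → ℝ} (hφc : HasCompactSupport φ) (v : Plane) :
    HasCompactSupport fun x => fderiv ℝ φ x v :=
  HasCompactSupport.fderiv_apply (𝕜 := ℝ) hφc v

theorem HasWeakPartial.linear_comb {Ω : Set Plane} {m : Fin 2} {f g f' g' : Plane → ℝ}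
    (hf : HasWeakPartial Ω m f f') (hg : HasWeakPartial Ω m g g') (s t : ℝ) :
    HasWeakPartial Ω m (fun x => s * f x + t * g x) (fun x => s * f' x + t * g' x) := by
  refine ⟨(hf.1.smul s).add (hg.1.smul t), (hf.2.1.smul s).add (hg.2.1.smul t),
    fun φ hφ hφc hφU => ?_⟩
  have hd := continuous_fderiv_apply hφ (EuclideanSpace.single m (1 : ℝ))
  have hdc := hasCompactSupport_fderiv_apply hφc (EuclideanSpace.single m (1 : ℝ))
  have hdU := (tsupport_fderiv_apply_subset (f := φ) ℝ (EuclideanSpace.single m (1 : ℝ))).trans hφU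
  have e1 : ∀ x, (s * f x + t * g x) * fderiv ℝ φ x (EuclideanSpace.single m 1)
      = s * (f x * fderiv ℝ φ x (EuclideanSpace.single m 1))
        + t * (g x * fderiv ℝ φ x (EuclideanSpace.single m 1)) := fun x => by ring
  have e2 : ∀ x, (s * f' x + t * g' x) * φ x = s * (f' x * φ x) + t * (g' x * φ x) :=
    fun x => by ring
  simp_rw [e1, e2]
  rw [integral_add, integral_add, integral_const_mul, integral_const_mul, integral_const_mul,
    integral_const_mul, hf.2.2 φ hφ hφc hφU, hg.2.2 φ hφ hφc hφU]
  · ring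
  · exact ((integrable_mul_of_locallyIntegrableOn hf.2.1 hφ.continuous hφc hφU).const_mul
      s).integrableOn
  · exact ((integrable_mul_of_locallyIntegrableOn hg.2.1 hφ.continuous hφc hφU).const_mul
      t).integrableOn
  · exact ((integrable_mul_of_locallyIntegrableOn hf.1 hd hdc hdU).const_mul s).integrableOn
  · exact ((integrable_mul_of_locallyIntegrableOn hg.1 hd hdc hdU).const_mul t).integrableOn

theorem HasWeakPartial.ae_eq {Ω : Set Plane} (hΩ : IsOpen Ω) {m : Fin 2} {f g g' : Plane → ℝ}
    (hg : HasWeakPartial Ω m f g) (hg' : HasWeakPartial Ω m f g') :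
    g =ᵐ[volume.restrict Ω] g' := by
  have h := hΩ.ae_eq_zero_of_integral_contDiff_smul_eq_zero (μ := volume) (f := fun x => g x - g' x)
    (hg.2.1.sub hg'.2.1) fun φ hφ hφc hφU => by
      have h1 := hg.2.2 φ hφ hφc hφU
      have h2 := hg'.2.2 φ hφ hφc hφU
      have h3 : ∫ x, φ x • (g x - g' x) = ∫ x in Ω, φ x • (g x - g' x) :=
        (setIntegral_eq_integral_of_forall_compl_eq_zero fun x hx => by
          rw [image_eq_zero_of_notMem_tsupport fun h => hx (hφU h), zero_smul]).symm
      have h4 : ∀ x, φ x • (g x - g' x) = g x * φ x - g' x * φ x := fun x => by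
        rw [smul_eq_mul]; ring
      rw [h3]
      simp_rw [h4]
      rw [integral_sub
        (integrable_mul_of_locallyIntegrableOn hg.2.1 hφ.continuous hφc hφU).integrableOn
        (integrable_mul_of_locallyIntegrableOn hg'.2.1 hφ.continuous hφc hφU).integrableOn]
      linarith
  filter_upwards [(ae_restrict_iff' hΩ.measurableSet).2 h] with x hx
  linarith

/-- The energy is defined with an arbitrarily chosen weak derivative; uniqueness almost everywhere
allows it to be computed with any known one. -/
theorem HasWeakPartial.weakPartial_ae_eq {Ω : Set Plane} (hΩ : IsOpen Ω) {m : Fin 2}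
    {f g : Plane → ℝ} (hg : HasWeakPartial Ω m f g) :
    weakPartial Ω m f =ᵐ[volume.restrict Ω] g := by
  have h : ∃ g, HasWeakPartial Ω m f g := ⟨g, hg⟩
  rw [weakPartial, dif_pos h]
  exact h.choose_spec.ae_eq hΩ hg

theorem hasWeakPartial_fderiv {Ω : Set Plane} (m : Fin 2) {p : Plane → ℝ} (hp : ContDiff ℝ ∞ p)
    (hpc : HasCompactSupport p) (hpU : tsupport p ⊆ Ω) :
    HasWeakPartial Ω m p (fun x => fderiv ℝ p x (EuclideanSpace.single m 1)) := by
  have hd := continuous_fderiv_apply hp (EuclideanSpace.single m (1 : ℝ))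
  have hdc := hasCompactSupport_fderiv_apply hpc (EuclideanSpace.single m (1 : ℝ))
  refine ⟨(hp.continuous.locallyIntegrable).locallyIntegrableOn _,
    hd.locallyIntegrable.locallyIntegrableOn _, fun φ hφ hφc hφU => ?_⟩
  have hd' := continuous_fderiv_apply hφ (EuclideanSpace.single m (1 : ℝ))
  rw [setIntegral_eq_integral_of_forall_compl_eq_zero fun x hx => by
      rw [image_eq_zero_of_notMem_tsupport fun h => hx (hpU h), zero_mul],
    setIntegral_eq_integral_of_forall_compl_eq_zero fun x hx => by
      rw [image_eq_zero_of_notMem_tsupport fun h => hx (hφU h), mul_zero]]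
  exact integral_mul_fderiv_eq_neg_fderiv_mul_of_integrable
    ((hd.mul hφ.continuous).integrable_of_hasCompactSupport hφc.mul_left)
    ((hp.continuous.mul hd').integrable_of_hasCompactSupport hpc.mul_right)
    ((hp.continuous.mul hφ.continuous).integrable_of_hasCompactSupport hφc.mul_left)
    (fun x _ => hp.differentiable (by simp) x) (fun x _ => hφ.differentiable (by simp) x)

theorem HasWeakLaplacian.linear_comb {Ω : Set Plane} {f₁ f₂ : Plane → ℝ}
    {F₁ F₂ : Fin 2 → Plane → ℝ} {g₁ g₂ : Plane → ℝ} (h₁ : HasWeakLaplacian Ω f₁ F₁ g₁)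
    (h₂ : HasWeakLaplacian Ω f₂ F₂ g₂) (s t : ℝ) :
    HasWeakLaplacian Ω (fun x => s * f₁ x + t * f₂ x) (fun m x => s * F₁ m x + t * F₂ m x)
      (fun x => s * g₁ x + t * g₂ x) := by
  refine ⟨(h₁.memLp_top.const_mul s).add (h₂.memLp_top.const_mul t),
    fun m => (h₁.hasWeakPartial m).linear_comb (h₂.hasWeakPartial m) s t,
    fun m => ((h₁.memLp m).const_mul s).add ((h₂.memLp m).const_mul t),
    (h₁.integrable.const_mul s).add (h₂.integrable.const_mul t), fun φ hφ hφc hφU => ?_⟩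
  have hd := fun m : Fin 2 => continuous_fderiv_apply hφ (EuclideanSpace.single m (1 : ℝ))
  have hdc := fun m : Fin 2 => hasCompactSupport_fderiv_apply hφc (EuclideanSpace.single m (1 : ℝ))
  have hdU := fun m : Fin 2 =>
    (tsupport_fderiv_apply_subset (f := φ) ℝ (EuclideanSpace.single m (1 : ℝ))).trans hφU
  have key : ∀ {F : Fin 2 → Plane → ℝ}, (∀ m, LocallyIntegrableOn (F m) Ω) →
      IntegrableOn (fun x => ∑ m, F m x * fderiv ℝ φ x (EuclideanSpace.single m 1)) Ω := fun hF =>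
    integrable_finsetSum _ fun m _ =>
      (integrable_mul_of_locallyIntegrableOn (hF m) (hd m) (hdc m) (hdU m)).integrableOn
  have key' : ∀ {g : Plane → ℝ}, Integrable g (volume.restrict Ω) →
      IntegrableOn (fun x => g x * φ x) Ω := fun hg =>
    (integrable_mul_of_locallyIntegrableOn (IntegrableOn.locallyIntegrableOn hg) hφ.continuous
      hφc hφU).integrableOn
  have e1 : ∀ x, ∑ m, (s * F₁ m x + t * F₂ m x) * fderiv ℝ φ x (EuclideanSpace.single m 1)
      = s * (∑ m, F₁ m x * fderiv ℝ φ x (EuclideanSpace.single m 1))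
        + t * ∑ m, F₂ m x * fderiv ℝ φ x (EuclideanSpace.single m 1) := fun x => by
    simp only [Fin.sum_univ_two]; ring
  have e2 : ∀ x, (s * g₁ x + t * g₂ x) * φ x = s * (g₁ x * φ x) + t * (g₂ x * φ x) :=
    fun x => by ring
  simp_rw [e1, e2]
  rw [integral_add ((key fun m => (h₁.hasWeakPartial m).2.1).const_mul s)
      ((key fun m => (h₂.hasWeakPartial m).2.1).const_mul t),
    integral_add ((key' h₁.integrable).const_mul s) ((key' h₂.integrable).const_mul t),
    integral_const_mul, integral_const_mul, integral_const_mul, integral_const_mul,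
    h₁.integral_eq φ hφ hφc hφU, h₂.integral_eq φ hφ hφc hφU]
  ring

/-! ### The first variation of the Landau–de Gennes energy -/

/-- The differential of the bulk energy density at `Q` in the direction `P`. -/
def bulkDeriv (a b c : ℝ) (Q P : Mat3) : ℝ :=
  -a ^ 2 * (Q * P).trace - b ^ 2 * (Q ^ 2 * P).trace + c ^ 2 * normSqQ Q * (Q * P).trace

theorem normSqQ_add_smul (Q P : Mat3) (t : ℝ) :
    normSqQ (Q + t • P) = normSqQ Q + t * (2 * (Q * P).trace) + t ^ 2 * normSqQ P := by
  simp only [normSqQ, pow_two, add_mul, mul_add, Matrix.trace_add, Matrix.smul_mul,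
    Matrix.mul_smul, Matrix.trace_smul, smul_eq_mul, Matrix.trace_mul_comm P Q]
  ring

/-- The matrices need not commute; cyclicity of the trace identifies the orderings within each
degree. -/
theorem trace_add_smul_pow_three (Q P : Mat3) (t : ℝ) :
    ((Q + t • P) ^ 3).trace = (Q ^ 3).trace + t * (3 * (Q ^ 2 * P).trace)
      + t ^ 2 * (3 * (Q * P ^ 2).trace) + t ^ 3 * (P ^ 3).trace := by
  have h1 : (Q * P * Q).trace = (Q * Q * P).trace := by
    rw [Matrix.trace_mul_comm, ← mul_assoc]
  have h2 : (P * Q * Q).trace = (Q * Q * P).trace := by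
    rw [mul_assoc, Matrix.trace_mul_comm]
  have h3 : (P * Q * P).trace = (Q * P * P).trace := by
    rw [mul_assoc, Matrix.trace_mul_comm]
  have h4 : (P * P * Q).trace = (Q * P * P).trace := by
    rw [Matrix.trace_mul_comm, ← mul_assoc]
  simp only [pow_succ, pow_zero, one_mul, add_mul, mul_add, Matrix.trace_add, Matrix.smul_mul,
    Matrix.mul_smul, Matrix.trace_smul, smul_eq_mul, h1, h2, h3, h4, ← mul_assoc]
  ring

/-- The coefficients of the polynomial `t ↦ bulk (Q + t P)`. -/
def bulkCoeff (a b c : ℝ) (Q P : Mat3) : Fin 5 → ℝ :=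
  ![bulk a b c Q, bulkDeriv a b c Q P,
    -(a ^ 2 / 2) * normSqQ P - b ^ 2 * (Q * P ^ 2).trace
      + c ^ 2 / 2 * normSqQ Q * normSqQ P + c ^ 2 * (Q * P).trace ^ 2,
    -(b ^ 2 / 3) * (P ^ 3).trace + c ^ 2 * (Q * P).trace * normSqQ P,
    c ^ 2 / 4 * normSqQ P ^ 2]

theorem bulk_add_smul (a b c : ℝ) (Q P : Mat3) (t : ℝ) :
    bulk a b c (Q + t • P) = ∑ n : Fin 5, t ^ (n : ℕ) * bulkCoeff a b c Q P n := by
  simp only [bulk, normSqQ_add_smul, trace_add_smul_pow_three, bulkCoeff, bulkDeriv,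
    Fin.sum_univ_succ, Fin.sum_univ_zero]
  simp
  ring

/-- The integral is itself a polynomial in `t`, so no differentiation under the integral sign is
needed. At least two coefficients are required for a linear one to exist. -/
theorem hasDerivAt_integral_polynomial {α : Type*} [MeasurableSpace α] {μ : Measure α} {n : ℕ}
    {A : Fin (n + 2) → α → ℝ} (hA : ∀ i, Integrable (A i) μ) :
    HasDerivAt (fun t : ℝ => ∫ x, ∑ i : Fin (n + 2), t ^ (i : ℕ) * A i x ∂μ)
      (∫ x, A 1 x ∂μ) 0 := by
  have h1 : ∀ t : ℝ, (∫ x, ∑ i : Fin (n + 2), t ^ (i : ℕ) * A i x ∂μ)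
      = ∑ i : Fin (n + 2), t ^ (i : ℕ) * ∫ x, A i x ∂μ := fun t => by
    rw [integral_finsetSum _ fun i _ => (hA i).const_mul _]
    simp_rw [integral_const_mul]
  simp_rw [h1]
  have h2 := HasDerivAt.fun_sum (u := (Finset.univ : Finset (Fin (n + 2)))) (x := (0 : ℝ))
    (A := fun i t => t ^ (i : ℕ) * ∫ x, A i x ∂μ)
    (A' := fun i => ((i : ℕ) : ℝ) * 0 ^ ((i : ℕ) - 1) * ∫ x, A i x ∂μ)
    fun i _ => (hasDerivAt_pow (i : ℕ) (0 : ℝ)).mul_const _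
  have h3 : ∑ i : Fin (n + 2), ((i : ℕ) : ℝ) * 0 ^ ((i : ℕ) - 1) * ∫ x, A i x ∂μ
      = ∫ x, A 1 x ∂μ := by
    rw [Fin.sum_univ_succ, Fin.sum_univ_succ, Finset.sum_eq_zero]
    · simp
    · intro i _
      simp
  rwa [h3] at h2

section
variable {α : Type*} [MeasurableSpace α] {μ : Measure α}

theorem memLp_top_mul {f g : α → ℝ} (hf : MemLp f ⊤ μ) (hg : MemLp g ⊤ μ) :
    MemLp (fun x => f x * g x) ⊤ μ :=
  hg.mul' hf

theorem memLp_top_sq {f : α → ℝ} (hf : MemLp f ⊤ μ) : MemLp (fun x => f x ^ 2) ⊤ μ := by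
  simpa only [pow_two] using memLp_top_mul hf hf

theorem memLp_top_matrix_mul {A B : α → Mat3} (hA : ∀ i j, MemLp (fun x => A x i j) ⊤ μ)
    (hB : ∀ i j, MemLp (fun x => B x i j) ⊤ μ) (i j : Fin 3) :
    MemLp (fun x => (A x * B x) i j) ⊤ μ := by
  simp only [Matrix.mul_apply]
  exact memLp_finsetSum _ fun l _ => memLp_top_mul (hA i l) (hB l j)

theorem memLp_top_trace {A : α → Mat3} (hA : ∀ i j, MemLp (fun x => A x i j) ⊤ μ) :
    MemLp (fun x => (A x).trace) ⊤ μ := by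
  simp only [Matrix.trace, Matrix.diag]
  exact memLp_finsetSum _ fun i _ => hA i i

theorem memLp_top_bulkCoeff {a b c : ℝ} {Q P : α → Mat3}
    (hQ : ∀ i j, MemLp (fun x => Q x i j) ⊤ μ) (hP : ∀ i j, MemLp (fun x => P x i j) ⊤ μ)
    (n : Fin 5) : MemLp (fun x => bulkCoeff a b c (Q x) (P x) n) ⊤ μ := by
  have hQ2 := memLp_top_matrix_mul hQ hQ
  have hP2 := memLp_top_matrix_mul hP hP
  have tQ := memLp_top_trace hQ2
  have tP := memLp_top_trace hP2
  have tQ3 := memLp_top_trace (memLp_top_matrix_mul hQ2 hQ)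
  have tP3 := memLp_top_trace (memLp_top_matrix_mul hP2 hP)
  have tQP := memLp_top_trace (memLp_top_matrix_mul hQ hP)
  have tQQP := memLp_top_trace (memLp_top_matrix_mul hQ2 hP)
  have tQPP := memLp_top_trace (memLp_top_matrix_mul hQ hP2)
  simp only [bulkCoeff, bulk, bulkDeriv, normSqQ, pow_succ (_ : Mat3), pow_zero (_ : Mat3), one_mul]
  fin_cases n
  · exact ((tQ.const_mul _).sub (tQ3.const_mul _)).add ((memLp_top_sq tQ).const_mul _)
  · exact ((tQP.const_mul _).sub (tQQP.const_mul _)).add (memLp_top_mul (tQ.const_mul _) tQP)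
  · exact (((tP.const_mul _).sub (tQPP.const_mul _)).add
      (memLp_top_mul (tQ.const_mul _) tP)).add ((memLp_top_sq tQP).const_mul _)
  · exact (tP3.const_mul _).add (memLp_top_mul (tQP.const_mul _) tP)
  · exact (memLp_top_sq tP).const_mul _
end

/-- A bounded field with finite Dirichlet energy which solves the Euler–Lagrange equation in the
sense of distributions is a critical point of the Landau–de Gennes energy. -/
theorem isCriticalPoint_of_hasWeakLaplacian {L a b c : ℝ} {Ω : Set Plane} (hΩ : IsOpen Ω)
    (hΩfin : volume Ω < ⊤) {Y : Plane → Mat3} {F : Fin 3 → Fin 3 → Fin 2 → Plane → ℝ}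
    {g : Fin 3 → Fin 3 → Plane → ℝ} (hYQ : ∀ x ∈ Ω, Y x ∈ QTensors)
    (hY : ∀ i j, HasWeakLaplacian Ω (fun x => Y x i j) (F i j) (g i j))
    (hEL : ∀ᵐ x ∂volume.restrict Ω, ∀ P ∈ QTensors,
      ∑ i, ∑ j, g i j x * P i j = 1 / L * bulkDeriv a b c (Y x) P) :
    IsCriticalPoint L a b c Ω Y := by
  have hfin : IsFiniteMeasure (volume.restrict Ω) :=
    ⟨by rwa [Measure.restrict_apply_univ]⟩
  refine ⟨⟨hYQ, fun i j => ⟨(hY i j).memLp_top.mono_exponent le_top, fun m =>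
    ⟨F i j m, (hY i j).hasWeakPartial m, (hY i j).memLp m⟩⟩⟩, fun P hP => ?_⟩
  set D : Fin 3 → Fin 3 → Fin 2 → Plane → ℝ := fun i j m x =>
    fderiv ℝ (fun y => P y i j) x (EuclideanSpace.single m 1) with hD
  have hDc : ∀ i j m, Continuous (D i j m) := fun i j m =>
    continuous_fderiv_apply (hP.2 i j).1 _
  have hDs : ∀ i j m, HasCompactSupport (D i j m) := fun i j m =>
    hasCompactSupport_fderiv_apply (hP.2 i j).2.1 _
  have hPtop : ∀ i j, MemLp (fun x => P x i j) ⊤ (volume.restrict Ω) := fun i j =>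
    ((hP.2 i j).1.continuous.memLp_top_of_hasCompactSupport (hP.2 i j).2.1 _)
  have hD2 : ∀ i j m, MemLp (D i j m) 2 (volume.restrict Ω) := fun i j m =>
    (((hDc i j m).memLp_top_of_hasCompactSupport (hDs i j m) _)).mono_exponent le_top
  have hYtop : ∀ i j, MemLp (fun x => Y x i j) ⊤ (volume.restrict Ω) := fun i j =>
    (hY i j).memLp_top
  -- The coefficients in `t` of `½ |∇Y + t ∇P|²`, padded with zeros to the degree four of the bulk
  -- part.
  set G : Fin 5 → Plane → ℝ := ![
    fun x => 1 / 2 * ∑ m, ∑ i, ∑ j, F i j m x ^ 2,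
    fun x => ∑ m, ∑ i, ∑ j, F i j m x * D i j m x,
    fun x => 1 / 2 * ∑ m, ∑ i, ∑ j, D i j m x ^ 2, 0, 0] with hG
  have hGi : ∀ n, Integrable (G n) (volume.restrict Ω) := by
    intro n
    fin_cases n
    · exact (integrable_finsetSum _ fun m _ => integrable_finsetSum _ fun i _ =>
        integrable_finsetSum _ fun j _ => ((hY i j).memLp m).integrable_sq).const_mul _
    · have h : Integrable (fun x => ∑ m, ∑ i, ∑ j, F i j m x * D i j m x)
          (volume.restrict Ω) :=
        integrable_finsetSum _ fun m _ => integrable_finsetSum _ fun i _ =>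
          integrable_finsetSum _ fun j _ => ((hY i j).memLp m).integrable_mul (hD2 i j m)
      exact h
    · exact (integrable_finsetSum _ fun m _ => integrable_finsetSum _ fun i _ =>
        integrable_finsetSum _ fun j _ => (hD2 i j m).integrable_sq).const_mul _
    · exact integrable_zero _ _ _
    · exact integrable_zero _ _ _
  have hBi : ∀ n, Integrable (fun x => bulkCoeff a b c (Y x) (P x) n) (volume.restrict Ω) :=
    fun n => (memLp_top_bulkCoeff hYtop hPtop n).integrable le_top
  have hE : ∀ t : ℝ, energy L a b c Ω (fun x => Y x + t • P x)
      = ∫ x in Ω, ∑ n : Fin 5, t ^ (n : ℕ) *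
        (G n x + 1 / L * bulkCoeff a b c (Y x) (P x) n) := by
    intro t
    refine integral_congr_ae ?_
    have h1 : ∀ᵐ x ∂volume.restrict Ω, ∀ m i j,
        weakPartial Ω m (fun y => (Y y + t • P y) i j) x = 1 * F i j m x + t * D i j m x := by
      refine ae_all_iff.2 fun m => ae_all_iff.2 fun i => ae_all_iff.2 fun j => ?_
      have h2 := ((hY i j).hasWeakPartial m).linear_comb
        (hasWeakPartial_fderiv m (hP.2 i j).1 (hP.2 i j).2.1 (hP.2 i j).2.2) 1 t
      have h3 : (fun y => (Y y + t • P y) i j) = fun y => 1 * Y y i j + t * P y i j := by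
        ext y; simp
      rw [h3]
      exact h2.weakPartial_ae_eq hΩ
    filter_upwards [h1] with x hx
    simp only [hx, bulk_add_smul, mul_add, Finset.sum_add_distrib]
    congr 1
    · simp only [hG, Fin.sum_univ_succ, Fin.sum_univ_zero]
      simp
      ring
    · rw [Finset.mul_sum]
      exact Finset.sum_congr rfl fun n _ => by ring
  have hder : HasDerivAt (fun t : ℝ => ∫ x in Ω, ∑ n : Fin 5, t ^ (n : ℕ) *
      (G n x + 1 / L * bulkCoeff a b c (Y x) (P x) n))
      (∫ x in Ω, (G 1 x + 1 / L * bulkCoeff a b c (Y x) (P x) 1)) 0 :=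
    hasDerivAt_integral_polynomial (n := 3) fun n => (hGi n).add ((hBi n).const_mul (1 / L))
  -- Each entry of `P` serves as a test function for the weak Laplacian of the same entry of `Y`.
  -- This turns `∫ ∇Y · ∇P` into `-∫ g · P`, which the bulk term cancels by the Euler-Lagrange
  -- equation.
  have hzero : ∫ x in Ω, (G 1 x + 1 / L * bulkCoeff a b c (Y x) (P x) 1) = 0 := by
    have h1 : ∀ x, G 1 x = ∑ i, ∑ j, ∑ m, F i j m x * D i j m x := fun x => by
      simp only [hG, Matrix.cons_val_one, Matrix.cons_val_zero]
      rw [Finset.sum_comm]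
      exact Finset.sum_congr rfl fun i _ => Finset.sum_comm
    have h2 : ∫ x in Ω, G 1 x = -∫ x in Ω, ∑ i, ∑ j, g i j x * P x i j := by
      simp_rw [h1]
      have hgP : ∀ i j, Integrable (fun x => g i j x * P x i j) (volume.restrict Ω) := fun i j =>
        (memLp_one_iff_integrable.2 (hY i j).integrable).integrable_mul (hPtop i j)
      have hFD : ∀ i j, Integrable (fun x => ∑ m, F i j m x * D i j m x) (volume.restrict Ω) :=
        fun i j => integrable_finsetSum _ fun m _ => ((hY i j).memLp m).integrable_mul (hD2 i j m)
      rw [integral_finsetSum _ fun i _ => integrable_finsetSum _ fun j _ => hFD i j,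
        integral_finsetSum _ fun i _ => integrable_finsetSum _ fun j _ => hgP i j,
        ← Finset.sum_neg_distrib]
      refine Finset.sum_congr rfl fun i _ => ?_
      rw [integral_finsetSum _ fun j _ => hFD i j, integral_finsetSum _ fun j _ => hgP i j,
        ← Finset.sum_neg_distrib]
      exact Finset.sum_congr rfl fun j _ =>
        (hY i j).integral_eq _ (hP.2 i j).1 (hP.2 i j).2.1 (hP.2 i j).2.2
    rw [integral_add (hGi 1) ((hBi 1).const_mul _), h2, neg_add_eq_zero]
    refine integral_congr_ae ?_
    filter_upwards [hEL] with x hx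
    exact hx _ (hP.1 x)
  rw [hzero] at hder
  simp_rw [hE]
  exact hder

/-! ### Block tensors and the ansatz -/

/-- The `Q`-tensors that are block diagonal with respect to `ℝ² ⊕ ℝ e₃`. -/
def blockTensor (p q s : ℝ) : Mat3 :=
  !![s + p, q, 0; q, s - p, 0; 0, 0, -(2 * s)]

/-- Linearity in the three parameters, written with a factor `1` to match two nested uses of
`linear_comb`. -/
theorem blockTensor_apply (p q s : ℝ) (i j : Fin 3) :
    blockTensor p q s i j = 1 * (blockTensor 1 0 0 i j * p + blockTensor 0 1 0 i j * q)
      + blockTensor 0 0 1 i j * s := by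
  fin_cases i <;> fin_cases j <;> simp [blockTensor] <;> ring

theorem blockTensor_mem (p q s : ℝ) : blockTensor p q s ∈ QTensors := by
  constructor
  · ext i j
    fin_cases i <;> fin_cases j <;> simp [blockTensor]
  · simp [blockTensor, Matrix.trace_fin_three]
    ring

theorem normSqQ_blockTensor (p q s : ℝ) :
    normSqQ (blockTensor p q s) = 2 * p ^ 2 + 2 * q ^ 2 + 6 * s ^ 2 := by
  simp [normSqQ, blockTensor, Matrix.trace_fin_three, pow_two]
  ring

/-- The square of a block tensor is a block tensor plus a multiple of the identity, and the identity
pairs to zero with a traceless `P`. So the bulk gradient keeps the block form, with `p` and `q`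
scaled by one common factor: this is why the ansatz is consistent with the full system. -/
theorem bulkDeriv_blockTensor (a b c p q s : ℝ) {P : Mat3} (hP : P ∈ QTensors) :
    bulkDeriv a b c (blockTensor p q s) P = ∑ i, ∑ j, blockTensor
      (p * (-a ^ 2 - 2 * b ^ 2 * s + c ^ 2 * (2 * p ^ 2 + 2 * q ^ 2 + 6 * s ^ 2)))
      (q * (-a ^ 2 - 2 * b ^ 2 * s + c ^ 2 * (2 * p ^ 2 + 2 * q ^ 2 + 6 * s ^ 2)))
      (s * (-a ^ 2 + b ^ 2 * s + c ^ 2 * (2 * p ^ 2 + 2 * q ^ 2 + 6 * s ^ 2))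
        - b ^ 2 / 3 * (p ^ 2 + q ^ 2)) i j * P i j := by
  have h1 : P 1 0 = P 0 1 := congrFun (congrFun hP.1 0) 1
  have h2 : P 2 2 = -P 0 0 - P 1 1 := by
    have := hP.2
    rw [Matrix.trace_fin_three] at this
    linarith
  simp only [bulkDeriv, normSqQ_blockTensor, Matrix.trace_fin_three, pow_two (blockTensor p q s),
    Matrix.mul_apply, Fin.sum_univ_three]
  simp [blockTensor, h1, h2]
  ring

theorem HasWeakLaplacian.const_mul {Ω : Set Plane} {f : Plane → ℝ} {F : Fin 2 → Plane → ℝ}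
    {g : Plane → ℝ} (h : HasWeakLaplacian Ω f F g) (s : ℝ) :
    HasWeakLaplacian Ω (fun x => s * f x) (fun m x => s * F m x) (fun x => s * g x) := by
  simpa using h.linear_comb h s 0

theorem hasWeakLaplacian_blockTensor {Ω : Set Plane} {p q s : Plane → ℝ}
    {P Q S : Fin 2 → Plane → ℝ} {p' q' s' : Plane → ℝ} (hp : HasWeakLaplacian Ω p P p')
    (hq : HasWeakLaplacian Ω q Q q') (hs : HasWeakLaplacian Ω s S s') (i j : Fin 3) :
    HasWeakLaplacian Ω (fun x => blockTensor (p x) (q x) (s x) i j)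
      (fun m x => blockTensor (P m x) (Q m x) (S m x) i j)
      (fun x => blockTensor (p' x) (q' x) (s' x) i j) := by
  have h1 : ∀ p q s : Plane → ℝ, (fun x => blockTensor (p x) (q x) (s x) i j) = fun x =>
      1 * (blockTensor 1 0 0 i j * p x + blockTensor 0 1 0 i j * q x)
        + blockTensor 0 0 1 i j * s x := fun p q s => funext fun x => blockTensor_apply _ _ _ i j
  have h2 : (fun m x => blockTensor (P m x) (Q m x) (S m x) i j) = fun m x =>
      1 * (blockTensor 1 0 0 i j * P m x + blockTensor 0 1 0 i j * Q m x)
        + blockTensor 0 0 1 i j * S m x := funext fun m => h1 _ _ _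
  rw [h1, h1, h2]
  exact (hp.linear_comb hq _ _).linear_comb hs _ _

theorem mode_zero (x : Plane) : mode 0 0 x = 1 := by simp [mode]

/-- By the double-angle formulas the half-integer director enters only through `cos kφ` and `sin
kφ`, the latter being the mode with phase `-π/2`; hence `Y` is single-valued for odd `k` too. -/
theorem ansatz_eq (k : ℤ) (u v : ℝ → ℝ) (x : Plane) :
    ansatz k u v x = blockTensor (√2 / 2 * (u ‖x‖ * mode k 0 x))
      (√2 / 2 * (u ‖x‖ * mode k (-(Real.pi / 2)) x)) (-(√6 / 6) * (v ‖x‖ * mode 0 0 x)) := by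
  have h6 : √(3 / 2) = √6 / 2 := by
    rw [Real.sqrt_eq_iff_eq_sq (by norm_num) (by positivity), div_pow,
      Real.sq_sqrt (by norm_num)]
    norm_num
  have hc : Real.cos (k * angle x) = 2 * Real.cos (k / 2 * angle x) ^ 2 - 1 := by
    rw [← Real.cos_two_mul]; ring_nf
  have hs : Real.cos (k * angle x + -(Real.pi / 2))
      = 2 * Real.sin (k / 2 * angle x) * Real.cos (k / 2 * angle x) := by
    rw [← sub_eq_add_neg, Real.cos_sub_pi_div_two, ← Real.sin_two_mul]; ring_nf
  have hcs := Real.sin_sq_add_cos_sq (k / 2 * angle x)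
  rw [mode_zero]
  simp only [mode, add_zero, hc, hs]
  ext i j
  fin_cases i <;> fin_cases j <;>
    simp [ansatz, blockTensor, Fn, F3, director, h6] <;>
    first | ring1 | linear_combination (u ‖x‖ * √2) * hcs

theorem norm_polarPoint {R : ℝ} (hR : 0 < R) (φ : ℝ) : ‖polarPoint R φ‖ = R := by
  rw [← sq_eq_sq₀ (norm_nonneg _) hR.le, sq_norm_eq]
  simp only [polarPoint, Matrix.cons_val_zero, Matrix.cons_val_one]
  linear_combination R ^ 2 * Real.sin_sq_add_cos_sq φ

theorem mode_polarPoint (k : ℤ) (α : ℝ) {R : ℝ} (hR : 0 < R) (φ : ℝ) :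
    mode k α (polarPoint R φ) = Real.cos (k * φ + α) := by
  have hn := norm_polarPoint hR φ
  have h0 : polarPoint R φ ≠ 0 := by
    rw [← norm_ne_zero_iff, hn]; exact hR.ne'
  have hRc : (R : ℂ) ≠ 0 := by exact_mod_cast hR.ne'
  have h1 : toComplex (polarPoint R φ) / R = Complex.exp (φ * Complex.I) := by
    rw [div_eq_iff hRc, Complex.exp_mul_I]
    apply Complex.ext <;> simp [toComplex, polarPoint, mul_comm] <;> exact Or.inl rfl
  rw [mode_eq k α h0, hn, h1, ← Complex.exp_int_mul, ← Complex.exp_add,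
    show (α : ℂ) * Complex.I + k * (φ * Complex.I) = ((k * φ + α : ℝ) : ℂ) * Complex.I by
      push_cast; ring, Complex.exp_ofReal_mul_I_re]

theorem ansatz_polarPoint {R s : ℝ} (hR : 0 < R) (k : ℤ) {u v : ℝ → ℝ}
    (hu : u R = 1 / √2 * s) (hv : v R = -(1 / √6) * s) (φ : ℝ) :
    ansatz k u v (polarPoint R φ) = s • Qk k φ := by
  have e2 : ∀ z, √2 / 2 * (1 / √2 * s * z) = s / 2 * z := fun z => by field_simp
  have e6 : -(√6 / 6) * (-(1 / √6) * s) = s / 6 := by field_simp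
  have hc : Real.cos (k * φ) = 2 * Real.cos (k / 2 * φ) ^ 2 - 1 := by
    rw [← Real.cos_two_mul]; ring_nf
  have hs : Real.cos (k * φ + -(Real.pi / 2))
      = 2 * Real.sin (k / 2 * φ) * Real.cos (k / 2 * φ) := by
    rw [← sub_eq_add_neg, Real.cos_sub_pi_div_two, ← Real.sin_two_mul]; ring_nf
  have hcs := Real.sin_sq_add_cos_sq (k / 2 * φ)
  rw [ansatz_eq, mode_zero, mode_polarPoint k _ hR, mode_polarPoint k _ hR, norm_polarPoint hR,
    hu, hv, add_zero, hc, hs, mul_one, e6, e2, e2]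
  ext i j
  fin_cases i <;> fin_cases j <;>
    simp [blockTensor, Qk, director] <;>
    first | ring1 | linear_combination -s * hcs

/-- The modes are bounded and continuous off the origin; at the origin the factor `u(|x|) → 0`
absorbs their discontinuity. -/
theorem continuousOn_ansatz {R : ℝ} (k : ℤ) {u v : ℝ → ℝ} (hu : ContinuousOn u (Icc 0 R))
    (hu0 : u 0 = 0) (hv : ContinuousOn v (Icc 0 R)) :
    ContinuousOn (ansatz k u v) (Metric.closedBall 0 R) := by
  have hmaps : MapsTo (fun x : Plane => ‖x‖) (Metric.closedBall 0 R) (Icc 0 R) := fun x hx =>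
    ⟨norm_nonneg x, by simpa using hx⟩
  have hun : ContinuousOn (fun x : Plane => u ‖x‖) (Metric.closedBall 0 R) :=
    hu.comp continuous_norm.continuousOn hmaps
  have hvn : ContinuousOn (fun x : Plane => v ‖x‖) (Metric.closedBall 0 R) :=
    hv.comp continuous_norm.continuousOn hmaps
  have hmode : ∀ α, ContinuousOn (fun x : Plane => u ‖x‖ * mode k α x)
      (Metric.closedBall 0 R) := by
    intro α x hx
    by_cases hx0 : x = 0
    · subst hx0
      have h1 : Tendsto (fun x : Plane => |u ‖x‖|) (𝓝[Metric.closedBall 0 R] 0) (𝓝 0) := by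
        have h := (hun 0 hx).abs
        rw [ContinuousWithinAt] at h
        simpa [hu0] using h
      have h2 : u ‖(0 : Plane)‖ * mode k α 0 = 0 := by rw [norm_zero, hu0, zero_mul]
      rw [ContinuousWithinAt, h2]
      refine squeeze_zero_norm (fun y => ?_) h1
      rw [norm_mul, Real.norm_eq_abs, Real.norm_eq_abs]
      exact mul_le_of_le_one_right (abs_nonneg _) (abs_mode_le k α y)
    · exact (hun x hx).mul (((continuousOn_mode k α).continuousAt
        (isOpen_compl_singleton.mem_nhds hx0)).continuousWithinAt)
  refine continuousOn_pi.2 fun i => continuousOn_pi.2 fun j => ?_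
  simp_rw [ansatz_eq, mode_zero, mul_one]
  have h1 : ∀ p q s : Plane → ℝ, (fun x => blockTensor (p x) (q x) (s x) i j) = fun x =>
      1 * (blockTensor 1 0 0 i j * p x + blockTensor 0 1 0 i j * q x)
        + blockTensor 0 0 1 i j * s x := fun p q s => funext fun x => blockTensor_apply _ _ _ i j
  rw [h1]
  exact (continuousOn_const.mul ((continuousOn_const.mul (continuousOn_const.mul (hmode _))).add
    (continuousOn_const.mul (continuousOn_const.mul (hmode _))))).add
    (continuousOn_const.mul (continuousOn_const.mul hvn))

/-! ### Criticality of the ansatz -/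

theorem exists_abs_le_of_continuousOn_Icc {R : ℝ} {f : ℝ → ℝ} (hf : ContinuousOn f (Icc 0 R)) :
    ∃ B, ∀ ρ ∈ Ioo 0 R, |f ρ| ≤ B := by
  obtain ⟨B, hB⟩ := isCompact_Icc.exists_bound_of_continuousOn hf
  exact ⟨B, fun ρ hρ => hB ρ (Ioo_subset_Icc_self hρ)⟩

/-- A mode whose profile has finite reduced energy and bounded radial Laplacian `G`. -/
theorem hasWeakLaplacian_mode_of_finiteDirichlet {R : ℝ} {k : ℤ} (α : ℝ) {h G : ℝ → ℝ}
    (hd : ContDiffOn ℝ ∞ h (Ioo 0 R)) (hc : ContinuousOn h (Icc 0 R))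
    (hD : FiniteDirichlet R h)
    (hi : IntegrableOn (fun ρ => (k : ℝ) ^ 2 * h ρ ^ 2 / ρ) (Ioo 0 R))
    (hG : ContinuousOn G (Icc 0 R))
    (heq : ∀ ρ ∈ Ioo 0 R,
      deriv (deriv h) ρ + deriv h ρ / ρ - (k : ℝ) ^ 2 * h ρ / ρ ^ 2 = G ρ) :
    HasWeakLaplacian (Metric.ball 0 R) (fun x => h ‖x‖ * mode k α x)
      (modeGrad k α h (deriv h)) (fun x => (deriv (deriv h) ‖x‖ + deriv h ‖x‖ / ‖x‖
        - (k : ℝ) ^ 2 * h ‖x‖ / ‖x‖ ^ 2) * mode k α x) := by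
  obtain ⟨B, hB⟩ := exists_abs_le_of_continuousOn_Icc hc
  obtain ⟨B', hB'⟩ := exists_abs_le_of_continuousOn_Icc hG
  have hd1 : ContDiffOn ℝ ∞ (deriv h) (Ioo 0 R) := hd.deriv_of_isOpen isOpen_Ioo (by simp)
  have hd2 : ContDiffOn ℝ ∞ (deriv (deriv h)) (Ioo 0 R) :=
    hd1.deriv_of_isOpen isOpen_Ioo (by simp)
  have hda : ∀ {f : ℝ → ℝ}, ContDiffOn ℝ ∞ f (Ioo 0 R) → ∀ ρ ∈ Ioo 0 R,
      HasDerivAt f (deriv f ρ) ρ := fun hf ρ hρ =>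
    ((hf.contDiffAt (isOpen_Ioo.mem_nhds hρ)).differentiableAt (by simp)).hasDerivAt
  refine hasWeakLaplacian_mode α (hda hd) (hda hd1) hd2.continuousOn hB ?_ hi (B' := B')
    fun ρ hρ => by rw [heq ρ hρ]; exact hB' ρ hρ
  have hsq : IntegrableOn (fun ρ => (√ρ * deriv h ρ) ^ 2) (Ioo 0 R) := hD.memLp.integrable_sq
  refine hsq.congr_fun (fun ρ hρ => ?_) measurableSet_Ioo
  simp only [mul_pow, Real.sq_sqrt hρ.1.le]
  ring

/-- The right-hand sides of the ODEs are continuous on `[0, R]`, which bounds the Laplacians of the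
modes; what is left is to match them with the bulk gradient of the block tensor. -/
theorem isCriticalPoint_ansatz {L R a b c : ℝ} {k : ℤ} {u v : ℝ → ℝ}
    (hS : (u, v) ∈ admissible R a b c) (hu : ContDiffOn ℝ ∞ u (Ioo 0 R))
    (hu' : ContinuousOn u (Icc 0 R)) (hv : ContDiffOn ℝ ∞ v (Ioo 0 R))
    (hv' : ContinuousOn v (Icc 0 R)) (hode : SolvesODE L R a b c k u v) :
    IsCriticalPoint L a b c (Metric.ball 0 R) (ansatz k u v) := by
  obtain ⟨hDu, hDv, hur, -, -⟩ := mem_admissible_iff.1 hS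
  have hku : IntegrableOn (fun ρ => (k : ℝ) ^ 2 * u ρ ^ 2 / ρ) (Ioo 0 R) := by
    have hsq : IntegrableOn (fun ρ => (k : ℝ) ^ 2 * (u ρ / √ρ) ^ 2) (Ioo 0 R) :=
      hur.integrable_sq.const_mul _
    refine hsq.congr_fun (fun ρ hρ => ?_) measurableSet_Ioo
    simp only [div_pow, Real.sq_sqrt hρ.1.le]
    ring
  have hLu := fun α => hasWeakLaplacian_mode_of_finiteDirichlet α hu hu' hDu hku
    (by fun_prop) fun ρ hρ => (hode ρ hρ).1
  -- The component `v` is the mode with `k = 0`, for which the weighted condition at the origin is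
  -- void.
  have hLv := hasWeakLaplacian_mode_of_finiteDirichlet (k := 0) 0 hv hv' hDv (by simp)
    (G := fun r => v r / L * (-a ^ 2 - 1 / √6 * b ^ 2 * v r + c ^ 2 * ((u r) ^ 2 + (v r) ^ 2))
          + 1 / (√6 * L) * b ^ 2 * (u r) ^ 2)
    (by fun_prop) fun ρ hρ => by simpa using (hode ρ hρ).2
  refine isCriticalPoint_of_hasWeakLaplacian Metric.isOpen_ball measure_ball_lt_top
    (fun x _ => by rw [ansatz_eq]; exact blockTensor_mem _ _ _)
    (fun i j => by
      simp_rw [ansatz_eq]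
      exact hasWeakLaplacian_blockTensor ((hLu 0).const_mul (√2 / 2))
        ((hLu (-(Real.pi / 2))).const_mul (√2 / 2)) (hLv.const_mul (-(√6 / 6))) i j) ?_
  filter_upwards [ae_restrict_mem measurableSet_ball,
    ae_restrict_of_ae (Measure.ae_ne volume 0)] with x hx hx0 P hP
  have hρ : ‖x‖ ∈ Ioo 0 R := ⟨norm_pos_iff.2 hx0, by simpa using hx⟩
  obtain ⟨e1, e2⟩ := hode _ hρ
  have hcs : mode k 0 x ^ 2 + mode k (-(Real.pi / 2)) x ^ 2 = 1 := by
    simp only [mode, add_zero, ← sub_eq_add_neg, Real.cos_sub_pi_div_two, Real.cos_sq_add_sin_sq]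
  have h2 : √2 ^ 2 = 2 := Real.sq_sqrt (by norm_num)
  have h6 : √6 ^ 2 = 6 := Real.sq_sqrt (by norm_num)
  have h23 : √(2 / 3) = √6 / 3 := by
    rw [Real.sqrt_eq_iff_eq_sq (by norm_num) (by positivity), div_pow, h6]
    norm_num
  have h6i : 1 / √6 = √6 / 6 := by
    field_simp
    linarith
  have h6L : 1 / (√6 * L) = √6 / 6 / L := by rw [← h6i, div_div]
  have e2' : deriv (deriv v) ‖x‖ + deriv v ‖x‖ / ‖x‖ - ((0 : ℤ) : ℝ) ^ 2 * v ‖x‖ / ‖x‖ ^ 2 = _ :=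
    (by simp : _ = deriv (deriv v) ‖x‖ + deriv v ‖x‖ / ‖x‖).trans e2
  rw [ansatz_eq, bulkDeriv_blockTensor _ _ _ _ _ _ hP, Finset.mul_sum]
  refine Finset.sum_congr rfl fun i _ => ?_
  rw [Finset.mul_sum]
  refine Finset.sum_congr rfl fun j _ => ?_
  rw [e1, e2', h23, h6i, h6L, mode_zero, ← mul_assoc, blockTensor_apply, blockTensor_apply (_ * _)]
  set C := mode k 0 x
  set S := mode k (-(Real.pi / 2)) x
  -- The identity `|Y|² = u² + v²`: the tensors `F_n` and `F₃` are orthonormal.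
  have hN : 2 * (√2 / 2 * (u ‖x‖ * C)) ^ 2 + 2 * (√2 / 2 * (u ‖x‖ * S)) ^ 2
      + 6 * (-(√6 / 6) * (v ‖x‖ * 1)) ^ 2 = u ‖x‖ ^ 2 + v ‖x‖ ^ 2 := by
    linear_combination (1 / 2 * u ‖x‖ ^ 2 * (C ^ 2 + S ^ 2)) * h2 + u ‖x‖ ^ 2 * hcs
      + 1 / 6 * v ‖x‖ ^ 2 * h6
  have hpq : (√2 / 2 * (u ‖x‖ * C)) ^ 2 + (√2 / 2 * (u ‖x‖ * S)) ^ 2 = u ‖x‖ ^ 2 / 2 := by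
    linear_combination (1 / 4 * u ‖x‖ ^ 2 * (C ^ 2 + S ^ 2)) * h2 + u ‖x‖ ^ 2 / 2 * hcs
  rw [hN, hpq]
  linear_combination (-(1 / 36) * u ‖x‖ ^ 2 * b ^ 2 / L * blockTensor 0 0 1 i j * P i j) * h6

end LdG

end

theorem theorem3p1 (a b c : ℝ) (ha : 0 < a ^ 2) (hc : 0 < c ^ 2) (k : ℤ) (hk : k ≠ 0)
    (L R : ℝ) (hL : 0 < L) (hR : 0 < R) :
    ∃ u v : ℝ → ℝ,
      -- `(u, v)` is a global minimiser of the reduced energy on `S`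
      ((u, v) ∈ LdG.admissible R a b c ∧
        ∀ p ∈ LdG.admissible R a b c,
          LdG.reducedEnergy L R a b c k u v ≤ LdG.reducedEnergy L R a b c k p.1 p.2) ∧
      -- regularity
      ContDiffOn ℝ ∞ u (Ioo 0 R) ∧ ContinuousOn u (Icc 0 R) ∧
      ContDiffOn ℝ ∞ v (Ioo 0 R) ∧ ContDiffOn ℝ 1 v (Icc 0 R) ∧
      -- the ODE system with its boundary conditions
      LdG.SolvesODE L R a b c k u v ∧
      u 0 = 0 ∧ HasDerivWithinAt v 0 (Icc 0 R) 0 ∧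
      u R = 1 / √2 * LdG.sPlus a b c ∧ v R = -(1 / √6) * LdG.sPlus a b c ∧
      -- `Y` is a critical point of the Landau–de Gennes energy on the disk with the boundary
      -- values `s₊ Q_k`
      LdG.IsCriticalPoint L a b c (Metric.ball 0 R) (LdG.ansatz k u v) ∧
      ContinuousOn (LdG.ansatz k u v) (Metric.closedBall 0 R) ∧
      ∀ φ : ℝ, LdG.ansatz k u v (LdG.polarPoint R φ) = LdG.sPlus a b c • LdG.Qk k φ := by
  obtain ⟨u, v, hS, hmin, hu, hu', hv, hv', hode, hu0, hv0⟩ :=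
    LdG.exists_regular_minimizer (a := a) (b := b) hc hk hL hR
  have huR : u R = 1 / √2 * LdG.sPlus a b c := by
    rw [(LdG.mem_admissible_iff.1 hS).2.2.2.1]
    ring
  have hvR : v R = -(1 / √6) * LdG.sPlus a b c := by
    rw [(LdG.mem_admissible_iff.1 hS).2.2.2.2]
    ring
  exact ⟨u, v, ⟨hS, hmin⟩, hu, hu', hv, hv', hode, hu0, hv0, huR, hvR,
    LdG.isCriticalPoint_ansatz hS hu hu' hv hv'.continuousOn hode,
    LdG.continuousOn_ansatz k hu' hu0 hv'.continuousOn,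
    fun φ => LdG.ansatz_polarPoint hR k huR hvR φ⟩
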